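/- Let $k=\mathbb{F}_q$ be a finite field with $q$ elements and $\overline{\mathbb{F}_q}$ an algebraic closure, and let $\mathbb{P}^m$ be projective $m$-space over $\overline{\mathbb{F}_q}$. A hypersurface of degree $d$ in $\mathbb{P}^m$ is the zero set in $\mathbb{P}^m$ of a nonzero homogeneous polynomial of degree $d$ in $m+1$ variables with coefficients in $\mathbb{F}_q$; a hyperplane is the zero set of a nonzero linear form with coefficients in $\mathbb{F}_q$. For $n\ge 0$ put $p_n=|\mathbb{P}^n(\mathbb{F}_q)|=q^n+q^{n-1}+\dots+1$. Let $m\ge 2$ and $3\le d\le q$ be integers, and let $\mathcal{X}\subset\mathbb{P}^m$ be a hypersurface of degree $d$ that contains a hyperplane. Denote by $\mathcal{X}(\mathbb{F}_q)$ its set of $\mathbb{F}_q$-rational points. (1) If $|\mathcal{X}(\mathbb{F}_q)|<dq^{m-1}+p_{m-2}$ (that is, $\mathcal{X}$ does not attain Serre's bound), then $$|\mathcal{X}(\mathbb{F}_q)|\le dq^{m-1}+p_{m-2}-(d-2)q^{m-2}.$$ (2) If $|\mathcal{X}(\mathbb{F}_q)|=dq^{m-1}+p_{m-2}-(d-2)q^{m-2}$,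 then $\mathcal{X}$ is a union of hyperplanes (each defined over $\mathbb{F}_q$). -/

import Mathlib

open scoped LinearAlgebra.Projectivization

/-- `projCount q n = q ^ n + ⋯ + q + 1`, the number of points of projective `n`-space over a field
with `q` elements. -/
def projCount (q n : ℕ) : ℕ := ∑ i ∈ Finset.range (n + 1), q ^ i

/-- Geometric projective `m`-space: the points have coordinates in the field `K`. -/
abbrev ProjSpace (K : Type*) [Field K] (m : ℕ) : Type _ := ℙ K (Fin (m + 1) → K)

section

variable {k K : Type*} [Field k] [Field K] [Algebra k K] {m : ℕ}

/-- The zero set in `ProjSpace K m` of a polynomial `P` over `k` in `m + 1` variables. It is used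
only for homogeneous `P`, where it does not depend on the representative
(see `mk_mem_projZeroSet_iff`). -/
def projZeroSet (K : Type*) [Field K] [Algebra k K] (P : MvPolynomial (Fin (m + 1)) k) :
    Set (ProjSpace K m) :=
  {x | MvPolynomial.aeval x.rep P = 0}

/-- For homogeneous `P`, vanishing may be tested on any homogeneous coordinate vector. -/
theorem mk_mem_projZeroSet_iff {P : MvPolynomial (Fin (m + 1)) k} {d : ℕ}
    (hP : P.IsHomogeneous d) (v : Fin (m + 1) → K) (hv : v ≠ 0) :
    Projectivization.mk K v hv ∈ projZeroSet K P ↔ MvPolynomial.aeval v P = 0 := by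
  obtain ⟨a, ha⟩ := Projectivization.exists_smul_eq_mk_rep K v hv
  have h2 : ((a : K) • v) = (Projectivization.mk K v hv).rep := ha
  have h : MvPolynomial.aeval ((a : K) • v) P = (a : K) ^ d * MvPolynomial.aeval v P := by
    rw [MvPolynomial.aeval_def, MvPolynomial.aeval_def, MvPolynomial.eval₂_eq,
      MvPolynomial.eval₂_eq, Finset.mul_sum]
    refine Finset.sum_congr rfl fun e he => ?_
    have hd : ∑ i ∈ e.support, e i = d := by
      have := hP (MvPolynomial.mem_support_iff.mp he)
      simpa [Finsupp.weight_apply, Finsupp.sum] using this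
    simp only [Pi.smul_apply, smul_eq_mul, mul_pow, Finset.prod_mul_distrib]
    rw [Finset.prod_pow_eq_pow_sum, hd]
    ring
  show MvPolynomial.aeval (Projectivization.mk K v hv).rep P = 0 ↔ _
  rw [← h2, h]
  simp

/-- `X` is a projective hypersurface of degree `d` defined over `k`: the zero set of a nonzero
homogeneous polynomial of degree `d` with coefficients in `k`. -/
def IsHypersurface (k : Type*) {K : Type*} [Field k] [Field K] [Algebra k K] {m : ℕ}
    (d : ℕ) (X : Set (ProjSpace K m)) : Prop :=
  ∃ P : MvPolynomial (Fin (m + 1)) k, P ≠ 0 ∧ P.IsHomogeneous d ∧ X = projZeroSet K P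

/-- `H` is a hyperplane defined over `k`: the zero set of a nonzero linear form
`a₀ x₀ + ⋯ + aₘ xₘ` with coefficients in `k`. -/
def IsHyperplane (k : Type*) {K : Type*} [Field k] [Field K] [Algebra k K] {m : ℕ}
    (H : Set (ProjSpace K m)) : Prop :=
  ∃ a : Fin (m + 1) → k, a ≠ 0 ∧
    H = projZeroSet K (∑ i, MvPolynomial.C (a i) * MvPolynomial.X i)

/-- The inclusion of the `k`-rational points of projective space into its `K`-points: the point
`[v₀ : ⋯ : vₘ]` over `k` is sent to the same point over `K`. -/
noncomputable def rationalInclusion (k K : Type*) [Field k] [Field K] [Algebra k K] (m : ℕ) :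
    ProjSpace k m → ProjSpace K m :=
  Projectivization.map
    (σ := algebraMap k K)
    { toFun := fun v i => algebraMap k K (v i)
      map_add' := fun v w => by ext i; simp
      map_smul' := fun c v => by ext i; simp }
    (fun v w h => by
      ext i
      exact (algebraMap k K).injective (congrFun h i))

/-- The set `X(k)` of `k`-rational points of `X`. -/
def rationalPoints (k : Type*) {K : Type*} [Field k] [Field K] [Algebra k K] {m : ℕ}
    (X : Set (ProjSpace K m)) : Set (ProjSpace k m) :=
  {x | rationalInclusion k K m x ∈ X}

end

/-! The given hyperplane is split off. If `a` is its coefficient vector, then `linForm a ∣ P`, and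
on the affine chart `∑ aᵢ xᵢ = 1` the form `P` becomes a polynomial `f` of degree at most `e = d - 1
< q`. The complement of `X` lies in this chart, so `|X(𝔽_q)| = p_{m-1} + N`, where `N` is the number
of rational affine zeros of `f`. For `f` of degree exactly `e` the theorem becomes: `N < e q^{m-1}`
implies `N ≤ e q^{m-1} - (e-1) q^{m-2}` (`card_zeros_add_le`), and `N ≥ e q^{m-1} - (e-1) q^{m-2}`
makes every irreducible factor of `f` linear (`allLinear_of_count`). A smaller degree puts `N` below
this threshold by Schwartz–Zippel.

In the plane (`allLinear_of_plane_count`) the tool is the footprint bound: there are at most as many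
zeros as reduced monomials divisible by no known leading monomial. If `N ≥ e q - (e-1)`, then either
`f` divides a constant combination of `x^q - x` and `y^q - y`, which is a product of parallel lines,
or the bound is attained. In the latter case the polynomials used form a Gröbner basis, and reducing
one S-polynomial shows that `f` divides `L₀ (x^q - x) + L₁ (y^q - y)` with `L₀, L₁` affine, not both
zero. On a line this combination is `(T^q - T)(α + βT)`, so in all but at most `2(q-1)` directions
each line carries `e - 1` or `e` zeros. Comparison with the exact second moment of these numbers
leaves only degenerate `L`, for which the combination splits into lines, or a conic containing a
rational line.

In higher dimension, induction on `e`. If `f` has degree `j` with `0 < j < e` in some direction,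
counting along parallel lines (`zeros_of_dirDegree`) shows that `N` is at most the threshold; at
equality the leading coefficient `φ` in that direction has degree `e - j`, has as many zeros as
possible, and vanishes only where `f` does. So `φ` is a squarefree product of linear factors and
divides `f`. A nonlinear factor of `f` yields such a direction through a plane section, unless `f`
depends on one linear form, a case settled directly. The gap follows: strictly above the threshold
there are no intermediate directions, so `f` depends on one linear form and `N` is a multiple of
`q^{m-1}`. -/

/-! ### Degree in a direction and restriction to lines -/

section DirectionalDegree

open MvPolynomial

variable {k σ : Type*} [Field k]

/-- Every irreducible factor of `f` has degree one. -/
def AllLinear (f : MvPolynomial σ k) : Prop :=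
  ∀ p, Irreducible p → p ∣ f → p.totalDegree = 1

/-- The polynomial `f (X + T w)` in one variable `T` over the ring of polynomials in `X`. -/
noncomputable def dirShift (w : σ → k) :
    MvPolynomial σ k →ₐ[k] Polynomial (MvPolynomial σ k) :=
  aeval fun i => Polynomial.C (X i) + Polynomial.C (C (w i)) * Polynomial.X

/-- The degree of `f` in the direction `w`. -/
noncomputable def dirDegree (w : σ → k) (f : MvPolynomial σ k) : ℕ :=
  (dirShift w f).natDegree

/-- The restriction of `f` to the line `T ↦ P + T w`. -/
noncomputable def lineRestrict (P w : σ → k) : MvPolynomial σ k →ₐ[k] Polynomial k :=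
  aeval fun i => Polynomial.C (P i) + Polynomial.C (w i) * Polynomial.X

theorem map_eval_dirShift (P w : σ → k) (f : MvPolynomial σ k) :
    (dirShift w f).map (eval P) = lineRestrict P w f := by
  induction f using MvPolynomial.induction_on with
  | C a => simp [dirShift, lineRestrict, Polynomial.algebraMap_apply, MvPolynomial.algebraMap_eq]
  | add p q hp hq => simp [hp, hq]
  | mul_X p i hp =>
    rw [map_mul, map_mul, Polynomial.map_mul, hp]
    simp [dirShift, lineRestrict]

theorem coeff_lineRestrict (P w : σ → k) (f : MvPolynomial σ k) (j : ℕ) :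
    (lineRestrict P w f).coeff j = eval P ((dirShift w f).coeff j) := by
  rw [← map_eval_dirShift, Polynomial.coeff_map]

theorem eval_lineRestrict (P w : σ → k) (f : MvPolynomial σ k) (t : k) :
    (lineRestrict P w f).eval t = eval (P + t • w) f := by
  induction f using MvPolynomial.induction_on with
  | C a => simp [lineRestrict]
  | add p q hp hq => simp [hp, hq]
  | mul_X p i hp =>
    rw [map_mul, Polynomial.eval_mul, hp]
    simp only [lineRestrict, aeval_X, Polynomial.eval_add, Polynomial.eval_C, Polynomial.eval_mul,
      Polynomial.eval_X, map_mul, eval_X, Pi.add_apply, Pi.smul_apply, smul_eq_mul]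
    ring

theorem natDegree_lineRestrict_le (P w : σ → k) (f : MvPolynomial σ k) :
    (lineRestrict P w f).natDegree ≤ dirDegree w f := by
  rw [← map_eval_dirShift]
  exact Polynomial.natDegree_map_le

theorem coeff_zero_dirShift (w : σ → k) (f : MvPolynomial σ k) :
    (dirShift w f).coeff 0 = f := by
  induction f using MvPolynomial.induction_on with
  | C a => simp [dirShift, Polynomial.algebraMap_apply, MvPolynomial.algebraMap_eq]
  | add p q hp hq => simp [hp, hq]
  | mul_X p i hp =>
    rw [map_mul, Polynomial.mul_coeff_zero, hp]
    simp [dirShift]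

theorem dirShift_ne_zero (w : σ → k) {f : MvPolynomial σ k} (hf : f ≠ 0) : dirShift w f ≠ 0 := by
  intro h
  apply hf
  rw [← coeff_zero_dirShift w f, h, Polynomial.coeff_zero]

theorem dirDegree_mul (w : σ → k) {f g : MvPolynomial σ k} (hf : f ≠ 0) (hg : g ≠ 0) :
    dirDegree w (f * g) = dirDegree w f + dirDegree w g := by
  rw [dirDegree, map_mul, Polynomial.natDegree_mul (dirShift_ne_zero w hf) (dirShift_ne_zero w hg)]
  rfl

/-- The substitution `X ↦ X + T w` is homogeneous when `T` has weight one. The bound is checked on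
monomials, built up from powers of variables. -/
theorem totalDegree_coeff_dirShift (w : σ → k) (f : MvPolynomial σ k) (j : ℕ)
    (hj : (dirShift w f).coeff j ≠ 0) :
    ((dirShift w f).coeff j).totalDegree + j ≤ f.totalDegree := by
  classical
  have mono : ∀ (s : σ →₀ ℕ) (j : ℕ), (dirShift w (monomial s 1)).coeff j ≠ 0 →
      ((dirShift w (monomial s (1 : k))).coeff j).totalDegree + j ≤ s.sum fun _ e => e := by
    intro s
    induction s using Finsupp.induction_linear with
    | zero =>
      intro j hj
      have h1 : dirShift w (monomial (0 : σ →₀ ℕ) (1 : k)) = 1 := map_one _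
      rw [h1, Polynomial.coeff_one] at hj ⊢
      have : j = 0 := by by_contra h; simp [h] at hj
      simp [this]
    | add a b ha hb =>
      intro j hj
      have h1 : (monomial (a + b) (1 : k)) = monomial a 1 * monomial b 1 := by simp
      rw [h1, map_mul, Polynomial.coeff_mul] at hj ⊢
      rw [Finsupp.sum_add_index' (fun _ => rfl) (fun _ _ _ => rfl)]
      obtain ⟨x, hx, hx0⟩ := Finset.exists_ne_zero_of_sum_ne_zero hj
      have key : ∀ x ∈ Finset.HasAntidiagonal.antidiagonal j,
          ((dirShift w (monomial a (1 : k))).coeff x.1 *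
            (dirShift w (monomial b 1)).coeff x.2).totalDegree ≤
          ((a.sum fun _ e => e) + b.sum fun _ e => e) - j := by
        intro x hx
        by_cases h0 : (dirShift w (monomial a (1 : k))).coeff x.1 *
            (dirShift w (monomial b 1)).coeff x.2 = 0
        · rw [h0]; simp
        have h2 := ha x.1 (left_ne_zero_of_mul h0)
        have h3 := hb x.2 (right_ne_zero_of_mul h0)
        have h4 := totalDegree_mul ((dirShift w (monomial a (1 : k))).coeff x.1)
            ((dirShift w (monomial b 1)).coeff x.2)
        have := Finset.HasAntidiagonal.mem_antidiagonal.mp hx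
        omega
      have h5 := totalDegree_finsetSum_le (d := ((a.sum fun _ e => e) + b.sum fun _ e => e) - j) key
      have h2 := ha x.1 (left_ne_zero_of_mul hx0)
      have h3 := hb x.2 (right_ne_zero_of_mul hx0)
      have := Finset.HasAntidiagonal.mem_antidiagonal.mp hx
      omega
    | single i n =>
      intro j hj
      have h1 : monomial (Finsupp.single i n) (1 : k) = X i ^ n := by
        rw [X_pow_eq_monomial]
      have h2 : dirShift w (monomial (Finsupp.single i n) (1 : k)) =
          (Polynomial.C (C (w i)) * Polynomial.X + Polynomial.C (X i)) ^ n := by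
        rw [h1, map_pow, dirShift, aeval_X, add_comm]
      have h3 : (Finsupp.single i n).sum (fun _ e => e) = n := by simp
      rw [h3]
      have h4 : (Polynomial.C (C (w i)) * Polynomial.X + Polynomial.C (X i) :
          Polynomial (MvPolynomial σ k)) ^ n =
          ∑ l ∈ Finset.range (n + 1),
            Polynomial.monomial l ((C (w i)) ^ l * X i ^ (n - l) * (n.choose l : MvPolynomial σ k)) := by
        rw [add_pow]
        refine Finset.sum_congr rfl fun l _ => ?_
        rw [← Polynomial.C_mul_X_pow_eq_monomial]
        simp only [mul_pow, map_mul, map_pow, map_natCast]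
        ring
      have h5 : (dirShift w (monomial (Finsupp.single i n) (1 : k))).coeff j =
          if j ≤ n then (C (w i)) ^ j * X i ^ (n - j) * (n.choose j : MvPolynomial σ k) else 0 := by
        rw [h2, h4, Polynomial.finsetSum_coeff]
        simp [Polynomial.coeff_monomial]
      rw [h5] at hj ⊢
      have hjn : j ≤ n := by by_contra h; simp [h] at hj
      rw [if_pos hjn]
      have h6 : ((C (w i)) ^ j * X i ^ (n - j) * (n.choose j : MvPolynomial σ k)).totalDegree
          ≤ n - j := by
        have e1 : ((n.choose j : MvPolynomial σ k)) = C (n.choose j : k) := by simp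
        rw [e1, ← C_pow, mul_assoc]
        refine (totalDegree_mul _ _).trans ?_
        refine (add_le_add le_rfl (totalDegree_mul _ _)).trans ?_
        simp only [totalDegree_C, totalDegree_X_pow]
        omega
      omega
  rw [f.as_sum, map_sum, Polynomial.finsetSum_coeff] at hj
  have expand : (dirShift w f).coeff j =
      ∑ s ∈ f.support, C (coeff s f) * (dirShift w (monomial s 1)).coeff j := by
    conv_lhs => rw [f.as_sum, map_sum, Polynomial.finsetSum_coeff]
    refine Finset.sum_congr rfl fun s _ => ?_
    have : monomial s (coeff s f) = C (coeff s f) * monomial s 1 := by simp [C_mul_monomial]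
    rw [this, map_mul]
    have h2 : dirShift w (C (coeff s f)) = Polynomial.C (C (coeff s f)) := by
      simp [dirShift, Polynomial.algebraMap_apply, MvPolynomial.algebraMap_eq]
    rw [h2, Polynomial.coeff_C_mul]
  have term : ∀ s ∈ f.support,
      (C (coeff s f) * (dirShift w (monomial s 1)).coeff j).totalDegree ≤ f.totalDegree - j := by
    intro s hs
    by_cases h0 : (dirShift w (monomial s (1 : k))).coeff j = 0
    · simp [h0]
    have h1 := mono s j h0
    have h2 := le_totalDegree hs
    have h3 := totalDegree_mul (C (coeff s f)) ((dirShift w (monomial s 1)).coeff j)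
    rw [totalDegree_C] at h3
    omega
  have h5 := totalDegree_finsetSum_le (d := f.totalDegree - j) term
  rw [← expand] at h5
  have hj' : (dirShift w f).coeff j ≠ 0 := by
    rw [f.as_sum, map_sum, Polynomial.finsetSum_coeff]; exact hj
  rw [expand] at hj'
  obtain ⟨s, hs, hs0⟩ := Finset.exists_ne_zero_of_sum_ne_zero hj'
  have h1 := mono s j (right_ne_zero_of_mul hs0)
  have h2 := le_totalDegree hs
  omega

theorem dirDegree_le_totalDegree (w : σ → k) (f : MvPolynomial σ k) :
    dirDegree w f ≤ f.totalDegree := by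
  by_cases hf : f = 0
  · simp [hf, dirDegree]
  have h : (dirShift w f).coeff (dirDegree w f) ≠ 0 := by
    rw [dirDegree, Polynomial.coeff_natDegree, Polynomial.leadingCoeff_ne_zero]
    exact dirShift_ne_zero w hf
  have := totalDegree_coeff_dirShift w f _ h
  omega

theorem eq_C_coeff_totalDegree_dirShift (w : σ → k) (f : MvPolynomial σ k) :
    ∃ c, (dirShift w f).coeff f.totalDegree = C c := by
  by_cases h : (dirShift w f).coeff f.totalDegree = 0
  · exact ⟨0, by simp [h]⟩
  have := totalDegree_coeff_dirShift w f _ h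
  exact ⟨_, totalDegree_eq_zero_iff_eq_C.mp (by omega)⟩

/-- The coefficient of `T ^ f.totalDegree` is a constant, so it is the same on all lines of
direction `w`. -/
theorem coeff_totalDegree_lineRestrict_ne_zero_iff (P w : σ → k) {f : MvPolynomial σ k}
    (hf : f ≠ 0) :
    (lineRestrict P w f).coeff f.totalDegree ≠ 0 ↔ dirDegree w f = f.totalDegree := by
  obtain ⟨c, hc⟩ := eq_C_coeff_totalDegree_dirShift w f
  rw [coeff_lineRestrict, hc, eval_C]
  constructor
  · intro h
    refine le_antisymm (dirDegree_le_totalDegree w f) (Polynomial.le_natDegree_of_ne_zero ?_)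
    rw [hc]
    simpa using h
  · intro h h0
    have h1 : (dirShift w f).leadingCoeff = 0 := by
      rw [Polynomial.leadingCoeff]
      change (dirShift w f).coeff (dirDegree w f) = 0
      rw [h, hc, h0, map_zero]
    exact dirShift_ne_zero w hf (Polynomial.leadingCoeff_eq_zero.mp h1)

theorem natDegree_lineRestrict_of_dirDegree_eq (P w : σ → k) {f : MvPolynomial σ k}
    (hf : f ≠ 0) (h : dirDegree w f = f.totalDegree) :
    (lineRestrict P w f).natDegree = f.totalDegree :=
  le_antisymm ((natDegree_lineRestrict_le P w f).trans h.le)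
    (Polynomial.le_natDegree_of_ne_zero
      ((coeff_totalDegree_lineRestrict_ne_zero_iff P w hf).mpr h))

theorem coeff_totalDegree_lineRestrict_zero [Fintype σ] (w : σ → k) (f : MvPolynomial σ k) (n : ℕ) :
    (lineRestrict 0 w f).coeff n = eval w (homogeneousComponent n f) := by
  classical
  have key : ∀ s : σ →₀ ℕ, ∀ a : k, lineRestrict 0 w (monomial s a) =
      Polynomial.monomial s.degree (eval w (monomial s a)) := by
    intro s a
    rw [lineRestrict, aeval_monomial, eval_monomial, ← Polynomial.C_mul_X_pow_eq_monomial]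
    simp only [Pi.zero_apply, map_zero, zero_add, mul_pow, Finsupp.prod, Finset.prod_mul_distrib,
      map_mul, map_prod, map_pow, Polynomial.algebraMap_apply, Algebra.algebraMap_self,
      RingHom.id_apply, Finset.prod_pow_eq_pow_sum, Finsupp.degree_apply]
    ring
  conv_lhs => rw [f.as_sum]
  rw [homogeneousComponent_apply, map_sum, map_sum, Polynomial.finsetSum_coeff, Finset.sum_filter]
  refine Finset.sum_congr rfl fun s _ => ?_
  rw [key, Polynomial.coeff_monomial]

end DirectionalDegree

/-! ### Linear factors and divisibility by a linear polynomial -/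

section LinearFactors

open MvPolynomial

variable {k σ : Type*} [Field k]

theorem AllLinear.of_dvd {f g : MvPolynomial σ k} (hf : AllLinear f) (h : g ∣ f) : AllLinear g :=
  fun p hp hpg => hf p hp (hpg.trans h)

theorem AllLinear.mul {f g : MvPolynomial σ k} (hf : AllLinear f) (hg : AllLinear g) :
    AllLinear (f * g) := fun p hp hpfg =>
  (hp.prime.dvd_or_dvd hpfg).elim (hf p hp) (hg p hp)

theorem AllLinear.prod {ι : Type*} {s : Finset ι} {f : ι → MvPolynomial σ k}
    (hf : ∀ i ∈ s, AllLinear (f i)) : AllLinear (∏ i ∈ s, f i) := fun p hp hpf => by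
  obtain ⟨i, hi, hpi⟩ := (hp.prime.dvd_finsetProd_iff f).mp hpf
  exact hf i hi p hp hpi

theorem totalDegree_ne_zero_of_irreducible {p : MvPolynomial σ k} (hp : Irreducible p) :
    p.totalDegree ≠ 0 := by
  intro h
  obtain ⟨c, hc⟩ : ∃ c, p = C c := ⟨_, totalDegree_eq_zero_iff_eq_C.mp h⟩
  have hc0 : c ≠ 0 := by
    rintro rfl
    exact hp.ne_zero (by rw [hc, C_0])
  exact hp.not_isUnit (hc ▸ (isUnit_iff_ne_zero.mpr hc0).map C)

theorem allLinear_of_totalDegree_le_one {f : MvPolynomial σ k} (hf : f ≠ 0)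
    (h : f.totalDegree ≤ 1) : AllLinear f := by
  intro p hp hpf
  have h1 := totalDegree_le_of_dvd_of_isDomain hpf hf
  have h2 := totalDegree_ne_zero_of_irreducible hp
  omega

theorem eq_linear_of_totalDegree_le_one [Fintype σ] {f : MvPolynomial σ k}
    (h : f.totalDegree ≤ 1) :
    f = C (coeff 0 f) + ∑ i, C (coeff (Finsupp.single i 1) f) * X i := by
  classical
  ext s
  rw [coeff_add, coeff_C, coeff_sum]
  simp only [coeff_C_mul, coeff_X]
  by_cases hs : s = 0
  · subst hs
    simp
  rw [if_neg (Ne.symm hs), zero_add]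
  by_cases h1 : s.degree ≤ 1
  · obtain ⟨i, rfl⟩ : ∃ i, s = Finsupp.single i 1 := by
      have h2 : s.degree = 1 := by
        have : s.degree ≠ 0 := fun h0 => hs ((Finsupp.degree_eq_zero_iff s).mp h0)
        omega
      exact (Finsupp.sum_eq_one_iff s).mp h2
    simp [Finsupp.single_left_inj]
  · rw [coeff_eq_zero_of_totalDegree_lt (by rw [← Finsupp.degree_apply]; omega)]
    symm
    refine Finset.sum_eq_zero fun i _ => ?_
    rw [if_neg, mul_zero]
    rintro rfl
    simp at h1

theorem exists_coeff_single_ne_zero {p : MvPolynomial σ k} (hp : p.totalDegree = 1) :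
    ∃ i, coeff (Finsupp.single i 1) p ≠ 0 := by
  have hp0 : p ≠ 0 := by
    rintro rfl
    simp at hp
  obtain ⟨s, hs, hs1⟩ := Finset.exists_mem_eq_sup p.support (support_nonempty.mpr hp0)
    fun s => s.sum fun _ e => e
  obtain ⟨i, rfl⟩ := (Finsupp.sum_eq_one_iff s).mp (hs1.symm.trans hp)
  exact ⟨i, mem_support_iff.mp hs⟩

theorem irreducible_of_totalDegree_one {p : MvPolynomial σ k} (hp : p.totalDegree = 1) :
    Irreducible p := by
  refine irreducible_of_totalDegree_eq_one hp fun x hx => ?_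
  obtain ⟨i, hi⟩ := exists_coeff_single_ne_zero hp
  exact isUnit_iff_ne_zero.mpr (ne_zero_of_dvd_ne_zero hi (hx _))

theorem totalDegree_aeval_le {τ : Type*} (s : σ → MvPolynomial τ k)
    (hs : ∀ i, (s i).totalDegree ≤ 1) (f : MvPolynomial σ k) :
    (aeval s f).totalDegree ≤ f.totalDegree := by
  rw [aeval_def, eval₂_eq]
  refine totalDegree_finsetSum_le fun d hd => ?_
  refine (totalDegree_mul _ _).trans ?_
  rw [algebraMap_eq, totalDegree_C, zero_add]
  refine (totalDegree_finsetProd _ _).trans ?_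
  refine le_trans (Finset.sum_le_sum fun i _ => ?_) (le_totalDegree hd)
  refine (totalDegree_pow _ _).trans ?_
  calc d i * (s i).totalDegree ≤ d i * 1 := Nat.mul_le_mul le_rfl (hs i)
    _ = d i := mul_one _

theorem dvd_sub_aeval {p : MvPolynomial σ k} (s : σ → MvPolynomial σ k)
    (hs : ∀ i, p ∣ X i - s i) (f : MvPolynomial σ k) : p ∣ f - aeval s f := by
  induction f using MvPolynomial.induction_on with
  | C a => simp [MvPolynomial.algebraMap_eq]
  | add f g hf hg =>
    have : f + g - aeval s (f + g) = (f - aeval s f) + (g - aeval s g) := by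
      rw [map_add]; ring
    rw [this]
    exact dvd_add hf hg
  | mul_X f i hf =>
    have : f * X i - aeval s (f * X i) = (f - aeval s f) * X i + aeval s f * (X i - s i) := by
      rw [map_mul, aeval_X]; ring
    rw [this]
    exact dvd_add (hf.mul_right _) ((hs i).mul_left _)

/-- A polynomial vanishing on the hyperplane `p = 0` is divisible by `p`, as soon as the points
over `K` separate polynomials of its degree. -/
theorem dvd_of_forall_aeval_eq_zero [Fintype σ] {K : Type*} [Field K] [Algebra k K]
    {p f : MvPolynomial σ k} (hp : p.totalDegree = 1)
    (hK : ∀ g : MvPolynomial σ k, g.totalDegree ≤ f.totalDegree →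
      (∀ x : σ → K, aeval x g = 0) → g = 0)
    (h : ∀ x : σ → K, aeval x p = 0 → aeval x f = 0) : p ∣ f := by
  classical
  obtain ⟨i₀, hi₀⟩ := exists_coeff_single_ne_zero hp
  set c := coeff (Finsupp.single i₀ 1) p with hc
  -- The substitution `s` solves `p = 0` for `X i₀`. It is the identity modulo `p` and kills `p`, so
  -- `aeval s f` vanishes at every point, and `f ≡ aeval s f` modulo `p`.
  let s : σ → MvPolynomial σ k := fun i => if i = i₀ then X i₀ - C c⁻¹ * p else X i
  have hs1 : ∀ i, (s i).totalDegree ≤ 1 := by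
    intro i
    by_cases hi : i = i₀
    · simp only [s, if_pos hi]
      refine (totalDegree_sub _ _).trans (max_le (totalDegree_X _).le ?_)
      refine (totalDegree_mul _ _).trans ?_
      rw [totalDegree_C, hp]
    · simp only [s, if_neg hi]
      exact (totalDegree_X _).le
  have hs2 : ∀ i, p ∣ X i - s i := by
    intro i
    by_cases hi : i = i₀
    · subst hi
      simp [s]
    · simp [s, if_neg hi]
  have hsp : aeval s p = 0 := by
    have h1 : ∀ i, C (coeff (Finsupp.single i 1) p) * s i =
        C (coeff (Finsupp.single i 1) p) * X i - if i = i₀ then p else 0 := by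
      intro i
      by_cases hi : i = i₀
      · subst hi
        simp only [s, if_true]
        rw [mul_sub, ← mul_assoc, ← C_mul, mul_inv_cancel₀ hi₀, C_1, one_mul]
      · simp [s, if_neg hi]
    have h2 := eq_linear_of_totalDegree_le_one hp.le
    conv_lhs => rw [h2]
    simp only [map_add, map_sum, map_mul, aeval_X, aeval_C, MvPolynomial.algebraMap_eq]
    rw [Finset.sum_congr rfl fun i _ => h1 i, Finset.sum_sub_distrib, Finset.sum_ite_eq',
      if_pos (Finset.mem_univ _), ← add_sub_assoc, ← h2, sub_self]
  have hzero : aeval s f = 0 := by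
    refine hK _ (totalDegree_aeval_le s hs1 f) fun x => ?_
    have comp : ∀ g : MvPolynomial σ k, aeval x (aeval s g) = aeval (fun i => aeval x (s i)) g := by
      intro g
      have : (aeval x).comp (aeval s) = (aeval fun i => aeval x (s i) : MvPolynomial σ k →ₐ[k] K) := by
        ext i
        simp
      exact DFunLike.congr_fun this g
    rw [comp]
    apply h
    rw [← comp, hsp, map_zero]
  have := dvd_sub_aeval s hs2 f
  rwa [hzero, sub_zero] at this

end LinearFactors

/-! ### Zeros in affine space, counted along parallel lines -/

section Counting

set_option linter.unusedSectionVars false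

open MvPolynomial Finset

variable {k : Type*} [Field k] [Fintype k] [DecidableEq k] {n : ℕ}

/-- The rational zeros of `f` in affine `n`-space. -/
noncomputable def zeros (f : MvPolynomial (Fin n) k) : Finset (Fin n → k) :=
  univ.filter fun P => eval P f = 0

@[simp]
theorem mem_zeros {f : MvPolynomial (Fin n) k} {P : Fin n → k} : P ∈ zeros f ↔ eval P f = 0 := by
  simp [zeros]

/-- The number of parameters of zeros of `f` on the line `t ↦ P + t w`. -/
noncomputable def lineZeroCount (f : MvPolynomial (Fin n) k) (P w : Fin n → k) : ℕ :=
  #{t : k | eval (P + t • w) f = 0}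

theorem card_zeros_mul_le {f : MvPolynomial (Fin n) k} (hf : f ≠ 0) :
    #(zeros f) * Fintype.card k ≤ f.totalDegree * Fintype.card k ^ n := by
  have h := schwartz_zippel_totalDegree hf (univ : Finset k)
  have hq : (0 : ℚ≥0) < Fintype.card k := by exact_mod_cast Fintype.card_pos
  rw [card_univ, div_le_div_iff₀ (by positivity) hq] at h
  have h2 : (Fintype.piFinset fun _ : Fin n => (univ : Finset k)) = univ := by
    ext; simp
  rw [h2] at h
  exact_mod_cast h

theorem card_zeros_le {f : MvPolynomial (Fin (n + 1)) k} (hf : f ≠ 0) :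
    #(zeros f) ≤ f.totalDegree * Fintype.card k ^ n := by
  have h := card_zeros_mul_le hf
  rw [pow_succ, ← mul_assoc] at h
  exact Nat.le_of_mul_le_mul_right h Fintype.card_pos

theorem eq_zero_of_forall_eval {f : MvPolynomial (Fin n) k}
    (hq : f.totalDegree < Fintype.card k) (h : ∀ P, eval P f = 0) : f = 0 := by
  by_contra hf
  have h1 := card_zeros_mul_le hf
  have h2 : zeros f = univ := by ext P; simp [h]
  rw [h2, card_univ, Fintype.card_pi] at h1
  simp only [prod_const, card_univ, Fintype.card_fin] at h1
  rw [mul_comm] at h1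
  have := Nat.le_of_mul_le_mul_right h1 (pow_pos Fintype.card_pos n)
  omega

theorem dvd_of_zeros_subset {p f : MvPolynomial (Fin n) k} (hp : p.totalDegree = 1)
    (hq : f.totalDegree < Fintype.card k) (h : ∀ P, eval P p = 0 → eval P f = 0) : p ∣ f := by
  refine dvd_of_forall_aeval_eq_zero (K := k) hp (fun g hg hg0 => ?_) fun x hx => ?_
  · exact eq_zero_of_forall_eval (hg.trans_lt hq) fun P => by simpa [coe_aeval_eq_eval] using hg0 P
  · simpa [coe_aeval_eq_eval] using h x (by simpa [coe_aeval_eq_eval] using hx)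

theorem lineZeroCount_eq (f : MvPolynomial (Fin n) k) (P w : Fin n → k) :
    lineZeroCount f P w = #{t : k | (lineRestrict P w f).eval t = 0} := by
  simp only [lineZeroCount, eval_lineRestrict]

theorem lineZeroCount_le_card (f : MvPolynomial (Fin n) k) (P w : Fin n → k) :
    lineZeroCount f P w ≤ Fintype.card k := card_le_univ _

theorem lineZeroCount_eq_card_roots {f : MvPolynomial (Fin n) k} {P w : Fin n → k}
    (h : lineRestrict P w f ≠ 0) :
    lineZeroCount f P w = #(lineRestrict P w f).roots.toFinset := by
  rw [lineZeroCount_eq]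
  congr 1
  ext t
  simp [h]

theorem lineZeroCount_le_natDegree {f : MvPolynomial (Fin n) k} {P w : Fin n → k}
    (h : lineRestrict P w f ≠ 0) :
    lineZeroCount f P w ≤ (lineRestrict P w f).natDegree := by
  rw [lineZeroCount_eq_card_roots h]
  exact (Multiset.toFinset_card_le _).trans (Polynomial.card_roots' _)

theorem lineZeroCount_le_dirDegree {f : MvPolynomial (Fin n) k} {P w : Fin n → k}
    (h : lineRestrict P w f ≠ 0) :
    lineZeroCount f P w ≤ dirDegree w f :=
  (lineZeroCount_le_natDegree h).trans (natDegree_lineRestrict_le P w f)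

theorem sum_lineZeroCount (f : MvPolynomial (Fin n) k) (w : Fin n → k) :
    ∑ P, lineZeroCount f P w = Fintype.card k * #(zeros f) := by
  simp only [lineZeroCount, card_filter]
  rw [sum_comm]
  have : ∀ t : k, ∑ P : Fin n → k, (if eval (P + t • w) f = 0 then 1 else 0) = #(zeros f) := by
    intro t
    rw [zeros, card_filter]
    exact Fintype.sum_equiv (Equiv.addRight (t • w)) _ _ fun P => rfl
  simp [this]

theorem eval_add_smul_of_dirDegree_eq_zero {w : Fin n → k} {f : MvPolynomial (Fin n) k}
    (h : dirDegree w f = 0) (P : Fin n → k) (t : k) : eval (P + t • w) f = eval P f := by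
  have h1 : (lineRestrict P w f).natDegree = 0 := by
    have := natDegree_lineRestrict_le P w f
    omega
  rw [← eval_lineRestrict, Polynomial.eq_C_of_natDegree_eq_zero h1, Polynomial.eval_C,
    coeff_lineRestrict, coeff_zero_dirShift]

/-- Degree below `q` makes the passage from functions to polynomials legitimate twice: first on each
line, then for the top coefficient of the shift as a polynomial in the base point. -/
theorem dirDegree_eq_zero_of_forall {w : Fin n → k} {f : MvPolynomial (Fin n) k}
    (hq : f.totalDegree < Fintype.card k)
    (h : ∀ P (t : k), eval (P + t • w) f = eval P f) : dirDegree w f = 0 := by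
  have h1 : ∀ P, lineRestrict P w f = Polynomial.C (eval P f) := by
    intro P
    rw [← sub_eq_zero]
    by_contra h0
    have h2 : #(univ : Finset k) ≤ (lineRestrict P w f - Polynomial.C (eval P f)).natDegree := by
      refine le_trans (card_le_card fun t _ => ?_)
        ((Multiset.toFinset_card_le _).trans (Polynomial.card_roots' _))
      rw [Multiset.mem_toFinset, Polynomial.mem_roots h0, Polynomial.IsRoot, Polynomial.eval_sub,
        eval_lineRestrict, h, Polynomial.eval_C, sub_self]
    rw [Polynomial.natDegree_sub_C, card_univ] at h2
    have := (natDegree_lineRestrict_le P w f).trans (dirDegree_le_totalDegree w f)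
    omega
  by_contra h0
  apply h0
  have h2 : (dirShift w f).coeff (dirDegree w f) = 0 := by
    refine eq_zero_of_forall_eval ?_ fun P => ?_
    · by_cases h3 : (dirShift w f).coeff (dirDegree w f) = 0
      · rw [h3, totalDegree_zero]; exact Fintype.card_pos
      · have := totalDegree_coeff_dirShift w f _ h3
        omega
    · rw [← coeff_lineRestrict, h1, Polynomial.coeff_C, if_neg h0]
  have h3 : dirShift w f = 0 := Polynomial.leadingCoeff_eq_zero.mp h2
  rw [dirDegree, h3, Polynomial.natDegree_zero]

theorem lineRestrict_add_smul (P w : Fin n → k) (s : k) (f : MvPolynomial (Fin n) k) :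
    lineRestrict (P + s • w) w f = (lineRestrict P w f).comp (Polynomial.X + Polynomial.C s) := by
  induction f using MvPolynomial.induction_on with
  | C a => simp [lineRestrict]
  | add p q hp hq => simp [hp, hq]
  | mul_X p i hp =>
    rw [map_mul, map_mul, Polynomial.mul_comp, hp]
    simp only [lineRestrict, aeval_X, Pi.add_apply, Pi.smul_apply, smul_eq_mul, Polynomial.add_comp,
      Polynomial.C_comp, Polynomial.mul_comp, Polynomial.X_comp, map_add, map_mul]
    ring

/-- Moving the base point along `w` replaces `T` by `T + s`, which does not change the top
coefficient. -/
theorem dirDegree_leadingCoeff {w : Fin n → k} {f : MvPolynomial (Fin n) k}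
    (hq : f.totalDegree < Fintype.card k) : dirDegree w (dirShift w f).leadingCoeff = 0 := by
  by_cases hf : f = 0
  · simp [hf, dirDegree]
  refine dirDegree_eq_zero_of_forall ?_ fun P s => ?_
  · have := totalDegree_coeff_dirShift w f (dirDegree w f)
      (Polynomial.leadingCoeff_ne_zero.mpr (dirShift_ne_zero w hf))
    change ((dirShift w f).coeff (dirDegree w f)).totalDegree < _
    omega
  · change eval _ ((dirShift w f).coeff (dirDegree w f)) =
      eval _ ((dirShift w f).coeff (dirDegree w f))
    rw [← coeff_lineRestrict, ← coeff_lineRestrict, lineRestrict_add_smul]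
    rcases (natDegree_lineRestrict_le P w f).lt_or_eq with h | h
    · rw [Polynomial.coeff_eq_zero_of_natDegree_lt h, Polynomial.coeff_eq_zero_of_natDegree_lt]
      rwa [Polynomial.natDegree_comp, Polynomial.natDegree_X_add_C, mul_one]
    · rw [← h]
      have h1 : (lineRestrict P w f).natDegree =
          ((lineRestrict P w f).comp (Polynomial.X + Polynomial.C s)).natDegree := by
        rw [Polynomial.natDegree_comp, Polynomial.natDegree_X_add_C, mul_one]
      conv_lhs => rw [h1]
      rw [Polynomial.coeff_natDegree, Polynomial.coeff_natDegree, Polynomial.leadingCoeff_comp]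
      · simp
      · simp

/-- The top homogeneous component is nonzero of degree below `q`, so it does not vanish at some
vector; that vector is the direction. -/
theorem exists_dirDegree_eq_totalDegree {f : MvPolynomial (Fin n) k} (hf : f ≠ 0)
    (hq : f.totalDegree < Fintype.card k) : ∃ u, dirDegree u f = f.totalDegree := by
  by_contra! h
  have h1 : homogeneousComponent f.totalDegree f = 0 := by
    refine eq_zero_of_forall_eval ?_ fun P => ?_
    · exact (homogeneousComponent_isHomogeneous _ _).totalDegree_le.trans_lt hq
    · by_contra h0
      rw [← coeff_totalDegree_lineRestrict_zero, ← ne_eq,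
        coeff_totalDegree_lineRestrict_ne_zero_iff 0 P hf] at h0
      exact h P h0
  obtain ⟨s, hs, hs1⟩ := Finset.exists_mem_eq_sup f.support (support_nonempty.mpr hf)
    fun s => s.sum fun _ e => e
  have h2 := congrArg (coeff s) h1
  rw [coeff_homogeneousComponent, if_pos (by exact hs1.symm), coeff_zero] at h2
  exact mem_support_iff.mp hs h2

/-- The numerical core of `zeros_of_dirDegree`. -/
theorem tight_of_counts {q Q e j r B S N : ℤ} (hQ : 0 < Q) (hj : 1 ≤ j) (hje : j < e) (heq : e < q)
    (hsum : q * N ≤ (q * q * Q - B) * j + S) (hS : S ≤ B * q) (hB : B ≤ r * (q * Q))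
    (hr : r + j ≤ e) (hN : e * (q * Q) ≤ N + (e - 1) * Q) :
    e * (q * Q) = N + (e - 1) * Q ∧ B = (e - j) * (q * Q) ∧ r = e - j ∧ S = B * q := by
  have hq0 : 0 < q := by linarith
  have hqj : 0 < q - j := by linarith
  have hqQ : 0 < q * Q := mul_pos hq0 hQ
  have t2 : q * (e * (q * Q)) ≤ q * (N + (e - 1) * Q) := mul_le_mul_of_nonneg_left hN hq0.le
  have hB' : B ≤ (e - j) * (q * Q) :=
    hB.trans (mul_le_mul_of_nonneg_right (by linarith) hqQ.le)
  have t3 : (q - j) * B ≤ (q - j) * ((e - j) * (q * Q)) :=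
    mul_le_mul_of_nonneg_left hB' hqj.le
  -- Inserting the largest possible `B` gives a defect of `j (e - j) Q`, and this inequality says `j
  -- (e - j) ≥ e - 1`. All estimates must therefore be equalities.
  have t4 : 0 ≤ (q * Q) * ((j - 1) * (e - j - 1)) :=
    mul_nonneg hqQ.le (mul_nonneg (by linarith) (by linarith))
  have t5 : (q - j) * B = (q - j) * ((e - j) * (q * Q)) := by linarith
  have t6 : B = (e - j) * (q * Q) := mul_left_cancel₀ hqj.ne' t5
  have t7 : S = B * q := by linarith
  have t8 : q * (e * (q * Q)) = q * (N + (e - 1) * Q) := by linarith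
  refine ⟨mul_left_cancel₀ hq0.ne' t8, t6, le_antisymm (by linarith) ?_, t7⟩
  rw [t6] at hB
  exact le_of_mul_le_mul_right hB hqQ

/-- If a polynomial of degree `e` has degree `j ∉ {0, e}` in the direction `w` and at least
`e q ^ (n + 1) - (e - 1) q ^ n` zeros, then equality holds and its leading coefficient in the
direction `w` cuts out a set of `(e - j) q ^ (n + 1)` zeros. -/
theorem zeros_of_dirDegree {f : MvPolynomial (Fin (n + 2)) k} {w : Fin (n + 2) → k}
    (hq : f.totalDegree < Fintype.card k) (h1 : dirDegree w f ≠ 0)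
    (h2 : dirDegree w f < f.totalDegree)
    (hN : f.totalDegree * Fintype.card k ^ (n + 1) ≤
      #(zeros f) + (f.totalDegree - 1) * Fintype.card k ^ n) :
    f.totalDegree * Fintype.card k ^ (n + 1) =
      #(zeros f) + (f.totalDegree - 1) * Fintype.card k ^ n ∧
    #(zeros (dirShift w f).leadingCoeff) =
      (f.totalDegree - dirDegree w f) * Fintype.card k ^ (n + 1) ∧
    (dirShift w f).leadingCoeff.totalDegree = f.totalDegree - dirDegree w f ∧
    ∀ P, eval P (dirShift w f).leadingCoeff = 0 → eval P f = 0 := by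
  have hf : f ≠ 0 := by
    rintro rfl
    simp at h2
  set q := Fintype.card k with hqd
  set φ := (dirShift w f).leadingCoeff with hφ
  have hφ0 : φ ≠ 0 := Polynomial.leadingCoeff_ne_zero.mpr (dirShift_ne_zero w hf)
  have hr : φ.totalDegree + dirDegree w f ≤ f.totalDegree :=
    totalDegree_coeff_dirShift w f (dirDegree w f) hφ0
  have hB := card_zeros_le hφ0
  rw [← hqd] at hB
  -- Where `φ` does not vanish, the restriction to the line has degree exactly `dirDegree w f`. On
  -- the other lines only the trivial bound `q` is available.
  have hline : ∀ P ∈ univ \ zeros φ, lineZeroCount f P w ≤ dirDegree w f := by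
    intro P hP
    refine lineZeroCount_le_dirDegree fun h0 => ?_
    have h3 : eval P φ = 0 := by
      change eval P ((dirShift w f).coeff (dirDegree w f)) = 0
      rw [← coeff_lineRestrict, h0, Polynomial.coeff_zero]
    simp [h3] at hP
  have hS : ∑ P ∈ zeros φ, lineZeroCount f P w ≤ ∑ P ∈ zeros φ, q :=
    sum_le_sum fun P _ => lineZeroCount_le_card f P w
  have hsum := sum_lineZeroCount f w
  rw [← sum_sdiff (subset_univ (zeros φ))] at hsum
  have h3 := sum_le_sum hline
  rw [sum_const, smul_eq_mul, card_univ_sdiff] at h3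
  simp only [Fintype.card_pi, prod_const, card_univ, Fintype.card_fin, ← hqd] at h3
  rw [sum_const, smul_eq_mul] at hS
  have hBle : #(zeros φ) ≤ q ^ (n + 2) := by
    have := card_le_univ (zeros φ)
    simpa [Fintype.card_pi, hqd] using this
  have he1 : 1 ≤ f.totalDegree := by omega
  obtain ⟨c1, c2, c3, c4⟩ := tight_of_counts (q := q) (Q := (q : ℤ) ^ n) (e := f.totalDegree)
    (j := dirDegree w f) (r := φ.totalDegree) (B := #(zeros φ))
    (S := (∑ P ∈ zeros φ, lineZeroCount f P w : ℕ)) (N := #(zeros f))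
    (by have : 0 < q := Fintype.card_pos
        positivity) (by omega) (by exact_mod_cast h2) (by exact_mod_cast hq)
    (by
      have h4 : q * #(zeros f) ≤ (q ^ (n + 2) - #(zeros φ)) * dirDegree w f +
          ∑ P ∈ zeros φ, lineZeroCount f P w := by
        rw [hqd]; rw [hqd] at h3; omega
      zify [hBle] at h4
      rw [Nat.cast_sum]
      calc _ ≤ _ := h4
        _ = _ := by ring)
    (by exact_mod_cast hS)
    (by
      zify at hB
      calc _ ≤ _ := hB
        _ = _ := by ring)
    (by exact_mod_cast hr)
    (by
      zify [he1] at hN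
      calc _ = _ := by ring
        _ ≤ _ := hN)
  refine ⟨?_, ?_, by omega, ?_⟩
  · zify [he1]
    calc _ = _ := by ring
        _ = _ := c1
  · zify [h2.le]
    calc _ = _ := c2
        _ = _ := by ring
  · intro P hP
    -- Equality in the trivial bound puts each of these lines entirely inside the zero set of `f`;
    -- the parameter `0` gives `P` itself.
    have h5 : ∑ P ∈ zeros φ, lineZeroCount f P w = ∑ P ∈ zeros φ, q := by
      rw [sum_const, smul_eq_mul]
      exact_mod_cast c4
    have h6 := (sum_eq_sum_iff_of_le fun P _ => lineZeroCount_le_card f P w).mp h5 P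
      (mem_zeros.mpr hP)
    have h7 := (card_eq_iff_eq_univ _).mp h6
    have h8 := mem_univ (0 : k)
    rw [← h7] at h8
    simpa using h8

end Counting

/-! ### The footprint bound and Gröbner bases -/

section Footprint

set_option linter.unusedSectionVars false

open MvPolynomial Finset MonomialOrder

variable {k : Type*} [Field k] [Fintype k] [DecidableEq k] {n : ℕ} (m : MonomialOrder (Fin n))

/-- The polynomial `x_i ^ q - x_i`, which vanishes at all rational points. -/
noncomputable def fieldRelation (i : Fin n) : MvPolynomial (Fin n) k :=
  X i ^ Fintype.card k - X i

@[simp]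
theorem eval_fieldRelation (P : Fin n → k) (i : Fin n) : eval P (fieldRelation i : MvPolynomial (Fin n) k) = 0 := by
  simp [fieldRelation, FiniteField.pow_card]

theorem degree_X_lt_degree_X_pow (i : Fin n) :
    m.degree (X i : MvPolynomial (Fin n) k) ≺[m] m.degree (X i ^ Fintype.card k : MvPolynomial (Fin n) k) := by
  rw [m.degree_pow, degree_X]
  apply m.toSyn_strictMono
  have hq : 1 < Fintype.card k := Fintype.one_lt_card
  rw [Finsupp.smul_single]
  refine lt_of_le_of_ne (Finsupp.single_le_single.mpr (by simpa using hq.le)) fun h => ?_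
  have := Finsupp.single_injective i h
  simp at this
  omega

theorem degree_fieldRelation (i : Fin n) :
    m.degree (fieldRelation i : MvPolynomial (Fin n) k) = Finsupp.single i (Fintype.card k) := by
  rw [fieldRelation, degree_sub_of_lt (degree_X_lt_degree_X_pow m i), m.degree_pow, degree_X]
  simp

theorem leadingCoeff_fieldRelation (i : Fin n) :
    m.leadingCoeff (fieldRelation i : MvPolynomial (Fin n) k) = 1 := by
  rw [fieldRelation, leadingCoeff_sub_of_lt (degree_X_lt_degree_X_pow m i), m.leadingCoeff_pow,
    leadingCoeff_X, one_pow]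

theorem fieldRelation_ne_zero (i : Fin n) : (fieldRelation i : MvPolynomial (Fin n) k) ≠ 0 := by
  intro h
  have := leadingCoeff_fieldRelation (k := k) (MonomialOrder.lex (σ := Fin n)) i
  rw [h, leadingCoeff_zero] at this
  exact zero_ne_one this

/-- The exponents of the reduced monomials. -/
noncomputable def reducedBox (q n : ℕ) : Finset (Fin n →₀ ℕ) :=
  (Fintype.piFinset fun _ : Fin n => range q).map Finsupp.equivFunOnFinite.symm.toEmbedding

theorem mem_reducedBox {q : ℕ} {d : Fin n →₀ ℕ} : d ∈ reducedBox q n ↔ ∀ i, d i < q := by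
  simp only [reducedBox, mem_map_equiv, Equiv.symm_symm, Fintype.mem_piFinset, mem_range]
  rfl

theorem card_reducedBox (q n : ℕ) : #(reducedBox q n) = q ^ n := by
  simp [reducedBox]

variable {m} {ι : Type*}

/-- The footprint bound. -/
theorem card_add_card_le_of_footprint (b : ι → MvPolynomial (Fin n) k) (hb : ∀ i, b i ≠ 0)
    (hfield : ∀ j, ∃ i, b i = fieldRelation j) (Z : Finset (Fin n → k))
    (hZ : ∀ i, ∀ P ∈ Z, eval P (b i) = 0) (D : Finset (Fin n →₀ ℕ))
    (hD : D ⊆ reducedBox (Fintype.card k) n) (hDb : ∀ d ∈ D, ∃ i, m.degree (b i) ≤ d) :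
    #Z + #D ≤ Fintype.card k ^ n := by
  classical
  let U := reducedBox (Fintype.card k) n \ D
  let Φ : (U → k) →ₗ[k] (Z → k) :=
    { toFun := fun a P => ∑ d : U, a d * eval P.1 (monomial d.1 1)
      map_add' := fun a a' => by
        ext P; simp only [Pi.add_apply, add_mul, sum_add_distrib]
      map_smul' := fun c a => by
        ext P; simp only [Pi.smul_apply, smul_eq_mul, RingHom.id_apply, mul_sum, mul_assoc] }
  -- Every function on `Z` is interpolated by a polynomial. Its remainder modulo `b` takes the same
  -- values on `Z` and involves only monomials with exponents in `U`.
  have hΦ : Function.Surjective Φ := by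
    intro g
    obtain ⟨p, hp⟩ : ∃ p : MvPolynomial (Fin n) k, ∀ P, eval P p =
        if h : P ∈ Z then g ⟨P, h⟩ else 0 := by
      have h1 : (fun P : Fin n → k => if h : P ∈ Z then g ⟨P, h⟩ else 0) ∈
          (⊤ : Submodule k ((Fin n → k) → k)) := trivial
      rw [← map_restrict_dom_evalₗ] at h1
      obtain ⟨p, -, hp⟩ := h1
      exact ⟨p, fun P => congrFun hp P⟩
    obtain ⟨c, r, hr, -, hr2⟩ := m.div (b := b) (fun i => isUnit_iff_ne_zero.mpr
      (m.leadingCoeff_ne_zero_iff.mpr (hb i))) p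
    have hsupp : r.support ⊆ U := by
      intro d hd
      rw [mem_sdiff, mem_reducedBox]
      refine ⟨fun j => ?_, fun hdD => ?_⟩
      · obtain ⟨i, hi⟩ := hfield j
        have := hr2 d hd i
        rw [hi, degree_fieldRelation, Finsupp.single_le_iff] at this
        omega
      · obtain ⟨i, hi⟩ := hDb d hdD
        exact hr2 d hd i hi
    refine ⟨fun d => coeff d.1 r, ?_⟩
    ext P
    have h2 : eval P.1 r = g P := by
      have h3 := hp P.1
      rw [dif_pos P.2] at h3
      rw [← h3, hr, map_add, Finsupp.linearCombination_apply, Finsupp.sum, map_sum]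
      rw [sum_eq_zero, zero_add]
      intro i _
      rw [smul_eq_mul, map_mul, hZ i P.1 P.2, mul_zero]
    rw [← h2]
    change ∑ d : U, coeff d.1 r * eval P.1 (monomial d.1 1) = _
    rw [sum_coe_sort U (fun d => coeff d r * eval P.1 (monomial d 1)), eval_eq]
    rw [← sum_subset hsupp]
    · refine sum_congr rfl fun d _ => ?_
      rw [eval_monomial, one_mul]
      rfl
    · intro d _ hd
      rw [notMem_support_iff.mp hd, zero_mul]
  have h1 := LinearMap.finrank_le_finrank_of_surjective hΦ
  rw [Module.finrank_fintype_fun_eq_card, Module.finrank_fintype_fun_eq_card, Fintype.card_coe,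
    Fintype.card_coe] at h1
  have h2 := card_sdiff_add_card_eq_card hD
  rw [card_reducedBox] at h2
  change #Z ≤ #(reducedBox (Fintype.card k) n \ D) at h1
  omega

/-- If the footprint bound is attained, the family is a Gröbner basis. -/
theorem exists_standard_representation [Fintype ι] (b : ι → MvPolynomial (Fin n) k)
    (hb : ∀ i, b i ≠ 0)
    (hfield : ∀ j, ∃ i, b i = fieldRelation j) (Z : Finset (Fin n → k))
    (hZ : ∀ i, ∀ P ∈ Z, eval P (b i) = 0) (D : Finset (Fin n →₀ ℕ))
    (hD : D ⊆ reducedBox (Fintype.card k) n) (hDb : ∀ d ∈ D, ∃ i, m.degree (b i) ≤ d)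
    (hcard : Fintype.card k ^ n ≤ #Z + #D) (h : MvPolynomial (Fin n) k)
    (hh : ∀ P ∈ Z, eval P h = 0) :
    ∃ g : ι → MvPolynomial (Fin n) k, h = ∑ i, g i * b i ∧
      ∀ i, m.degree (b i * g i) ≼[m] m.degree h := by
  classical
  obtain ⟨c, r, hr, hr1, hr2⟩ := m.div (b := b) (fun i => isUnit_iff_ne_zero.mpr
      (m.leadingCoeff_ne_zero_iff.mpr (hb i))) h
  have hlin : Finsupp.linearCombination (MvPolynomial (Fin n) k) b c = ∑ i, c i * b i := by
    rw [Finsupp.linearCombination_apply, Finsupp.sum_fintype _ _ (by simp)]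
    rfl
  suffices hr0 : r = 0 by
    refine ⟨c, ?_, hr1⟩
    rw [hr, hr0, add_zero, hlin]
  by_contra hr0
  have hdeg : m.degree r ∈ r.support := (m.degree_mem_support_iff r).mpr hr0
  have hnot : m.degree r ∉ D := fun hD' => by
    obtain ⟨i, hi⟩ := hDb _ hD'
    exact hr2 _ hdeg i hi
  -- A nonzero remainder vanishes on `Z` and has a reduced leading exponent outside `D`. Adjoining
  -- it to the family would push the footprint bound below `#Z`.
  have := card_add_card_le_of_footprint (m := m) (fun o : Option ι => o.elim r b)
    (fun o => by cases o <;> simp [hr0, hb])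
    (fun j => by
      obtain ⟨i, hi⟩ := hfield j
      exact ⟨some i, hi⟩) Z
    (fun o P hP => by
      cases o with
      | some i => exact hZ i P hP
      | none =>
        have h3 := hh P hP
        rw [hr, hlin, map_add, map_sum, sum_eq_zero, zero_add] at h3
        · exact h3
        · intro i _
          rw [map_mul, hZ i P hP, mul_zero])
    (insert (m.degree r) D)
    (insert_subset (mem_reducedBox.mpr fun j => by
      obtain ⟨i, hi⟩ := hfield j
      have := hr2 _ hdeg i
      rw [hi, degree_fieldRelation, Finsupp.single_le_iff] at this
      omega) hD)
    (fun d hd => by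
      rcases mem_insert.mp hd with rfl | hd
      · exact ⟨none, le_rfl⟩
      · obtain ⟨i, hi⟩ := hDb d hd
        exact ⟨some i, hi⟩)
  rw [card_insert_of_notMem hnot] at this
  omega

theorem degree_sub_lt_of_leadingCoeff_eq {p r : MvPolynomial (Fin n) k} {d : Fin n →₀ ℕ}
    (hd : d ≠ 0) (hp : m.degree p = d) (hr : m.degree r = d)
    (h : m.leadingCoeff p = m.leadingCoeff r) : m.degree (p - r) ≺[m] d := by
  refine lt_of_le_of_ne ?_ fun h0 => ?_
  · refine m.degree_sub_le.trans ?_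
    rw [hp, hr, sup_idem]
  · have h1 : m.degree (p - r) = d := m.toSyn.injective h0
    have h2 : coeff d (p - r) = 0 := by
      rw [coeff_sub]
      conv_lhs =>
        rw [← hp]
        arg 2
        rw [hp, ← hr]
      exact sub_eq_zero.mpr h
    rw [← h1, m.coeff_degree_eq_zero_iff] at h2
    rw [h2, degree_zero] at h1
    exact hd h1.symm

end Footprint

/-! ### The degree-lexicographic order in two variables, with `x₀ > x₁` -/

section FootprintPlane

open MvPolynomial Finset MonomialOrder

theorem degLex_lt_iff_fin_two {a b : Fin 2 →₀ ℕ} :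
    a ≺[degLex] b ↔ a 0 + a 1 < b 0 + b 1 ∨ a 0 + a 1 = b 0 + b 1 ∧ a 0 < b 0 := by
  rw [degLex_lt_iff, Finsupp.DegLex.lt_iff, Finsupp.degree_eq_sum, Finsupp.degree_eq_sum]
  simp only [ofDegLex_toDegLex, Fin.sum_univ_two]
  refine or_congr_right (and_congr_right fun h => ?_)
  rw [Finsupp.Lex.lt_iff]
  constructor
  · rintro ⟨i, h1, h2⟩
    fin_cases i
    · simpa using h2
    · have := h1 0 (by simp)
      simp at this h2
      omega
  · intro h1
    exact ⟨0, by simp, by simpa using h1⟩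

theorem degLex_le_iff_fin_two {a b : Fin 2 →₀ ℕ} :
    a ≼[degLex] b ↔ a 0 + a 1 < b 0 + b 1 ∨ a 0 + a 1 = b 0 + b 1 ∧ a 0 ≤ b 0 := by
  rw [← not_lt, degLex_lt_iff_fin_two]
  omega

end FootprintPlane

/-! ### Planar polynomials whose leading monomial involves both variables -/

section PlaneGroebner

open MvPolynomial Finset MonomialOrder

set_option linter.unusedSectionVars false

/-- The exponent of the monomial `x₀ ^ a * x₁ ^ b`. -/
noncomputable def planeExponent (a b : ℕ) : Fin 2 →₀ ℕ := Finsupp.single 0 a + Finsupp.single 1 b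

@[simp]
theorem planeExponent_zero (a b : ℕ) : planeExponent a b 0 = a := by simp [planeExponent]

@[simp]
theorem planeExponent_one (a b : ℕ) : planeExponent a b 1 = b := by simp [planeExponent]

theorem le_iff_fin_two {d e : Fin 2 →₀ ℕ} : d ≤ e ↔ d 0 ≤ e 0 ∧ d 1 ≤ e 1 := by
  rw [Finsupp.le_def, Fin.forall_fin_two]

theorem ext_fin_two {d e : Fin 2 →₀ ℕ} (h0 : d 0 = e 0) (h1 : d 1 = e 1) : d = e := by
  ext i
  fin_cases i
  · exact h0
  · exact h1

theorem planeExponent_injective :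
    Function.Injective fun x : ℕ × ℕ => planeExponent x.1 x.2 := fun x y h => Prod.ext
  (by simpa using DFunLike.congr_fun h 0) (by simpa using DFunLike.congr_fun h 1)

/-- The exponents of the monomials `x₀ ^ a * x₁ ^ b` with `(a, b)` in a given set. -/
noncomputable def planeExponents (s : Finset (ℕ × ℕ)) : Finset (Fin 2 →₀ ℕ) :=
  s.map ⟨fun x => planeExponent x.1 x.2, planeExponent_injective⟩

theorem card_planeExponents (s : Finset (ℕ × ℕ)) : #(planeExponents s) = #s := card_map _

theorem mem_planeExponents {s : Finset (ℕ × ℕ)} {d : Fin 2 →₀ ℕ} :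
    d ∈ planeExponents s ↔ (d 0, d 1) ∈ s := by
  rw [planeExponents, mem_map]
  constructor
  · rintro ⟨x, hx, rfl⟩
    change (planeExponent x.1 x.2 0, planeExponent x.1 x.2 1) ∈ s
    simpa using hx
  · intro h
    exact ⟨_, h, ext_fin_two (planeExponent_zero _ _) (planeExponent_one _ _)⟩

variable {k : Type*} [Field k]

theorem degree_add_apply_eq_totalDegree {f : MvPolynomial (Fin 2) k} :
    degLex.degree f 0 + degLex.degree f 1 = f.totalDegree := by
  rw [← degree_degLexDegree, Finsupp.degree_eq_sum, Fin.sum_univ_two]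

theorem degree_mul_apply {f g : MvPolynomial (Fin 2) k} (hf : f ≠ 0) (hg : g ≠ 0) (i : Fin 2) :
    degLex.degree (f * g) i = degLex.degree f i + degLex.degree g i := by
  rw [degLex.degree_mul hf hg, Finsupp.add_apply]

variable [Fintype k] [DecidableEq k]

theorem degree_fieldRelation_self (i : Fin 2) :
    degLex.degree (fieldRelation i : MvPolynomial (Fin 2) k) i = Fintype.card k := by
  rw [degree_fieldRelation, Finsupp.single_eq_same]

theorem degree_fieldRelation_ne {i j : Fin 2} (h : i ≠ j) :
    degLex.degree (fieldRelation i : MvPolynomial (Fin 2) k) j = 0 := by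
  rw [degree_fieldRelation, Finsupp.single_eq_of_ne (Ne.symm h)]

theorem totalDegree_fieldRelation (i : Fin 2) :
    (fieldRelation i : MvPolynomial (Fin 2) k).totalDegree = Fintype.card k := by
  rw [← degree_degLexDegree, degree_fieldRelation, Finsupp.degree_single]

theorem totalDegree_le_of_fieldRelation_mul {i : Fin 2} {g : MvPolynomial (Fin 2) k} {r : ℕ}
    (h : (fieldRelation i * g).totalDegree ≤ Fintype.card k + r) : g.totalDegree ≤ r := by
  by_cases hg : g = 0
  · simp [hg]
  rw [totalDegree_mul_of_isDomain (fieldRelation_ne_zero i) hg, totalDegree_fieldRelation] at h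
  omega

theorem totalDegree_le_of_degree_lt {p : MvPolynomial (Fin 2) k} {d : Fin 2 →₀ ℕ}
    (h : degLex.degree p ≺[degLex] d) : p.totalDegree ≤ d 0 + d 1 := by
  rw [degLex_lt_iff_fin_two, degree_add_apply_eq_totalDegree] at h
  omega

theorem totalDegree_le_of_degree_le {p : MvPolynomial (Fin 2) k} {d : Fin 2 →₀ ℕ}
    (h : degLex.degree p ≼[degLex] d) : p.totalDegree ≤ d 0 + d 1 := by
  rw [degLex_le_iff_fin_two, degree_add_apply_eq_totalDegree] at h
  omega

/-- `f` divides a nontrivial combination of the field equations with coefficients of degree at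
most one. -/
def DividesAffineCombination (f : MvPolynomial (Fin 2) k) : Prop :=
  ∃ L : Fin 2 → MvPolynomial (Fin 2) k, (∀ i, (L i).totalDegree ≤ 1) ∧ L ≠ 0 ∧
    f ∣ L 0 * fieldRelation 0 + L 1 * fieldRelation 1

/-- The S-polynomial of `f` and `x_i ^ q - x_i` is taken at the monomial `x_i ^ q * x_j`, of total
degree `q + 1`. In a standard representation of it the coefficients of the field relations then have
degree at most one. -/
theorem dividesAffineCombination_of_mixed_aux {f : MvPolynomial (Fin 2) k} (i j : Fin 2)
    (hij : i ≠ j) (hf : f ≠ 0) (hq : f.totalDegree < Fintype.card k)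
    (hj : degLex.degree f j = 1)
    (D : Finset (Fin 2 →₀ ℕ)) (hD : D ⊆ reducedBox (Fintype.card k) 2)
    (hDf : ∀ d ∈ D, degLex.degree f ≤ d) (hcard : Fintype.card k ^ 2 ≤ #(zeros f) + #D) :
    DividesAffineCombination f := by
  have hij' : (i = 0 ∧ j = 1) ∨ (i = 1 ∧ j = 0) :=
    (by decide : ∀ i j : Fin 2, i ≠ j → (i = 0 ∧ j = 1) ∨ (i = 1 ∧ j = 0)) i j hij
  set q := Fintype.card k with hqd
  have hsum : degLex.degree f i + degLex.degree f j = f.totalDegree := by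
    rw [← degree_add_apply_eq_totalDegree]
    rcases hij' with ⟨rfl, rfl⟩ | ⟨rfl, rfl⟩
    · rfl
    · rw [add_comm]
  have hall : ∀ l : Fin 2, l = i ∨ l = j :=
    (by decide : ∀ i j : Fin 2, i ≠ j → ∀ l, l = i ∨ l = j) i j hij
  set l := degLex.leadingCoeff f with hl
  have hl0 : l ≠ 0 := degLex.leadingCoeff_ne_zero_iff.mpr hf
  set c := q - degLex.degree f i with hc
  have hFi : (fieldRelation i : MvPolynomial (Fin 2) k) ≠ 0 := fieldRelation_ne_zero i
  have hFj : (fieldRelation j : MvPolynomial (Fin 2) k) ≠ 0 := fieldRelation_ne_zero j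
  set d : Fin 2 →₀ ℕ := Finsupp.single i q + Finsupp.single j 1 with hd
  have hdi : d i = q := by simp [hd, hij]
  have hdj : d j = 1 := by simp [hd, hij.symm]
  have hd01 : d 0 + d 1 = q + 1 := by
    rcases hij' with ⟨rfl, rfl⟩ | ⟨rfl, rfl⟩ <;> omega
  have hd0 : d ≠ 0 := fun h => by rw [h] at hdj; simp at hdj
  have ext' : ∀ {a b : Fin 2 →₀ ℕ}, a i = b i → a j = b j → a = b := by
    intro a b h1 h2
    ext x
    rcases hall x with rfl | rfl
    · exact h1
    · exact h2
  have hp : degLex.degree (X i ^ c * f) = d := by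
    rw [degLex.degree_mul (pow_ne_zero _ (X_ne_zero i)) hf, degLex.degree_pow, degree_X]
    refine ext' ?_ ?_
    · simp [hdi]; omega
    · simp [hdj, hij, hj]
  have hr : degLex.degree (C l * X j * fieldRelation i : MvPolynomial (Fin 2) k) = d := by
    rw [degLex.degree_mul (mul_ne_zero (by simpa using hl0) (X_ne_zero j)) hFi,
      degLex.degree_mul (by simpa using hl0) (X_ne_zero j), degree_C, degree_X,
      degree_fieldRelation]
    refine ext' ?_ ?_
    · simp [hdi, hij.symm]
      exact hqd.symm
    · simp [hdj, hij]
  have hlt := degree_sub_lt_of_leadingCoeff_eq hd0 hp hr (by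
    rw [leadingCoeff_mul, leadingCoeff_mul, leadingCoeff_mul, leadingCoeff_fieldRelation,
      leadingCoeff_C, leadingCoeff_X, degLex.leadingCoeff_pow, leadingCoeff_X, ← hl]
    simp)
  obtain ⟨g, hg1, hg2⟩ := exists_standard_representation (m := degLex)
    ![f, fieldRelation i, fieldRelation j]
    (by intro x; fin_cases x <;> simp [hf, hFi, hFj])
    (by
      intro x
      rcases hall x with rfl | rfl
      · exact ⟨1, rfl⟩
      · exact ⟨2, rfl⟩) (zeros f)
    (by
      intro x P hP
      fin_cases x
      exacts [mem_zeros.mp hP, eval_fieldRelation _ _, eval_fieldRelation _ _]) D hD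
    (fun d hd => ⟨0, hDf d hd⟩) hcard (X i ^ c * f - C l * X j * fieldRelation i)
    (by
      intro P hP
      rw [map_sub, map_mul, map_mul, mem_zeros.mp hP, eval_fieldRelation, mul_zero, mul_zero,
        sub_zero])
  rw [Fin.sum_univ_three] at hg1
  have h0 := (hg2 0).trans_lt hlt
  have h1 := (hg2 1).trans_lt hlt
  have h2 := (hg2 2).trans_lt hlt
  simp only [Matrix.cons_val_zero, Matrix.cons_val_one, Matrix.cons_val] at hg1 h0 h1 h2
  have d1 := totalDegree_le_of_degree_lt h1
  have d2 := totalDegree_le_of_degree_lt h2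
  rw [hd01] at d1 d2
  have k1 := totalDegree_le_of_fieldRelation_mul d1
  have k2 := totalDegree_le_of_fieldRelation_mul d2
  have hrel : (X i ^ c - g 0) * f =
      (C l * X j + g 1) * fieldRelation i + g 2 * fieldRelation j := by
    linear_combination hg1
  -- The representation lies strictly below the exponent `d` of `X i ^ c * f`, so `g 0` cannot
  -- cancel `X i ^ c`. This gives a nonzero combination.
  have hne : X i ^ c - g 0 ≠ 0 := by
    intro h
    rw [sub_eq_zero] at h
    rw [← h, mul_comm, hp] at h0
    exact lt_irrefl _ h0
  have hL : (C l * X j + g 1).totalDegree ≤ 1 :=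
    (totalDegree_add _ _).trans (max_le ((totalDegree_mul _ _).trans (by simp)) k1)
  have hnz : (C l * X j + g 1) * fieldRelation i + g 2 * fieldRelation j ≠ 0 :=
    hrel ▸ mul_ne_zero hne hf
  rcases hij' with ⟨rfl, rfl⟩ | ⟨rfl, rfl⟩
  · refine ⟨![C l * X 1 + g 1, g 2], ?_, ?_, ?_⟩
    · intro x; fin_cases x
      · exact hL
      · exact k2
    · intro h
      have e0 := congrFun h 0
      have e1 := congrFun h 1
      simp only [Matrix.cons_val_zero, Matrix.cons_val_one, Pi.zero_apply] at e0 e1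
      rw [e0, e1] at hnz
      simp at hnz
    · exact ⟨X 0 ^ c - g 0, by simp only [Matrix.cons_val_zero, Matrix.cons_val_one]; rw [← hrel]; ring⟩
  · refine ⟨![g 2, C l * X 0 + g 1], ?_, ?_, ?_⟩
    · intro x; fin_cases x
      · exact k2
      · exact hL
    · intro h
      have e0 := congrFun h 0
      have e1 := congrFun h 1
      simp only [Matrix.cons_val_zero, Matrix.cons_val_one, Pi.zero_apply] at e0 e1
      rw [e0, e1] at hnz
      simp at hnz
    · exact ⟨X 1 ^ c - g 0, by
        simp only [Matrix.cons_val_zero, Matrix.cons_val_one]; rw [add_comm, ← hrel]; ring⟩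

theorem dividesAffineCombination_of_mixed {f : MvPolynomial (Fin 2) k}
    (hq : f.totalDegree < Fintype.card k) (h0 : degLex.degree f 0 ≠ 0)
    (h1 : degLex.degree f 1 ≠ 0)
    (hN : f.totalDegree * Fintype.card k ≤ #(zeros f) + (f.totalDegree - 1)) :
    DividesAffineCombination f ∧
      f.totalDegree * Fintype.card k = #(zeros f) + (f.totalDegree - 1) := by
  have hf : f ≠ 0 := by rintro rfl; simp at h0
  have hsum := degree_add_apply_eq_totalDegree (f := f)
  set q := Fintype.card k with hqd
  obtain ⟨α, hα⟩ : ∃ α, α = degLex.degree f 0 := ⟨_, rfl⟩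
  obtain ⟨β, hβ⟩ : ∃ β, β = degLex.degree f 1 := ⟨_, rfl⟩
  set D := planeExponents (Ico α q ×ˢ Ico β q) with hDdef
  have hD : D ⊆ reducedBox q 2 := by
    intro d hd
    rw [hDdef, mem_planeExponents] at hd
    simp only [mem_product, mem_Ico] at hd
    rw [mem_reducedBox, Fin.forall_fin_two]
    omega
  have hDf : ∀ d ∈ D, degLex.degree f ≤ d := by
    intro d hd
    rw [hDdef, mem_planeExponents] at hd
    simp only [mem_product, mem_Ico] at hd
    rw [le_iff_fin_two]
    omega
  have hDcard : #D = (q - α) * (q - β) := by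
    rw [hDdef, card_planeExponents, card_product, Nat.card_Ico, Nat.card_Ico]
  have hbound := card_add_card_le_of_footprint (m := degLex)
    ![f, fieldRelation 0, fieldRelation 1]
    (by intro x; fin_cases x <;> simp [hf, fieldRelation_ne_zero])
    (by
      intro x
      fin_cases x
      · exact ⟨1, rfl⟩
      · exact ⟨2, rfl⟩) (zeros f)
    (by
      intro x P hP
      fin_cases x
      exacts [mem_zeros.mp hP, eval_fieldRelation _ _, eval_fieldRelation _ _]) D hD (fun d hd => ⟨0, hDf d hd⟩)
  rw [← hqd] at hbound
  -- The footprint bound thus reads `N ≤ e q - α β`. Since `α β = (e - 1) + (α - 1)(β - 1)`, the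
  -- hypothesis forces equality and one exponent equal to one.
  have hcomp : (q - α) * (q - β) + f.totalDegree * q = q ^ 2 + α * β := by
    rw [← hsum, ← hα, ← hβ]
    obtain ⟨a, ha⟩ := Nat.exists_eq_add_of_le (show α ≤ q by omega)
    obtain ⟨b, hb⟩ := Nat.exists_eq_add_of_le (show β ≤ q by omega)
    have e1 : q - α = a := by omega
    have e2 : q - β = b := by omega
    rw [e1, e2]
    zify at *
    linear_combination (-(b : ℤ)) * ha + (α - (q : ℤ)) * hb
  have hαβ : α * β + 1 = α + β + (α - 1) * (β - 1) := by
    obtain ⟨a, rfl⟩ := Nat.exists_eq_add_of_le (show 1 ≤ α by omega)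
    obtain ⟨b, rfl⟩ := Nat.exists_eq_add_of_le (show 1 ≤ β by omega)
    simp only [Nat.add_sub_cancel_left]
    ring
  have hprod : (α - 1) * (β - 1) = 0 := by
    rw [hDcard] at hbound
    omega
  have heq : f.totalDegree * q = #(zeros f) + (f.totalDegree - 1) := by
    rw [hDcard] at hbound
    omega
  refine ⟨?_, heq⟩
  have hcard : q ^ 2 ≤ #(zeros f) + #D := by
    rw [hDcard]
    omega
  rcases Nat.mul_eq_zero.mp hprod with h | h
  · exact dividesAffineCombination_of_mixed_aux 1 0 (by decide) hf hq (by omega) D hD hDf hcard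
  · exact dividesAffineCombination_of_mixed_aux 0 1 (by decide) hf hq (by omega) D hD hDf hcard

end PlaneGroebner

/-! ### Planar polynomials with leading monomial a power of `x₀` -/

section PlanePure

open MvPolynomial Finset MonomialOrder

set_option linter.unusedSectionVars false

variable {k : Type*} [Field k] [Fintype k] [DecidableEq k]

theorem forall_exists_fieldRelation_four (f R : MvPolynomial (Fin 2) k) (j : Fin 2) :
    ∃ i, ![f, R, fieldRelation 0, fieldRelation 1] i = fieldRelation j := by
  fin_cases j
  · exact ⟨2, rfl⟩
  · exact ⟨3, rfl⟩

theorem pure_vanish {f R : MvPolynomial (Fin 2) k} (hR : ∀ P ∈ zeros f, eval P R = 0)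
    (i : Fin 4) (P : Fin 2 → k) (hP : P ∈ zeros f) :
    eval P (![f, R, fieldRelation 0, fieldRelation 1] i) = 0 := by
  fin_cases i
  exacts [mem_zeros.mp hP, hR P hP, eval_fieldRelation _ _, eval_fieldRelation _ _]

theorem pure_ne_zero {f R : MvPolynomial (Fin 2) k} (hf : f ≠ 0) (hR : R ≠ 0) (i : Fin 4) :
    ![f, R, fieldRelation 0, fieldRelation 1] i ≠ 0 := by
  fin_cases i
  exacts [hf, hR, fieldRelation_ne_zero _, fieldRelation_ne_zero _]

theorem eq_C_of_degree_lt_single_one {g : MvPolynomial (Fin 2) k}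
    (h : degLex.degree g ≺[degLex] Finsupp.single 1 1) : ∃ c, g = C c := by
  rw [degLex_lt_iff_fin_two, degree_add_apply_eq_totalDegree] at h
  have : g.totalDegree = 0 := by
    rw [← degree_add_apply_eq_totalDegree] at h ⊢
    simp at h
    omega
  exact ⟨_, totalDegree_eq_zero_iff_eq_C.mp this⟩

/-- Cancelling a factor in a strict comparison of leading exponents. -/
theorem degree_lt_of_degree_mul_lt {p g : MvPolynomial (Fin 2) k} {d e : Fin 2 →₀ ℕ}
    (hp : p ≠ 0) (he : e ≠ 0) (hd : d = degLex.degree p + e)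
    (h : degLex.degree (p * g) ≺[degLex] d) : degLex.degree g ≺[degLex] e := by
  by_cases hg : g = 0
  · rw [hg, degree_zero]
    exact degLex.toSyn_strictMono (pos_iff_ne_zero.mpr he)
  rw [degLex.degree_mul hp hg, hd, map_add, map_add] at h
  exact lt_of_add_lt_add_left h

/-- If `g` had degree one, the product would have total degree `q + 1` and `x₀`-exponent at least `q
> d 0`, hence a leading monomial above `d`. -/
theorem eq_C_of_fieldRelation_mul {g : MvPolynomial (Fin 2) k} {d : Fin 2 →₀ ℕ}
    (hd : d 0 + d 1 = Fintype.card k + 1) (hd0 : d 0 < Fintype.card k)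
    (h : degLex.degree (fieldRelation 0 * g) ≺[degLex] d) : ∃ c, g = C c := by
  by_cases hg : g = 0
  · exact ⟨0, by simp [hg]⟩
  rw [degLex_lt_iff_fin_two, degree_mul_apply (fieldRelation_ne_zero 0) hg,
    degree_mul_apply (fieldRelation_ne_zero 0) hg, degree_fieldRelation_self,
    degree_fieldRelation_ne (by decide)] at h
  have : g.totalDegree = 0 := by
    rw [← degree_add_apply_eq_totalDegree]
    omega
  exact ⟨_, totalDegree_eq_zero_iff_eq_C.mp this⟩

/-- The S-polynomial of `R` and `x₁ ^ q - x₁`, taken at `x₀ * x₁ ^ q`. -/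
theorem dividesAffineCombination_of_pure_one {f R A : MvPolynomial (Fin 2) k} {c : k}
    (hf : f ≠ 0) (hR0 : R ≠ 0)
    (hR : fieldRelation 0 = A * f + C c * fieldRelation 1 + R)
    (hdR : degLex.degree R = planeExponent 1 (Fintype.card k - 1))
    (D : Finset (Fin 2 →₀ ℕ)) (hD : D ⊆ reducedBox (Fintype.card k) 2)
    (hDf : ∀ d ∈ D, degLex.degree f ≤ d ∨ degLex.degree R ≤ d)
    (hcard : Fintype.card k ^ 2 ≤ #(zeros f) + #D) :
    DividesAffineCombination f := by
  have hq1 : 1 < Fintype.card k := Fintype.one_lt_card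
  set q := Fintype.card k with hqd
  have hvan : ∀ P ∈ zeros f, eval P R = 0 := by
    intro P hP
    have := congrArg (eval P) hR
    rw [map_add, map_add, map_mul, map_mul, eval_fieldRelation, eval_fieldRelation,
      mem_zeros.mp hP, mul_zero, mul_zero, zero_add, zero_add] at this
    exact this.symm
  set r := degLex.leadingCoeff R with hr
  have hr0 : r ≠ 0 := degLex.leadingCoeff_ne_zero_iff.mpr hR0
  set d := planeExponent 1 q with hd
  have hp : degLex.degree (X 1 * R) = d := by
    rw [degLex.degree_mul (X_ne_zero 1) hR0, degree_X, hdR]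
    exact ext_fin_two (by simp [hd]) (by simp [hd]; omega)
  have hp' : degLex.degree (C r * X 0 * fieldRelation 1 : MvPolynomial (Fin 2) k) = d := by
    rw [degLex.degree_mul (mul_ne_zero (by simpa using hr0) (X_ne_zero 0)) (fieldRelation_ne_zero 1),
      degLex.degree_mul (by simpa using hr0) (X_ne_zero 0), degree_C, degree_X,
      degree_fieldRelation]
    exact ext_fin_two (by simp [hd]) (by simp [hd, hqd])
  have hlt := degree_sub_lt_of_leadingCoeff_eq
    (fun h => by simpa [hd] using DFunLike.congr_fun h 0) hp hp' (by
    rw [leadingCoeff_mul, leadingCoeff_mul, leadingCoeff_mul, leadingCoeff_fieldRelation,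
      leadingCoeff_C, leadingCoeff_X, leadingCoeff_X, ← hr]
    simp)
  obtain ⟨g, hg1, hg2⟩ := exists_standard_representation (m := degLex) _
    (pure_ne_zero hf hR0) (forall_exists_fieldRelation_four f R) (zeros f) (pure_vanish hvan) D hD
    (fun d hd => (hDf d hd).elim (fun h => ⟨0, h⟩) fun h => ⟨1, h⟩) hcard
    (X 1 * R - C r * X 0 * fieldRelation 1) (by
      intro P hP
      rw [map_sub, map_mul, map_mul, hvan P hP, eval_fieldRelation, mul_zero, mul_zero, sub_zero])
  rw [Fin.sum_univ_four] at hg1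
  have h1 := (hg2 1).trans_lt hlt
  have h2 := (hg2 2).trans_lt hlt
  have h3 := (hg2 3).trans_lt hlt
  simp only [Matrix.cons_val_zero, Matrix.cons_val_one, Matrix.cons_val] at hg1 h1 h2 h3
  obtain ⟨γ, hγ⟩ := eq_C_of_degree_lt_single_one (degree_lt_of_degree_mul_lt
    (e := Finsupp.single 1 1) hR0 (by simp) (by
      rw [hdR]; exact ext_fin_two (by simp [hd]) (by simp [hd]; omega)) h1)
  obtain ⟨δ, hδ⟩ := eq_C_of_fieldRelation_mul (by simp [hd]; omega) (by simp [hd]; omega) h2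
  have d3 := totalDegree_le_of_degree_lt h3
  have k3 : (g 3).totalDegree ≤ 1 := totalDegree_le_of_fieldRelation_mul (i := 1) (by
    refine d3.trans ?_
    simp [hd]; omega)
  -- `R` is eliminated from the representation by `hR`; these are the resulting coefficients of the
  -- two field relations. The first contains `X 1` with coefficient one, so the pair is nonzero.
  refine ⟨![X 1 - C γ - C δ, - C c * (X 1 - C γ) - C r * X 0 - g 3], ?_, ?_, ?_⟩
  · have t1 : (X 1 - C γ : MvPolynomial (Fin 2) k).totalDegree ≤ 1 :=
      (totalDegree_sub _ _).trans (by simp)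
    intro x; fin_cases x
    · exact (totalDegree_sub _ _).trans (max_le t1 (by simp))
    · refine (totalDegree_sub _ _).trans (max_le ((totalDegree_sub _ _).trans (max_le ?_ ?_)) k3)
      · rw [← C_neg]
        exact (totalDegree_mul _ _).trans (by rw [totalDegree_C, zero_add]; exact t1)
      · exact (totalDegree_mul _ _).trans (by simp)
  · intro h
    have e0 := congrArg (coeff (Finsupp.single 1 1)) (congrFun h 0)
    have hne : (0 : Fin 2 →₀ ℕ) ≠ Finsupp.single 1 1 := fun h => by
      simpa using DFunLike.congr_fun h 1
    simp [coeff_C, hne] at e0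
  · refine ⟨g 0 + A * (X 1 - g 1), ?_⟩
    simp only [Matrix.cons_val_zero, Matrix.cons_val_one]
    rw [← hγ, ← hδ]
    linear_combination hg1 + (X 1 - g 1) * hR

/-- The S-polynomial of `f` and `R`, taken at `x₀ ^ e * x₁ ^ b`, again of total degree `q + 1`. -/
theorem dividesAffineCombination_of_pure_pred {f R A : MvPolynomial (Fin 2) k} {c : k}
    (hf : f ≠ 0) (hR0 : R ≠ 0)
    (hR : fieldRelation 0 = A * f + C c * fieldRelation 1 + R) {e b : ℕ} (he : e ≠ 0)
    (heq : e < Fintype.card k) (hb : e + b = Fintype.card k + 1)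
    (hdf : degLex.degree f = planeExponent e 0)
    (hdR : degLex.degree R = planeExponent (e - 1) b)
    (D : Finset (Fin 2 →₀ ℕ)) (hD : D ⊆ reducedBox (Fintype.card k) 2)
    (hDf : ∀ d ∈ D, degLex.degree f ≤ d ∨ degLex.degree R ≤ d)
    (hcard : Fintype.card k ^ 2 ≤ #(zeros f) + #D) :
    DividesAffineCombination f := by
  set q := Fintype.card k with hqd
  have hvan : ∀ P ∈ zeros f, eval P R = 0 := by
    intro P hP
    have := congrArg (eval P) hR
    rw [map_add, map_add, map_mul, map_mul, eval_fieldRelation, eval_fieldRelation,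
      mem_zeros.mp hP, mul_zero, mul_zero, zero_add, zero_add] at this
    exact this.symm
  set r := degLex.leadingCoeff R with hr
  have hr0 : r ≠ 0 := degLex.leadingCoeff_ne_zero_iff.mpr hR0
  set l := degLex.leadingCoeff f with hl
  have hl0 : l ≠ 0 := degLex.leadingCoeff_ne_zero_iff.mpr hf
  set d := planeExponent e b with hd
  have hp : degLex.degree (C r * X 1 ^ b * f) = d := by
    rw [degLex.degree_mul (mul_ne_zero (by simpa using hr0) (pow_ne_zero _ (X_ne_zero 1))) hf,
      degLex.degree_mul (by simpa using hr0) (pow_ne_zero _ (X_ne_zero 1)), degree_C,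
      degLex.degree_pow, degree_X, hdf]
    exact ext_fin_two (by simp [hd]) (by simp [hd])
  have hp' : degLex.degree (C l * X 0 * R) = d := by
    rw [degLex.degree_mul (mul_ne_zero (by simpa using hl0) (X_ne_zero 0)) hR0,
      degLex.degree_mul (by simpa using hl0) (X_ne_zero 0), degree_C, degree_X, hdR]
    exact ext_fin_two (by simp [hd]; omega) (by simp [hd])
  have hlt := degree_sub_lt_of_leadingCoeff_eq
    (fun h => he (by simpa [hd] using DFunLike.congr_fun h 0)) hp hp' (by
    rw [leadingCoeff_mul, leadingCoeff_mul, leadingCoeff_mul, leadingCoeff_mul,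
      leadingCoeff_C, leadingCoeff_C, leadingCoeff_X, degLex.leadingCoeff_pow, leadingCoeff_X,
      ← hr, ← hl]
    simp [mul_comm])
  obtain ⟨g, hg1, hg2⟩ := exists_standard_representation (m := degLex) _
    (pure_ne_zero hf hR0) (forall_exists_fieldRelation_four f R) (zeros f) (pure_vanish hvan) D hD
    (fun d hd => (hDf d hd).elim (fun h => ⟨0, h⟩) fun h => ⟨1, h⟩) hcard
    (C r * X 1 ^ b * f - C l * X 0 * R) (by
      intro P hP
      rw [map_sub, map_mul, map_mul _ _ R, hvan P hP, mem_zeros.mp hP, mul_zero, mul_zero, sub_zero])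
  rw [Fin.sum_univ_four] at hg1
  have h1 := (hg2 1).trans_lt hlt
  have h2 := (hg2 2).trans_lt hlt
  have h3 := (hg2 3).trans_lt hlt
  simp only [Matrix.cons_val_zero, Matrix.cons_val_one, Matrix.cons_val] at hg1 h1 h2 h3
  have hg1lt : degLex.degree (g 1) ≺[degLex] Finsupp.single 0 1 := degree_lt_of_degree_mul_lt
    hR0 (by simp) (by
      rw [hdR]; exact ext_fin_two (by simp [hd]; omega) (by simp [hd])) h1
  obtain ⟨δ, hδ⟩ := eq_C_of_fieldRelation_mul (by simp [hd]; omega) (by simp [hd]; omega) h2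
  have d3 := totalDegree_le_of_degree_lt h3
  have k1 : (g 1).totalDegree ≤ 1 := by simpa using totalDegree_le_of_degree_lt hg1lt
  have k3 : (g 3).totalDegree ≤ 1 := totalDegree_le_of_fieldRelation_mul (i := 1) (by
    refine d3.trans ?_
    simp [hd]; omega)
  have t1 : (C l * X 0 + g 1).totalDegree ≤ 1 :=
    (totalDegree_add _ _).trans (max_le ((totalDegree_mul _ _).trans (by simp)) k1)
  refine ⟨![(C l * X 0 + g 1) + C δ, - C c * (C l * X 0 + g 1) + g 3], ?_, ?_, ?_⟩
  · intro x; fin_cases x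
    · exact (totalDegree_add _ _).trans (max_le t1 (by simp))
    · refine (totalDegree_add _ _).trans (max_le ?_ k3)
      rw [← C_neg]
      exact (totalDegree_mul _ _).trans (by rw [totalDegree_C, zero_add]; exact t1)
  · intro h
    have e0 := congrArg (coeff (Finsupp.single 0 1)) (congrFun h 0)
    -- The coefficient of `X 0` in the first entry is `l`, because `g 1` lies strictly below `X 0`.
    have hne : (0 : Fin 2 →₀ ℕ) ≠ Finsupp.single 0 1 := fun h => by
      simpa using DFunLike.congr_fun h 0
    simp [coeff_C, hne, coeff_C_mul, degLex.coeff_eq_zero_of_lt hg1lt] at e0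
    exact hl0 e0
  · refine ⟨C r * X 1 ^ b + A * (C l * X 0 + g 1) - g 0, ?_⟩
    simp only [Matrix.cons_val_zero, Matrix.cons_val_one]
    rw [← hδ]
    linear_combination -hg1 + (C l * X 0 + g 1) * hR

end PlanePure

/-! ### Planar polynomials with many zeros divide a combination of field relations -/

section PlaneStructure

open MvPolynomial Finset MonomialOrder

set_option linter.unusedSectionVars false

variable {k : Type*} [Field k] [Fintype k] [DecidableEq k]

/-- With `y = e - a` and `z = q - b`, the two counts give `y z ≤ e - 1`, while `z ≥ a`. Since `y a =
(e - 1) + (y - 1)(a - 1)`, this forces `z = a`, and `a = 1` or `y = 1`. -/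
theorem pure_exponent_arith {e q a b E N : ℕ} (h2 : 2 ≤ e) (heq : e < q) (hE : E = e - 1)
    (ha : a < e) (hb : b < q) (hab : a + b ≤ q) (hN : e * q ≤ N + E)
    (hbound : N + ((q - e) * q + (e - a) * (q - b)) ≤ q ^ 2) :
    a + b = q ∧ (a = 1 ∨ a = e - 1) ∧ e * q = N + E ∧
      q ^ 2 ≤ N + ((q - e) * q + (e - a) * (q - b)) := by
  obtain ⟨x, rfl⟩ := Nat.exists_eq_add_of_le heq.le
  obtain ⟨y, rfl⟩ := Nat.exists_eq_add_of_le ha.le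
  obtain ⟨z, hz⟩ := Nat.exists_eq_add_of_le hb.le
  have e1 : a + y + x - (a + y) = x := by omega
  have e2 : a + y - a = y := by omega
  have e3 : a + y + x - b = z := by omega
  rw [e1, e2, e3] at hbound ⊢
  have hz1 : a ≤ z := by omega
  have hy1 : 1 ≤ y := by omega
  have hyz : y * z ≤ E := by nlinarith
  have ha1 : 1 ≤ a := by
    by_contra h
    have : 1 ≤ z := by omega
    have : y * 1 ≤ y * z := Nat.mul_le_mul le_rfl this
    omega
  obtain ⟨w, rfl⟩ := Nat.exists_eq_add_of_le hz1
  obtain ⟨a', rfl⟩ := Nat.exists_eq_add_of_le ha1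
  obtain ⟨y', rfl⟩ := Nat.exists_eq_add_of_le hy1
  have hE' : E = 1 + a' + y' := by omega
  have key : (1 + y') * (1 + a' + w) = 1 + a' + y' + (y' * a' + (1 + y') * w) := by ring
  have hw : y' * a' + (1 + y') * w = 0 := by omega
  have hw0 : w = 0 := by
    have := (Nat.add_eq_zero_iff.mp hw).2
    rcases Nat.mul_eq_zero.mp this with h | h <;> omega
  have hya : y' = 0 ∨ a' = 0 := Nat.mul_eq_zero.mp (Nat.add_eq_zero_iff.mp hw).1
  have hN' : (1 + a' + (1 + y')) * (1 + a' + (1 + y') + x) = N + E := by nlinarith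
  refine ⟨by omega, by omega, hN', ?_⟩
  nlinarith

theorem plane_structure_of_pure {f : MvPolynomial (Fin 2) k} (h2 : 2 ≤ f.totalDegree)
    (hq : f.totalDegree < Fintype.card k) (h1 : degLex.degree f 1 = 0)
    (hN : f.totalDegree * Fintype.card k ≤ #(zeros f) + (f.totalDegree - 1)) :
    (∃ c : k, f ∣ fieldRelation 0 - C c * fieldRelation 1) ∨
    (DividesAffineCombination f ∧
      f.totalDegree * Fintype.card k = #(zeros f) + (f.totalDegree - 1)) := by
  have hf : f ≠ 0 := by rintro rfl; simp at h2
  have hsum := degree_add_apply_eq_totalDegree (f := f)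
  set q := Fintype.card k with hqd
  obtain ⟨e, he⟩ : ∃ e, e = f.totalDegree := ⟨_, rfl⟩
  have hdf : degLex.degree f = planeExponent e 0 := ext_fin_two (by simp; omega) (by simp [h1])
  -- The remainder `R` of `x₀ ^ q - x₀` vanishes on the zeros of `f`. Either it is zero, or its
  -- leading monomial sharpens the footprint bound.
  obtain ⟨g, R, hR, hg, hRs⟩ := degLex.div (b := ![f, fieldRelation 1])
    (fun i => isUnit_iff_ne_zero.mpr (degLex.leadingCoeff_ne_zero_iff.mpr (by
      fin_cases i
      exacts [hf, fieldRelation_ne_zero _]))) (fieldRelation 0)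
  rw [Finsupp.linearCombination_apply, Finsupp.sum_fintype _ _ (by simp), Fin.sum_univ_two] at hR
  have hg0 := totalDegree_le_of_degree_le (hg 0)
  have hg1 := totalDegree_le_of_degree_le (hg 1)
  rw [degree_add_apply_eq_totalDegree, totalDegree_fieldRelation, ← hqd] at hg0 hg1
  simp only [Matrix.cons_val_zero, Matrix.cons_val_one, smul_eq_mul] at hR hg0 hg1
  have k1 : (g 1).totalDegree ≤ 0 :=
    totalDegree_le_of_fieldRelation_mul (i := 1) (by rw [← hqd]; simpa using hg1)
  obtain ⟨c, hc⟩ : ∃ c, g 1 = C c := ⟨_, totalDegree_eq_zero_iff_eq_C.mp (by omega)⟩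
  rw [hc] at hR hg1
  by_cases hR0 : R = 0
  · left
    refine ⟨c, g 0, ?_⟩
    rw [hR0] at hR
    linear_combination hR
  right
  have hRdeg : R.totalDegree ≤ q := by
    have : R = fieldRelation 0 - (f * g 0 + fieldRelation 1 * C c) := by linear_combination -hR
    rw [this]
    refine (totalDegree_sub _ _).trans (max_le (totalDegree_fieldRelation 0).le ?_)
    exact (totalDegree_add _ _).trans (max_le hg0 hg1)
  have hRmem := (degLex.degree_mem_support_iff R).mpr hR0
  have hν0 := hRs _ hRmem 0
  have hν1 := hRs _ hRmem 1
  simp only [Matrix.cons_val_zero, Matrix.cons_val_one] at hν0 hν1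
  rw [hdf, le_iff_fin_two] at hν0
  rw [degree_fieldRelation, Finsupp.single_le_iff, ← hqd] at hν1
  simp only [planeExponent_zero, planeExponent_one] at hν0 hν1
  replace hν0 : degLex.degree R 0 < e := by
    by_contra h
    exact hν0 ⟨by omega, Nat.zero_le _⟩
  replace hν1 : degLex.degree R 1 < q := not_le.mp hν1
  have hRsum := degree_add_apply_eq_totalDegree (f := R)
  obtain ⟨a, ha⟩ : ∃ a, a = degLex.degree R 0 := ⟨_, rfl⟩
  obtain ⟨b, hb⟩ : ∃ b, b = degLex.degree R 1 := ⟨_, rfl⟩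
  rw [← ha] at hν0
  rw [← hb] at hν1
  have hdR : degLex.degree R = planeExponent a b := ext_fin_two (by simp [ha]) (by simp [hb])
  have hvan : ∀ P ∈ zeros f, eval P R = 0 := by
    intro P hP
    have := congrArg (eval P) hR
    rw [map_add, map_add, map_mul, map_mul, eval_fieldRelation, eval_fieldRelation,
      mem_zeros.mp hP, mul_zero, mul_zero, zero_add, zero_add] at this
    exact this.symm
  -- `s₁` holds the reduced multiples of the leading monomial of `f`, and `s₂` the further ones
  -- coming from `R`.
  set s₁ := Ico e q ×ˢ range q with hs1
  set s₂ := Ico a e ×ˢ Ico b q with hs2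
  have hdisj : Disjoint s₁ s₂ := by
    rw [disjoint_left]
    intro x hx hx'
    simp only [hs1, hs2, mem_product, mem_Ico] at hx hx'
    omega
  have hcardD : #(planeExponents (s₁ ∪ s₂)) = (q - e) * q + (e - a) * (q - b) := by
    rw [card_planeExponents, card_union_of_disjoint hdisj, hs1, hs2, card_product, card_product]
    simp
  have hD : planeExponents (s₁ ∪ s₂) ⊆ reducedBox q 2 := by
    intro d hd
    rw [mem_planeExponents, hs1, hs2] at hd
    simp only [mem_union, mem_product, mem_Ico, mem_range] at hd
    rw [mem_reducedBox, Fin.forall_fin_two]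
    omega
  have hDf : ∀ d ∈ planeExponents (s₁ ∪ s₂), degLex.degree f ≤ d ∨ degLex.degree R ≤ d := by
    intro d hd
    rw [mem_planeExponents, hs1, hs2] at hd
    simp only [mem_union, mem_product, mem_Ico, mem_range] at hd
    rw [le_iff_fin_two, le_iff_fin_two, hdf, hdR]
    simp only [planeExponent_zero, planeExponent_one]
    omega
  have hbound := card_add_card_le_of_footprint (m := degLex) _ (pure_ne_zero hf hR0)
    (forall_exists_fieldRelation_four f R) (zeros f) (pure_vanish hvan) _ hD
    (fun d hd => (hDf d hd).elim (fun h => ⟨0, h⟩) fun h => ⟨1, h⟩)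
  rw [← hqd, hcardD] at hbound
  rw [← he] at h2 hq hN ⊢
  obtain ⟨hab, ha1, heq, hcard⟩ := pure_exponent_arith h2 hq rfl hν0 hν1 (by omega) hN hbound
  rw [← hcardD] at hcard
  refine ⟨?_, heq⟩
  have hR' : fieldRelation 0 = g 0 * f + C c * fieldRelation 1 + R := hR
  rcases ha1 with rfl | rfl
  · refine dividesAffineCombination_of_pure_one hf hR0 hR' ?_ _ hD hDf hcard
    rw [hdR, ← hqd, ← hab, Nat.add_sub_cancel_left]
  · exact dividesAffineCombination_of_pure_pred hf hR0 hR' (by omega) hq (by omega) hdf hdR _ hD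
      hDf hcard

/-- A polynomial in two variables of degree `2 ≤ e < q` with at least `e q - (e - 1)` zeros divides
a nontrivial combination of the field equations with affine coefficients, which can be taken to
be constants unless it has exactly `e q - (e - 1)` zeros. -/
theorem plane_structure {f : MvPolynomial (Fin 2) k} (h2 : 2 ≤ f.totalDegree)
    (hq : f.totalDegree < Fintype.card k)
    (hN : f.totalDegree * Fintype.card k ≤ #(zeros f) + (f.totalDegree - 1)) :
    (∃ c : Fin 2 → k, c ≠ 0 ∧ f ∣ C (c 0) * fieldRelation 0 + C (c 1) * fieldRelation 1) ∨
    (DividesAffineCombination f ∧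
      f.totalDegree * Fintype.card k = #(zeros f) + (f.totalDegree - 1)) := by
  have hsum := degree_add_apply_eq_totalDegree (f := f)
  by_cases h1 : degLex.degree f 1 = 0
  · refine (plane_structure_of_pure h2 hq h1 hN).imp_left fun ⟨c, hc⟩ => ⟨![1, -c], ?_, ?_⟩
    · intro h
      simpa using congrFun h 0
    · simpa [sub_eq_add_neg] using hc
  by_cases h0 : degLex.degree f 0 = 0
  swap
  · exact Or.inr (dividesAffineCombination_of_mixed hq h0 h1 hN)
  -- The leading monomial is a power of `x₁`; exchanging the variables turns it into a power of
  -- `x₀`, which is maximal in its degree.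
  set σ : Fin 2 ≃ Fin 2 := Equiv.swap 0 1 with hσ
  have hσσ : ∀ p : MvPolynomial (Fin 2) k, rename σ (rename σ p) = p := by
    intro p
    rw [rename_rename]
    have : (σ ∘ σ : Fin 2 → Fin 2) = id := by
      funext i
      simp [hσ]
    rw [this, rename_id_apply]
  have htot : (rename σ f).totalDegree = f.totalDegree :=
    totalDegree_renameEquiv σ f
  have hzeros : #(zeros (rename σ f)) = #(zeros f) := by
    refine card_bij (fun P _ => P ∘ σ) ?_ ?_ ?_
    · intro P hP
      rw [mem_zeros, eval_rename] at hP
      exact mem_zeros.mpr hP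
    · intro P _ P' _ h
      exact σ.surjective.injective_comp_right h
    · intro P hP
      refine ⟨P ∘ σ, ?_, ?_⟩
      · rw [mem_zeros, eval_rename]
        have : (P ∘ σ) ∘ σ = P := by funext i; simp [hσ]
        rw [this]
        exact mem_zeros.mp hP
      · funext i; simp [hσ]
  have hfield0 : rename σ (fieldRelation 0 : MvPolynomial (Fin 2) k) = fieldRelation 1 := by
    simp [fieldRelation, hσ]
  have hfield1 : rename σ (fieldRelation 1 : MvPolynomial (Fin 2) k) = fieldRelation 0 := by
    simp [fieldRelation, hσ]
  have hf : f ≠ 0 := by rintro rfl; simp at h2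
  have hcoef : coeff (Finsupp.single 0 f.totalDegree) (rename σ f) ≠ 0 := by
    have : Finsupp.single (0 : Fin 2) f.totalDegree =
        (Finsupp.single 1 f.totalDegree).mapDomain σ := by
      rw [Finsupp.mapDomain_single]
      simp [hσ]
    rw [this, coeff_rename_mapDomain _ σ.injective]
    have h3 : Finsupp.single 1 f.totalDegree = degLex.degree f :=
      ext_fin_two (by simp [h0]) (by simp; omega)
    rw [h3]
    exact degLex.leadingCoeff_ne_zero_iff.mpr hf
  have hdeg1 : degLex.degree (rename σ f) 1 = 0 := by
    have h3 := degLex.le_degree (mem_support_iff.mpr hcoef)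
    have h4 := degree_add_apply_eq_totalDegree (f := rename σ f)
    rw [degLex_le_iff_fin_two] at h3
    simp at h3
    omega
  rw [← htot] at h2 hq
  rw [← htot, ← hzeros] at hN
  rcases plane_structure_of_pure h2 hq hdeg1 hN with ⟨c, hc⟩ | ⟨⟨L, hL1, hL0, hLd⟩, hEq⟩
  · left
    have h3 := map_dvd (rename σ) hc
    rw [hσσ, map_sub, map_mul, hfield0, hfield1, rename_C] at h3
    refine ⟨![-c, 1], ?_, ?_⟩
    · intro h
      have := congrFun h (1 : Fin 2)
      simp at this
    · have h4 : (fieldRelation 1 - C c * fieldRelation 0 : MvPolynomial (Fin 2) k) =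
          C ((![-c, 1] : Fin 2 → k) 0) * fieldRelation 0 +
            C ((![-c, 1] : Fin 2 → k) 1) * fieldRelation 1 := by
        simp only [Matrix.cons_val_zero, Matrix.cons_val_one, C_neg, C_1]
        ring
      rwa [h4] at h3
  · right
    rw [htot, hzeros] at hEq
    refine ⟨⟨fun i => rename σ (L (σ i)), ?_, ?_, ?_⟩, hEq⟩
    · intro i
      exact (totalDegree_rename_le _ _).trans (hL1 _)
    · intro h
      apply hL0
      funext i
      have h3 := congrFun h (σ i)
      have h4 := congrArg (rename σ) h3
      have h5 : σ (σ i) = i := by simp [hσ]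
      simp only [h5, hσσ, Pi.zero_apply, map_zero] at h4
      exact h4
    · have h3 := map_dvd (rename σ) hLd
      rw [hσσ, map_add, map_mul, map_mul, hfield0, hfield1, add_comm] at h3
      simpa [hσ] using h3

end PlaneStructure

/-! ### Combinations of field relations that split into lines -/

section ProductsOfLinearForms

open MvPolynomial Finset

set_option linter.unusedSectionVars false

variable {k : Type*} [Field k] [Fintype k] [DecidableEq k]

theorem X_pow_card_sub_X_eq_prod :
    (Polynomial.X ^ Fintype.card k - Polynomial.X : Polynomial k) =
      ∏ a : k, (Polynomial.X - Polynomial.C a) := by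
  have hmonic : (Polynomial.X ^ Fintype.card k - Polynomial.X : Polynomial k).Monic :=
    Polynomial.monic_X_pow_sub (by
      rw [Polynomial.degree_X]
      exact_mod_cast Fintype.one_lt_card)
  have h := Polynomial.prod_multiset_X_sub_C_of_monic_of_roots_card_eq hmonic (by
    rw [FiniteField.roots_X_pow_card_sub_X,
      FiniteField.X_pow_card_sub_X_natDegree_eq k Fintype.one_lt_card]
    rfl)
  rw [← h, FiniteField.roots_X_pow_card_sub_X]
  rfl

/-- Homogenization of `T ^ q - T = ∏ (T - a)`, evaluated at `x / y` in the fraction field. -/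
theorem prod_sub_algebraMap_mul {A : Type*} [CommRing A] [IsDomain A] [Algebra k A] (x y : A) :
    ∏ a : k, (x - algebraMap k A a * y) = x ^ Fintype.card k - x * y ^ (Fintype.card k - 1) := by
  have hq : 1 < Fintype.card k := Fintype.one_lt_card
  by_cases hy : y = 0
  · simp [hy, zero_pow (by omega : Fintype.card k - 1 ≠ 0)]
  let F := FractionRing A
  apply IsFractionRing.injective A F
  have hy' : algebraMap A F y ≠ 0 := by simpa using hy
  have h1 := X_pow_card_sub_X_eq_prod (k := k)
  have h2 := congrArg (Polynomial.aeval (algebraMap A F x / algebraMap A F y)) h1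
  simp only [map_prod, map_sub, Polynomial.aeval_X, Polynomial.aeval_C, map_pow] at h2
  have h3 : ∀ a : k, algebraMap A F (x - algebraMap k A a * y) =
      algebraMap A F y * (algebraMap A F x / algebraMap A F y - algebraMap k F a) := by
    intro a
    rw [map_sub, map_mul, ← IsScalarTower.algebraMap_apply, mul_sub, mul_div_cancel₀ _ hy', mul_comm _ (algebraMap A F y)]
  rw [map_prod, prod_congr rfl fun a _ => h3 a, prod_mul_distrib, ← h2, prod_const, card_univ,
    map_sub, map_mul, map_pow, map_pow]
  obtain ⟨r, hr⟩ := Nat.exists_eq_add_of_le hq.le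
  rw [hr, Nat.add_sub_cancel_left, mul_sub, ← mul_pow, mul_div_cancel₀ _ hy', pow_add _ 1 r, pow_one,
    pow_add _ 1 r, pow_one, mul_right_comm, mul_div_cancel₀ _ hy']

theorem linear_ne_zero {c : Fin 2 → k} (hc : c ≠ 0) (a : k) :
    (C (c 0) * X 0 + C (c 1) * X 1 - C a : MvPolynomial (Fin 2) k) ≠ 0 := by
  intro h
  apply hc
  have hne : ∀ i : Fin 2, (0 : Fin 2 →₀ ℕ) ≠ Finsupp.single i 1 := fun i h => by
    simpa using DFunLike.congr_fun h i
  have e0 := congrArg (coeff (Finsupp.single 0 1)) h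
  have e1 := congrArg (coeff (Finsupp.single 1 1)) h
  simp [coeff_C_mul, coeff_X, coeff_C, hne, Finsupp.single_left_inj] at e0 e1
  funext i
  fin_cases i
  · exact e0
  · exact e1

theorem totalDegree_C_mul_X_le (c : k) (i : Fin 2) :
    (C c * X i : MvPolynomial (Fin 2) k).totalDegree ≤ 1 :=
  (totalDegree_mul _ _).trans (by simp)

theorem totalDegree_linear_le (c : Fin 2 → k) (a : k) :
    (C (c 0) * X 0 + C (c 1) * X 1 - C a : MvPolynomial (Fin 2) k).totalDegree ≤ 1 := by
  refine (totalDegree_sub _ _).trans (max_le ((totalDegree_add _ _).trans (max_le ?_ ?_)) ?_)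
  · exact totalDegree_C_mul_X_le _ _
  · exact totalDegree_C_mul_X_le _ _
  · simp

theorem add_pow_card {A : Type*} [CommRing A] [Algebra k A] (x y : A) :
    (x + y) ^ Fintype.card k = x ^ Fintype.card k + y ^ Fintype.card k :=
  map_add (FiniteField.frobeniusAlgHom k A) x y

theorem sub_pow_card {A : Type*} [CommRing A] [Algebra k A] (x y : A) :
    (x - y) ^ Fintype.card k = x ^ Fintype.card k - y ^ Fintype.card k :=
  map_sub (FiniteField.frobeniusAlgHom k A) x y

theorem C_pow_card {σ : Type*} (c : k) :
    (C c : MvPolynomial σ k) ^ Fintype.card k = C c := by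
  rw [← C_pow, FiniteField.pow_card]

/-- By additivity of Frobenius the combination is `ℓ ^ q - ℓ` with `ℓ = c₀ x₀ + c₁ x₁`, a product of
parallel lines. -/
theorem allLinear_const_combination {c : Fin 2 → k} (hc : c ≠ 0) :
    AllLinear (C (c 0) * fieldRelation 0 + C (c 1) * fieldRelation 1 : MvPolynomial (Fin 2) k) := by
  have h : (C (c 0) * fieldRelation 0 + C (c 1) * fieldRelation 1 : MvPolynomial (Fin 2) k) =
      ∏ a : k, (C (c 0) * X 0 + C (c 1) * X 1 - C a) := by
    have h1 := prod_sub_algebraMap_mul (k := k) (C (c 0) * X 0 + C (c 1) * X 1 : MvPolynomial (Fin 2) k) 1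
    simp only [mul_one, one_pow, algebraMap_eq] at h1
    rw [h1, add_pow_card, mul_pow, mul_pow, C_pow_card, C_pow_card, fieldRelation, fieldRelation]
    ring
  rw [h]
  exact AllLinear.prod fun a _ =>
    allLinear_of_totalDegree_le_one (linear_ne_zero hc a) (totalDegree_linear_le c a)

/-- A constant relation makes `L` a scalar vector times one affine polynomial `l`, so the
combination is `l` times a product of parallel lines. -/
theorem allLinear_combination_of_relation {L : Fin 2 → MvPolynomial (Fin 2) k}
    (hL1 : ∀ i, (L i).totalDegree ≤ 1) (hL : L ≠ 0) {v : Fin 2 → k} (hv : v ≠ 0)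
    (h : C (v 0) * L 0 + C (v 1) * L 1 = 0) :
    AllLinear (L 0 * fieldRelation 0 + L 1 * fieldRelation 1) := by
  obtain ⟨l, hl1, h0, h1⟩ : ∃ l : MvPolynomial (Fin 2) k, l.totalDegree ≤ 1 ∧
      L 0 = C (v 1) * l ∧ L 1 = C (- v 0) * l := by
    by_cases hv1 : v 1 = 0
    · have hv0 : v 0 ≠ 0 := fun hv0 => hv (by funext i; fin_cases i <;> assumption)
      refine ⟨C (- (v 0)⁻¹) * L 1, (totalDegree_mul _ _).trans (by simpa using hL1 1), ?_, ?_⟩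
      · have : C (v 0) * L 0 = 0 := by simpa [hv1] using h
        rcases mul_eq_zero.mp this with h' | h'
        · exact absurd (by simpa using h') hv0
        · simp [h', hv1]
      · rw [← mul_assoc, ← C_mul]
        simp [hv0]
    · refine ⟨C (v 1)⁻¹ * L 0, (totalDegree_mul _ _).trans (by simpa using hL1 0), ?_, ?_⟩
      · rw [← mul_assoc, ← C_mul, mul_inv_cancel₀ hv1, C_1, one_mul]
      · have h2 : C (v 1) * (L 1 - C (- v 0) * (C (v 1)⁻¹ * L 0)) = 0 := by
          have h3 : C (v 1) * C (v 1)⁻¹ = (1 : MvPolynomial (Fin 2) k) := by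
            rw [← C_mul, mul_inv_cancel₀ hv1, C_1]
          rw [C_neg]
          linear_combination h + C (v 0) * L 0 * h3
        rcases mul_eq_zero.mp h2 with h' | h'
        · exact absurd (by simpa using h') hv1
        · exact sub_eq_zero.mp h'
  have hl0 : l ≠ 0 := by
    rintro rfl
    apply hL
    funext i
    fin_cases i
    · simpa using h0
    · simpa using h1
  have hc : (![v 1, - v 0] : Fin 2 → k) ≠ 0 := by
    intro hc
    apply hv
    have e0 := congrFun hc 0
    have e1 := congrFun hc 1
    funext i
    fin_cases i
    · simpa using e1
    · simpa using e0
  have := (allLinear_of_totalDegree_le_one hl0 hl1).mul (allLinear_const_combination hc)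
  simp only [Matrix.cons_val_zero, Matrix.cons_val_one] at this
  rw [h0, h1]
  convert this using 1
  ring

/-- After a translation the combination is `μ (y x ^ q - x y ^ q)`, the product of all rational
lines through one point. -/
theorem allLinear_combination_of_alternating {b₀ b₁ μ : k} (hμ : μ ≠ 0) :
    AllLinear ((C b₀ + C μ * X 1) * fieldRelation 0 + (C b₁ - C μ * X 0) * fieldRelation 1 :
      MvPolynomial (Fin 2) k) := by
  set x : MvPolynomial (Fin 2) k := X 0 - C (b₁ / μ) with hx
  set y : MvPolynomial (Fin 2) k := X 1 + C (b₀ / μ) with hy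
  have e0 : (C b₀ + C μ * X 1 : MvPolynomial (Fin 2) k) = C μ * y := by
    rw [hy, mul_add, ← C_mul, mul_div_cancel₀ _ hμ]
    ring
  have e1 : (C b₁ - C μ * X 0 : MvPolynomial (Fin 2) k) = - (C μ * x) := by
    rw [hx, mul_sub, ← C_mul, mul_div_cancel₀ _ hμ]
    ring
  have f0 : (fieldRelation 0 : MvPolynomial (Fin 2) k) = x ^ Fintype.card k - x := by
    rw [hx, sub_pow_card, C_pow_card, fieldRelation]
    ring
  have f1 : (fieldRelation 1 : MvPolynomial (Fin 2) k) = y ^ Fintype.card k - y := by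
    rw [hy, add_pow_card, C_pow_card, fieldRelation]
    ring
  have hprod : (C b₀ + C μ * X 1) * fieldRelation 0 + (C b₁ - C μ * X 0) * fieldRelation 1 =
      C μ * (y * ∏ a : k, (x - algebraMap k (MvPolynomial (Fin 2) k) a * y)) := by
    rw [prod_sub_algebraMap_mul, e0, e1, f0, f1]
    obtain ⟨r, hr⟩ := Nat.exists_eq_add_of_le (Fintype.one_lt_card (α := k)).le
    rw [hr, Nat.add_sub_cancel_left]
    ring
  rw [hprod]
  refine (allLinear_of_totalDegree_le_one (by simpa using hμ) (by simp)).mul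
    (AllLinear.mul ?_ (AllLinear.prod fun a _ => ?_))
  · have := linear_ne_zero (c := ![0, 1]) (fun h => by simpa using congrFun h (1 : Fin 2)) (-(b₀ / μ))
    have h2 := totalDegree_linear_le (k := k) ![0, 1] (-(b₀ / μ))
    simp only [Matrix.cons_val_zero, Matrix.cons_val_one, C_0, zero_mul, zero_add, C_1, one_mul,
      C_neg, sub_neg_eq_add] at this h2
    exact allLinear_of_totalDegree_le_one this h2
  · have := linear_ne_zero (c := ![1, -a]) (fun h => by simpa using congrFun h (0 : Fin 2))
      (b₁ / μ + a * (b₀ / μ))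
    have h2 := totalDegree_linear_le (k := k) ![1, -a] (b₁ / μ + a * (b₀ / μ))
    have h3 : C ((![1, -a] : Fin 2 → k) 0) * X 0 + C ((![1, -a] : Fin 2 → k) 1) * X 1 -
        C (b₁ / μ + a * (b₀ / μ)) = x - algebraMap k (MvPolynomial (Fin 2) k) a * y := by
      simp only [Matrix.cons_val_zero, Matrix.cons_val_one, algebraMap_eq, hx, hy, C_add, C_mul,
        C_neg, C_1]
      ring
    rw [h3] at this h2
    exact allLinear_of_totalDegree_le_one this h2

theorem lineRestrict_fieldRelation (P v : Fin 2 → k) (i : Fin 2) :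
    lineRestrict P v (fieldRelation i) =
      Polynomial.C (v i) * (Polynomial.X ^ Fintype.card k - Polynomial.X) := by
  rw [fieldRelation, map_sub, map_pow, lineRestrict, aeval_X, add_pow_card, mul_pow,
    ← Polynomial.C_pow, ← Polynomial.C_pow, FiniteField.pow_card, FiniteField.pow_card]
  ring

theorem lineRestrict_of_totalDegree_le_one {l : MvPolynomial (Fin 2) k} (hl : l.totalDegree ≤ 1)
    (P v : Fin 2 → k) :
    lineRestrict P v l = Polynomial.C (eval P l) + Polynomial.C (coeff (Finsupp.single 0 1) l * v 0 +
      coeff (Finsupp.single 1 1) l * v 1) * Polynomial.X := by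
  have h := eq_linear_of_totalDegree_le_one hl
  rw [Fin.sum_univ_two] at h
  conv_lhs => rw [h]
  conv_rhs => rw [h]
  simp [lineRestrict, coeff_C_mul, coeff_X, coeff_C, Finsupp.single_left_inj, Ne.symm]
  ring

end ProductsOfLinearForms

/-! ### The second moment of the number of zeros on a line -/

section SecondMoment

open MvPolynomial Finset

set_option linter.unusedSectionVars false

variable {k : Type*} [Field k] [Fintype k] [DecidableEq k] {n : ℕ}

/-- Two distinct points on a line determine a base point and a direction vector. -/
def pairEquiv (s t : k) (h : s ≠ t) :
    (Fin n → k) × (Fin n → k) ≃ (Fin n → k) × (Fin n → k) where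
  toFun x := (x.2 + s • x.1, x.2 + t • x.1)
  invFun y := ((s - t)⁻¹ • (y.1 - y.2), y.1 - s • (s - t)⁻¹ • (y.1 - y.2))
  left_inv x := by
    have h0 : s - t ≠ 0 := sub_ne_zero.mpr h
    have h1 : (s - t)⁻¹ • (x.2 + s • x.1 - (x.2 + t • x.1)) = x.1 := by
      rw [add_sub_add_left_eq_sub, ← sub_smul, smul_smul, inv_mul_cancel₀ h0, one_smul]
    simp only [h1, add_sub_cancel_right]
  right_inv y := by
    have h0 : s - t ≠ 0 := sub_ne_zero.mpr h
    have h1 : (s - t) • (s - t)⁻¹ • (y.1 - y.2) = y.1 - y.2 := by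
      rw [smul_smul, mul_inv_cancel₀ h0, one_smul]
    rw [sub_smul] at h1
    ext1
    · simp
    · change y.1 - _ + t • _ = y.2
      rw [sub_add, h1, sub_sub_cancel]

/-- The square counts pairs of parameters `(s, t)`. For `s ≠ t` the points `P + s v` and `P + t v`
range over all pairs exactly once; for `s = t` the direction `v` is free. -/
theorem sum_sq_lineZeroCount (f : MvPolynomial (Fin n) k) :
    ∑ v, ∑ P, lineZeroCount f P v ^ 2 =
      Fintype.card k * Fintype.card k ^ n * #(zeros f) +
        Fintype.card k * (Fintype.card k - 1) * #(zeros f) ^ 2 := by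
  set q := Fintype.card k with hq
  set χ : (Fin n → k) → ℕ := fun P => if eval P f = 0 then 1 else 0 with hχ
  have hN : ∑ P, χ P = #(zeros f) := by rw [zeros, card_filter]
  have h1 : ∀ v P, lineZeroCount f P v ^ 2 = ∑ s : k, ∑ t : k, χ (P + s • v) * χ (P + t • v) := by
    intro v P
    rw [sq, lineZeroCount, card_filter, sum_mul_sum]
  have hdiag : ∀ s : k, ∑ x : (Fin n → k) × (Fin n → k), χ (x.2 + s • x.1) * χ (x.2 + s • x.1) =
      q ^ n * #(zeros f) := by
    intro s
    rw [Fintype.sum_prod_type]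
    have : ∀ v : Fin n → k, ∑ P, χ (P + s • v) * χ (P + s • v) = #(zeros f) := by
      intro v
      rw [← hN]
      refine (Fintype.sum_equiv (Equiv.addRight (s • v)) _ (fun P => χ P * χ P)
        fun P => rfl).trans (sum_congr rfl fun P _ => ?_)
      simp only [hχ]
      split_ifs <;> rfl
    simp [this, hq]
  have hoff : ∀ s t : k, s ≠ t →
      ∑ x : (Fin n → k) × (Fin n → k), χ (x.2 + s • x.1) * χ (x.2 + t • x.1) =
      #(zeros f) ^ 2 := by
    intro s t hst
    rw [sq, ← hN, sum_mul_sum, ← Fintype.sum_prod_type']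
    exact Fintype.sum_equiv (pairEquiv s t hst) _ _ fun x => rfl
  have hst : ∀ s t : k, ∑ x : (Fin n → k) × (Fin n → k), χ (x.2 + s • x.1) * χ (x.2 + t • x.1) =
      if s = t then q ^ n * #(zeros f) else #(zeros f) ^ 2 := by
    intro s t
    split_ifs with h
    · rw [← h]
      exact hdiag s
    · exact hoff s t h
  have hinner : ∀ s : k, ∑ t : k, (if s = t then q ^ n * #(zeros f) else #(zeros f) ^ 2) =
      q ^ n * #(zeros f) + (q - 1) * #(zeros f) ^ 2 := by
    intro s
    rw [← add_sum_erase _ _ (mem_univ s), if_pos rfl]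
    congr 1
    rw [sum_congr rfl fun t ht => if_neg (ne_of_mem_erase ht).symm, sum_const, smul_eq_mul,
      card_erase_of_mem (mem_univ s), card_univ]
  calc ∑ v, ∑ P, lineZeroCount f P v ^ 2
      = ∑ x : (Fin n → k) × (Fin n → k), ∑ s : k, ∑ t : k, χ (x.2 + s • x.1) * χ (x.2 + t • x.1) := by
        rw [Fintype.sum_prod_type]
        exact sum_congr rfl fun v _ => sum_congr rfl fun P _ => h1 v P
    _ = ∑ s : k, ∑ t : k, ∑ x : (Fin n → k) × (Fin n → k), χ (x.2 + s • x.1) * χ (x.2 + t • x.1) := by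
        rw [sum_comm]
        exact sum_congr rfl fun s _ => sum_comm
    _ = _ := by
        simp only [hst, hinner, sum_const, card_univ, smul_eq_mul, ← hq]
        ring

theorem sum_sq_lineZeroCount_zero (f : MvPolynomial (Fin n) k) :
    ∑ P, lineZeroCount f P 0 ^ 2 = Fintype.card k ^ 2 * #(zeros f) := by
  have : ∀ P, lineZeroCount f P 0 ^ 2 = if eval P f = 0 then Fintype.card k ^ 2 else 0 := by
    intro P
    simp only [lineZeroCount, smul_zero, add_zero]
    split_ifs with h <;> simp [h]
  rw [sum_congr rfl fun P _ => this P, ← sum_filter, sum_const, smul_eq_mul, mul_comm]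
  rfl

/-- A nonzero binary quadratic form has at most two isotropic lines, each with `q - 1` nonzero
vectors. -/
theorem card_isotropic_le {a b c : k} (h : ¬ (a = 0 ∧ b = 0 ∧ c = 0)) :
    #{v : Fin 2 → k | v ≠ 0 ∧ a * v 0 ^ 2 + b * (v 0 * v 1) + c * v 1 ^ 2 = 0} ≤
      2 * (Fintype.card k - 1) := by
  set I : Finset (Fin 2 → k) :=
    {v : Fin 2 → k | v ≠ 0 ∧ a * v 0 ^ 2 + b * (v 0 * v 1) + c * v 1 ^ 2 = 0} with hI
  have hinj : ∀ t : k, Set.InjOn (fun v : Fin 2 → k => v 0) {v | v 1 = t} := by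
    intro t v hv w hw hvw
    funext i
    fin_cases i
    · exact hvw
    · exact hv.trans hw.symm
  have hfib : ∀ t : k, ∀ p : Polynomial k, p ≠ 0 → (∀ v ∈ I, v 1 = t → p.eval (v 0) = 0) →
      #{v ∈ I | v 1 = t} ≤ p.natDegree := by
    intro t p hp hv
    calc #{v ∈ I | v 1 = t} = #(({v ∈ I | v 1 = t}).image fun v => v 0) :=
          (card_image_of_injOn ((hinj t).mono fun v hv => by
            simpa using (mem_filter.mp hv).2)).symm
      _ ≤ #p.roots.toFinset := card_le_card fun x hx => by
          obtain ⟨v, hv', rfl⟩ := mem_image.mp hx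
          rw [mem_filter] at hv'
          rw [Multiset.mem_toFinset, Polynomial.mem_roots hp]
          exact hv v hv'.1 hv'.2
      _ ≤ p.natDegree := (Multiset.toFinset_card_le _).trans (Polynomial.card_roots' _)
  have herase : #((univ : Finset k).erase 0) = Fintype.card k - 1 := by
    rw [card_erase_of_mem (mem_univ _), card_univ]
  have hquad : ∀ t : k, ∀ v ∈ I, v 1 = t → (Polynomial.C a * Polynomial.X ^ 2 +
      Polynomial.C (b * t) * Polynomial.X + Polynomial.C (c * t ^ 2)).eval (v 0) = 0 := by
    intro t v hv hvt
    have h1 := (mem_filter.mp hv).2.2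
    simp only [Polynomial.eval_add, Polynomial.eval_mul, Polynomial.eval_C, Polynomial.eval_pow,
      Polynomial.eval_X]
    rw [← hvt, ← h1]
    ring
  by_cases ha : a = 0
  · have h0 : #{v ∈ I | v 1 = 0} ≤ Fintype.card k - 1 := by
      rw [← herase, ← card_image_of_injOn ((hinj 0).mono fun v hv => by
            simpa using (mem_filter.mp hv).2)]
      refine card_le_card fun x hx => ?_
      obtain ⟨v, hv, rfl⟩ := mem_image.mp hx
      rw [mem_filter] at hv
      refine mem_erase.mpr ⟨fun h0 => (mem_filter.mp hv.1).2.1 ?_, mem_univ _⟩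
      funext i
      fin_cases i
      · exact h0
      · exact hv.2
    have h1 : #{v ∈ I | v 1 ≠ 0} ≤ 1 * #((univ : Finset k).erase 0) := by
      refine card_le_mul_card_image_of_maps_to (f := fun v : Fin 2 → k => v 1)
        (fun v hv => mem_erase.mpr ⟨(mem_filter.mp hv).2, mem_univ _⟩) 1 fun t ht => ?_
      have ht0 := ne_of_mem_erase ht
      refine (card_le_card (filter_subset_filter _ (filter_subset _ I))).trans
        ((hfib t _ ?_ (hquad t)).trans ?_)
      · intro hp
        apply h
        have e0 := congrArg (Polynomial.eval 0) hp
        have e1 := congrArg (Polynomial.eval 1) hp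
        simp [ha, ht0] at e0
        simp [ha, ht0, e0] at e1
        exact ⟨ha, e1, e0⟩
      · rw [ha, map_zero, zero_mul, zero_add]
        exact Polynomial.natDegree_linear_le
    have h2 := card_filter_add_card_filter_not (s := I) (fun v => v 1 = 0)
    rw [herase] at h1
    simp only [ne_eq] at h1
    omega
  · have h1 : #I ≤ 2 * #((univ : Finset k).erase 0) := by
      refine card_le_mul_card_image_of_maps_to (f := fun v : Fin 2 → k => v 1) (fun v hv => ?_) 2 fun t _ => ?_
      · refine mem_erase.mpr ⟨fun h1 => ?_, mem_univ _⟩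
        have hv2 := (mem_filter.mp hv).2
        simp only [h1, mul_zero, add_zero, ne_eq, OfNat.ofNat_ne_zero, not_false_eq_true, zero_pow,
          mul_eq_zero, ha, pow_eq_zero_iff, false_or] at hv2
        refine hv2.1 ?_
        funext i
        fin_cases i
        · exact hv2.2
        · exact h1
      · refine (hfib t _ ?_ (hquad t)).trans Polynomial.natDegree_quadratic_le
        intro hp
        have e2 := Polynomial.leadingCoeff_quadratic (b := b * t) (c := c * t ^ 2) ha
        rw [hp, Polynomial.leadingCoeff_zero] at e2
        exact ha e2.symm
    rw [herase] at h1
    exact h1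

end SecondMoment

/-! ### The planar theorem -/

section PlaneCase

open MvPolynomial Finset

set_option linter.unusedSectionVars false

variable {k : Type*} [Field k] [Fintype k] [DecidableEq k]

/-- The polynomial `T ^ q - T` splits with simple roots, so the extra linear factor can cost `g` at
most one distinct root. -/
theorem natDegree_le_card_roots_add_one {g : Polynomial k} {a b : k} (h : ¬ (a = 0 ∧ b = 0))
    (hg : g ∣ (Polynomial.X ^ Fintype.card k - Polynomial.X) *
      (Polynomial.C a + Polynomial.C b * Polynomial.X)) :
    g.natDegree ≤ #g.roots.toFinset + 1 := by
  have hl : Polynomial.C a + Polynomial.C b * Polynomial.X ≠ 0 := by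
    intro h0
    apply h
    have e0 := congrArg (fun p => Polynomial.coeff p 0) h0
    have e1 := congrArg (fun p => Polynomial.coeff p 1) h0
    simp only [Polynomial.coeff_add, Polynomial.coeff_C_zero, Polynomial.coeff_C_mul,
      Polynomial.coeff_X_zero, Polynomial.coeff_X_one, Polynomial.coeff_zero,
      Polynomial.coeff_C_succ, mul_zero, add_zero, zero_add, mul_one] at e0 e1
    exact ⟨e0, e1⟩
  have hX : (Polynomial.X ^ Fintype.card k - Polynomial.X : Polynomial k) ≠ 0 :=
    FiniteField.X_pow_card_sub_X_ne_zero k Fintype.one_lt_card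
  have hdeg : (Polynomial.C a + Polynomial.C b * Polynomial.X).natDegree ≤ 1 := by
    rw [add_comm]
    exact Polynomial.natDegree_linear_le
  have hs : g.Splits := by
    refine Polynomial.Splits.of_dvd (Polynomial.Splits.mul ?_ ?_) (mul_ne_zero hX hl) hg
    · rw [X_pow_card_sub_X_eq_prod]
      exact Polynomial.Splits.prod fun a _ => Polynomial.Splits.X_sub_C a
    · exact Polynomial.Splits.of_natDegree_le_one hdeg
  have hr : g.roots ≤ (univ : Finset k).val +
      (Polynomial.C a + Polynomial.C b * Polynomial.X).roots := by
    have := Polynomial.roots.le_of_dvd (mul_ne_zero hX hl) hg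
    rwa [Polynomial.roots_mul (mul_ne_zero hX hl), FiniteField.roots_X_pow_card_sub_X] at this
  set s := (Polynomial.C a + Polynomial.C b * Polynomial.X).roots with hsdef
  have hs1 : s.card ≤ 1 := (Polynomial.card_roots' _).trans hdeg
  have h1 : g.roots - s ≤ (univ : Finset k).val := by
    rw [tsub_le_iff_right]
    exact hr
  have h2 : (g.roots - s).toFinset.card = (g.roots - s).card :=
    Multiset.toFinset_card_of_nodup (Multiset.nodup_of_le h1 univ.nodup)
  have h3 : #(g.roots - s).toFinset ≤ #g.roots.toFinset :=
    card_le_card (Multiset.toFinset_subset.mpr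
      (Multiset.subset_of_le (Multiset.sub_le_self _ _)))
  have h4 : g.roots.card ≤ (g.roots - s).card + s.card := by
    rw [← Multiset.card_add]
    exact Multiset.card_le_card (tsub_le_iff_right.mp le_rfl)
  have h5 := hs.natDegree_eq_card_roots
  omega

/-- The derivative of a vector field `L` in a constant direction `v`, paired with `v`. -/
noncomputable def slopeForm (L : Fin 2 → MvPolynomial (Fin 2) k) (v : Fin 2 → k) : k :=
  coeff (Finsupp.single 0 1) (L 0) * v 0 ^ 2 +
    (coeff (Finsupp.single 1 1) (L 0) + coeff (Finsupp.single 0 1) (L 1)) * (v 0 * v 1) +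
    coeff (Finsupp.single 1 1) (L 1) * v 1 ^ 2

theorem lineRestrict_combination {L : Fin 2 → MvPolynomial (Fin 2) k}
    (hL : ∀ i, (L i).totalDegree ≤ 1) (P v : Fin 2 → k) :
    lineRestrict P v (L 0 * fieldRelation 0 + L 1 * fieldRelation 1) =
      (Polynomial.X ^ Fintype.card k - Polynomial.X) *
        (Polynomial.C (eval P (C (v 0) * L 0 + C (v 1) * L 1)) +
          Polynomial.C (slopeForm L v) * Polynomial.X) := by
  rw [map_add, map_mul, map_mul, lineRestrict_fieldRelation, lineRestrict_fieldRelation,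
    lineRestrict_of_totalDegree_le_one (hL 0), lineRestrict_of_totalDegree_le_one (hL 1),
    slopeForm]
  simp only [map_add, map_mul, eval_C, map_pow]
  ring

variable {f : MvPolynomial (Fin 2) k} {L : Fin 2 → MvPolynomial (Fin 2) k}

theorem lineRestrict_ne_zero_of_dvd_combination (hL : ∀ i, (L i).totalDegree ≤ 1)
    (hf : f ∣ L 0 * fieldRelation 0 + L 1 * fieldRelation 1) {P v : Fin 2 → k}
    (h : ¬ (eval P (C (v 0) * L 0 + C (v 1) * L 1) = 0 ∧ slopeForm L v = 0)) :
    lineRestrict P v f ≠ 0 ∧ (lineRestrict P v f).natDegree ≤ lineZeroCount f P v + 1 := by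
  have hd := map_dvd (lineRestrict P v) hf
  rw [lineRestrict_combination hL] at hd
  have h0 : lineRestrict P v f ≠ 0 := by
    intro h0
    rw [h0, zero_dvd_iff] at hd
    rcases mul_eq_zero.mp hd with hd | hd
    · exact FiniteField.X_pow_card_sub_X_ne_zero k Fintype.one_lt_card hd
    · apply h
      have e0 := congrArg (fun p => Polynomial.coeff p 0) hd
      have e1 := congrArg (fun p => Polynomial.coeff p 1) hd
      simp only [Polynomial.coeff_add, Polynomial.coeff_C_zero, Polynomial.coeff_C_mul,
        Polynomial.coeff_X_zero, Polynomial.coeff_X_one, Polynomial.coeff_zero,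
        Polynomial.coeff_C_succ, mul_zero, add_zero, zero_add, mul_one] at e0 e1
      exact ⟨e0, e1⟩
  refine ⟨h0, ?_⟩
  rw [lineZeroCount_eq_card_roots h0]
  exact natDegree_le_card_roots_add_one h hd

/-- If every line in direction `v` carries a nonzero restriction of `f`, a point count above
`(e - 1) q` forces `f` to have full degree in direction `v`. -/
theorem dirDegree_eq_of_lineRestrict_ne_zero {v : Fin 2 → k}
    (hN : (f.totalDegree - 1) * Fintype.card k < #(zeros f))
    (h : ∀ P, lineRestrict P v f ≠ 0) : dirDegree v f = f.totalDegree := by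
  by_contra hne
  have hlt := lt_of_le_of_ne (dirDegree_le_totalDegree v f) hne
  have h1 : ∑ P, lineZeroCount f P v ≤ ∑ _P : Fin 2 → k, (f.totalDegree - 1) :=
    sum_le_sum fun P _ => (lineZeroCount_le_dirDegree (h P)).trans (by omega)
  rw [sum_lineZeroCount, sum_const, card_univ, Fintype.card_fun, Fintype.card_fin, smul_eq_mul,
    sq, mul_assoc] at h1
  have := Nat.le_of_mul_le_mul_left h1 Fintype.card_pos
  rw [mul_comm] at this
  omega

theorem sum_sq_lineZeroCount_le_of_dirDegree_eq {v : Fin 2 → k} (hf : f ≠ 0)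
    (h : dirDegree v f = f.totalDegree) (hpos : 0 < f.totalDegree) :
    ∑ P, lineZeroCount f P v ^ 2 ≤ f.totalDegree * (Fintype.card k * #(zeros f)) := by
  rw [← sum_lineZeroCount f v, mul_sum]
  refine sum_le_sum fun P _ => ?_
  rw [sq]
  refine Nat.mul_le_mul_right _ ?_
  rw [← h]
  refine lineZeroCount_le_dirDegree fun h0 => ?_
  have := natDegree_lineRestrict_of_dirDegree_eq P v hf h
  rw [h0, Polynomial.natDegree_zero] at this
  omega

/-- Every line in direction `v` carries `E` or `E + 1` zeros. On these two values the square is an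
affine function, so the second moment is determined by the first. -/
theorem sum_sq_lineZeroCount_of_slopeForm_ne_zero (hL : ∀ i, (L i).totalDegree ≤ 1)
    (hf : f ∣ L 0 * fieldRelation 0 + L 1 * fieldRelation 1) {v : Fin 2 → k}
    (hv : slopeForm L v ≠ 0) (hpos : 0 < f.totalDegree)
    (hN : (f.totalDegree - 1) * Fintype.card k < #(zeros f)) {E : ℤ}
    (hE : E + 1 = f.totalDegree) :
    (∑ P, lineZeroCount f P v ^ 2 : ℤ) =
      (2 * E + 1) * (Fintype.card k * #(zeros f)) - Fintype.card k ^ 2 * (E * (E + 1)) := by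
  have hf0 : f ≠ 0 := by
    rintro rfl
    simp at hpos
  have hP : ∀ P, _ := fun P => lineRestrict_ne_zero_of_dvd_combination (P := P) hL hf (v := v)
    fun h => hv h.2
  have hd := dirDegree_eq_of_lineRestrict_ne_zero hN fun P => (hP P).1
  have hn : ∀ P, (lineZeroCount f P v : ℤ) ^ 2 =
      (2 * E + 1) * lineZeroCount f P v - E * (E + 1) := by
    intro P
    have h1 := (hP P).2
    have h2 := lineZeroCount_le_dirDegree (hP P).1
    rw [natDegree_lineRestrict_of_dirDegree_eq P v hf0 hd] at h1
    rw [hd] at h2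
    have h3 : (lineZeroCount f P v : ℤ) = E ∨ (lineZeroCount f P v : ℤ) = E + 1 := by omega
    rcases h3 with h3 | h3 <;> rw [h3] <;> ring
  have hsum : (∑ P, (lineZeroCount f P v : ℤ)) = Fintype.card k * #(zeros f) := by
    exact_mod_cast sum_lineZeroCount f v
  rw [sum_congr rfl fun P _ => hn P, sum_sub_distrib, ← mul_sum, hsum, sum_const, card_univ,
    Fintype.card_fun, Fintype.card_fin, nsmul_eq_mul]
  push_cast
  ring

/-- The restriction of `f` can vanish only when the base point is a zero of the affine polynomial `v
· L`, which has at most `q` zeros. On all other lines the degree drop leaves at most `E` zeros. -/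
theorem sum_sq_lineZeroCount_le_of_combination (hL : ∀ i, (L i).totalDegree ≤ 1)
    (hf : f ∣ L 0 * fieldRelation 0 + L 1 * fieldRelation 1) {v : Fin 2 → k}
    (hα : C (v 0) * L 0 + C (v 1) * L 1 ≠ 0) (hlt : dirDegree v f < f.totalDegree)
    (hq : f.totalDegree < Fintype.card k) {E : ℤ} (hE : E + 1 = f.totalDegree) :
    (∑ P, lineZeroCount f P v ^ 2 : ℤ) ≤
      E * (Fintype.card k * #(zeros f)) +
        Fintype.card k * (Fintype.card k * (Fintype.card k - E)) := by
  set q := Fintype.card k with hqdef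
  set α := C (v 0) * L 0 + C (v 1) * L 1 with hαdef
  have hα1 : α.totalDegree ≤ 1 := by
    refine (totalDegree_add _ _).trans (max_le ?_ ?_) <;>
      exact (totalDegree_mul _ _).trans (by simpa using hL _)
  have hZ : #(zeros α) ≤ q := by
    refine (card_zeros_le hα).trans ?_
    rw [pow_one]
    exact (Nat.mul_le_mul_right _ hα1).trans (one_mul q).le
  have hn : ∀ P, (lineZeroCount f P v : ℤ) ^ 2 ≤
      E * lineZeroCount f P v + if P ∈ zeros α then (q : ℤ) * (q - E) else 0 := by
    intro P
    split_ifs with hP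
    · have h1 : (lineZeroCount f P v : ℤ) ≤ q := by exact_mod_cast lineZeroCount_le_card f P v
      nlinarith [Int.natCast_nonneg (lineZeroCount f P v)]
    · have h1 := (lineRestrict_ne_zero_of_dvd_combination (P := P) hL hf (v := v)
        fun h => hP (mem_zeros.mpr h.1)).1
      have h2 : (lineZeroCount f P v : ℤ) ≤ E := by
        have := lineZeroCount_le_dirDegree h1
        omega
      nlinarith [Int.natCast_nonneg (lineZeroCount f P v)]
  have hsum : (∑ P, (lineZeroCount f P v : ℤ)) = q * #(zeros f) := by
    exact_mod_cast sum_lineZeroCount f v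
  refine (sum_le_sum fun P _ => hn P).trans ?_
  rw [sum_add_distrib, ← mul_sum, hsum, sum_ite_mem, univ_inter, sum_const, nsmul_eq_mul]
  have hZ' : (#(zeros α) : ℤ) ≤ q := by exact_mod_cast hZ
  have : (0 : ℤ) ≤ q * (q - E) := mul_nonneg (by positivity) (by omega)
  nlinarith

/-- A planar quadric containing a rational line is a product of linear factors. -/
theorem allLinear_of_lineRestrict_eq_zero (he : f.totalDegree = 2)
    (hq : f.totalDegree < Fintype.card k) {P v : Fin 2 → k} (hv : v ≠ 0)
    (h : lineRestrict P v f = 0) : AllLinear f := by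
  have hf0 : f ≠ 0 := by
    rintro rfl
    simp at he
  set c : Fin 2 → k := ![v 1, - v 0] with hc
  have hc0 : c ≠ 0 := by
    intro h0
    apply hv
    have e0 := congrFun h0 0
    have e1 := congrFun h0 1
    funext i
    fin_cases i <;> simp_all
  set p : MvPolynomial (Fin 2) k :=
    C (c 0) * X 0 + C (c 1) * X 1 - C (c 0 * P 0 + c 1 * P 1) with hp
  have hp0 : p ≠ 0 := linear_ne_zero hc0 _
  have hpe : ∀ R, eval R p = v 1 * (R 0 - P 0) - v 0 * (R 1 - P 1) := by
    intro R
    simp [hp, hc]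
    ring
  have hline : ∀ R, eval R p = 0 → eval R f = 0 := by
    intro R hR
    rw [hpe] at hR
    obtain ⟨t, ht⟩ : ∃ t : k, P + t • v = R := by
      by_cases h1 : v 1 = 0
      · have h0 : v 0 ≠ 0 := fun h0 => hv (by funext i; fin_cases i <;> assumption)
        refine ⟨(R 0 - P 0) / v 0, ?_⟩
        have hR1 : R 1 - P 1 = 0 := by
          rw [h1, zero_mul, zero_sub, neg_eq_zero] at hR
          exact (mul_eq_zero.mp hR).resolve_left h0
        funext i
        fin_cases i
        · simp [div_mul_cancel₀ _ h0]
        · simp [h1, (sub_eq_zero.mp hR1)]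
      · refine ⟨(R 1 - P 1) / v 1, ?_⟩
        funext i
        fin_cases i
        · simp only [Fin.zero_eta, Pi.add_apply, Pi.smul_apply, smul_eq_mul]
          field_simp
          linear_combination -hR
        · simp [div_mul_cancel₀ _ h1]
    rw [← ht, ← eval_lineRestrict, h, Polynomial.eval_zero]
  have hp1 : p.totalDegree = 1 := by
    refine le_antisymm (totalDegree_linear_le _ _) (Nat.one_le_iff_ne_zero.mpr fun h0 => ?_)
    obtain ⟨a, ha⟩ : ∃ a, p = C a := ⟨_, totalDegree_eq_zero_iff_eq_C.mp h0⟩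
    have e0 := congrArg (coeff (Finsupp.single 0 1)) ha
    have e1 := congrArg (coeff (Finsupp.single 1 1)) ha
    have hne : ∀ i : Fin 2, (0 : Fin 2 →₀ ℕ) ≠ Finsupp.single i 1 := fun i h => by
      simpa using DFunLike.congr_fun h i
    simp only [hp, coeff_sub, coeff_add, coeff_C_mul, coeff_X, coeff_C, hne, if_false,
      Finsupp.single_left_inj one_ne_zero] at e0 e1
    refine hc0 (funext fun i => ?_)
    fin_cases i
    · simpa using e0
    · simpa using e1
  obtain ⟨χ, hχ⟩ := dvd_of_zeros_subset hp1 hq hline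
  have hχ0 : χ ≠ 0 := by
    rintro rfl
    exact hf0 (by rw [hχ, mul_zero])
  have hdeg := totalDegree_mul_of_isDomain hp0 hχ0
  rw [← hχ, he, hp1] at hdeg
  rw [hχ]
  exact (allLinear_of_totalDegree_le_one hp0 hp1.le).mul
    (allLinear_of_totalDegree_le_one hχ0 (by omega))

/-- The exact second moment exceeds the value for generic directions by `q (q - 1)(q - E)((E + 1) q
- 3 E - 1)`. At most `2 (q - 1)` exceptional directions, each with excess at most `q M`, cannot
account for this. -/
theorem moment_contradiction {q E N A M : ℤ} {S : ℤ} (hE : 1 ≤ E) (hEq : E + 2 ≤ q)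
    (hN : N = (E + 1) * q - E)
    (hS : S = q * q ^ 2 * N + q * (q - 1) * N ^ 2 - q ^ 2 * N)
    (hM : 2 * M < (q - E) * ((E + 1) * q - 3 * E - 1)) (hM0 : 0 ≤ M)
    (hA : A ≤ 2 * (q - 1))
    (hSle : S ≤ (q ^ 2 - 1) * (q * ((2 * E + 1) * N - q * (E * (E + 1)))) + A * (q * M)) :
    False := by
  have h1 : A * (q * M) ≤ 2 * (q - 1) * (q * M) :=
    mul_le_mul_of_nonneg_right hA (mul_nonneg (by omega) hM0)
  have h2 : 0 < q * (q - 1) * ((q - E) * ((E + 1) * q - 3 * E - 1) - 2 * M) :=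
    mul_pos (mul_pos (by omega) (by omega)) (by omega)
  subst hN
  subst hS
  nlinarith

/-- The exceptional planar case: a polynomial dividing a combination of the field relations with
affine coefficients and having the critical number of zeros splits into linear factors. -/
theorem DividesAffineCombination.allLinear (h2 : 2 ≤ f.totalDegree)
    (hq : f.totalDegree < Fintype.card k) (hd : DividesAffineCombination f)
    (hN : f.totalDegree * Fintype.card k = #(zeros f) + (f.totalDegree - 1)) : AllLinear f := by
  obtain ⟨L, hL1, hL0, hfL⟩ := hd
  by_cases hc1 : ∃ v : Fin 2 → k, v ≠ 0 ∧ C (v 0) * L 0 + C (v 1) * L 1 = 0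
  · obtain ⟨v, hv, hv0⟩ := hc1
    exact (allLinear_combination_of_relation hL1 hL0 hv hv0).of_dvd hfL
  by_cases hc2 : coeff (Finsupp.single 0 1) (L 0) = 0 ∧
      coeff (Finsupp.single 1 1) (L 0) + coeff (Finsupp.single 0 1) (L 1) = 0 ∧
      coeff (Finsupp.single 1 1) (L 1) = 0
  · obtain ⟨h00, h01, h11⟩ := hc2
    have e0 := eq_linear_of_totalDegree_le_one (hL1 0)
    have e1 := eq_linear_of_totalDegree_le_one (hL1 1)
    rw [Fin.sum_univ_two] at e0 e1
    set μ := coeff (Finsupp.single 1 1) (L 0) with hμdef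
    have hμ1 : coeff (Finsupp.single 0 1) (L 1) = -μ := by linear_combination h01
    rw [h00, C_0, zero_mul, zero_add] at e0
    rw [h11, C_0, zero_mul, add_zero, hμ1, C_neg, neg_mul, ← sub_eq_add_neg] at e1
    have hμ : μ ≠ 0 := by
      intro hμ
      rw [hμ, C_0, zero_mul, add_zero] at e0
      rw [hμ, C_0, zero_mul, sub_zero] at e1
      refine hc1 ⟨![coeff 0 (L 1), - coeff 0 (L 0)], fun h0 => hL0 ?_, ?_⟩
      · have a0 := congrFun h0 0
        have a1 := congrFun h0 1
        simp only [Matrix.cons_val_zero, Matrix.cons_val_one, Pi.zero_apply, neg_eq_zero] at a0 a1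
        funext i
        fin_cases i
        · exact e0.trans (by rw [a1, C_0]; rfl)
        · exact e1.trans (by rw [a0, C_0]; rfl)
      · rw [e0, e1]
        simp only [coeff_C, if_true, Matrix.cons_val_zero, Matrix.cons_val_one, C_neg]
        ring
    rw [e0, e1] at hfL
    exact (allLinear_combination_of_alternating hμ).of_dvd hfL
  by_contra hnot
  have hf0 : f ≠ 0 := by
    rintro rfl
    simp at h2
  set q := Fintype.card k with hqdef
  obtain ⟨E, hE⟩ : ∃ E : ℤ, E + 1 = f.totalDegree := ⟨f.totalDegree - 1, by ring⟩
  have hE1 : 1 ≤ E := by omega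
  have hEq : E + 2 ≤ q := by omega
  have hNz : (#(zeros f) : ℤ) = (E + 1) * q - E := by
    have h3 : (f.totalDegree : ℤ) * q = #(zeros f) + (f.totalDegree - 1 : ℕ) := by
      exact_mod_cast hN
    rw [Nat.cast_sub (by omega)] at h3
    rw [← hE] at h3
    push_cast at h3
    linarith
  have hNlt : (f.totalDegree - 1) * q < #(zeros f) := by
    zify [(by omega : 1 ≤ f.totalDegree)]
    rw [hNz, ← hE]
    nlinarith
  set N : ℤ := ((#(zeros f) : ℕ) : ℤ) with hNdef
  set g : ℤ := (2 * E + 1) * N - q * (E * (E + 1)) with hg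
  obtain ⟨M, hM, hM0, hiso⟩ : ∃ M : ℤ, 2 * M < (q - E) * ((E + 1) * q - 3 * E - 1) ∧ 0 ≤ M ∧
      ∀ v : Fin 2 → k, v ≠ 0 → (∑ P, lineZeroCount f P v ^ 2 : ℤ) ≤ q * (g + M) := by
    have hfull : ∀ v : Fin 2 → k, dirDegree v f = f.totalDegree →
        (∑ P, lineZeroCount f P v ^ 2 : ℤ) ≤ q * (g + E ^ 2) := by
      intro v hv
      have h3 := sum_sq_lineZeroCount_le_of_dirDegree_eq hf0 hv (by omega)
      have h4 : (∑ P, lineZeroCount f P v ^ 2 : ℤ) ≤ f.totalDegree * (q * N) := by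
        rw [hNdef]
        exact_mod_cast h3
      refine h4.trans (le_of_eq ?_)
      rw [hg, ← hE, hNz]
      ring
    -- For `E = 1` the general excess `(q - E)(q - E - 1)` would give only equality in `hM`. A conic
    -- that does not split contains no rational line, so it has full degree in every direction and
    -- `M = 1` suffices.
    rcases hE1.eq_or_lt with hE1' | hE2
    · refine ⟨1, ?_, by norm_num, fun v hv => ?_⟩
      · rw [← hE1'] at hEq ⊢
        nlinarith
      · have h3 : dirDegree v f = f.totalDegree :=
          dirDegree_eq_of_lineRestrict_ne_zero hNlt fun P h0 =>
            hnot (allLinear_of_lineRestrict_eq_zero (by omega) hq hv h0)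
        have := hfull v h3
        rwa [← hE1', one_pow] at this
    · refine ⟨max (E ^ 2) ((q - E) * (q - E - 1)), ?_, le_max_of_le_left (sq_nonneg E),
        fun v hv => ?_⟩
      · rcases max_choice (E ^ 2) ((q - E) * (q - E - 1)) with h3 | h3 <;> rw [h3]
        · nlinarith [mul_nonneg (by omega : (0 : ℤ) ≤ q - E - 2) (by omega : (0 : ℤ) ≤ E),
            mul_nonneg (by omega : (0 : ℤ) ≤ q - E - 2) (by omega : (0 : ℤ) ≤ q - E - 2)]
        · have h4 : (0 : ℤ) < (q - E) * ((E - 1) * (q - 1)) :=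
            mul_pos (by omega) (mul_pos (by omega) (by omega))
          linarith
      · rcases (dirDegree_le_totalDegree v f).eq_or_lt with h3 | h3
        · refine (hfull v h3).trans ?_
          have := le_max_left (E ^ 2) ((q - E) * (q - E - 1))
          gcongr
        · have h4 := sum_sq_lineZeroCount_le_of_combination hL1 hfL
            (fun h0 => hc1 ⟨v, hv, h0⟩) h3 hq hE
          refine h4.trans ?_
          have := le_max_right (E ^ 2) ((q - E) * (q - E - 1))
          calc E * (q * N) + q * (q * (q - E)) = q * (g + (q - E) * (q - E - 1)) := by
                rw [hg, hNz]; ring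
            _ ≤ _ := by gcongr
  have hI := card_isotropic_le hc2
  set I : Finset (Fin 2 → k) := {v : Fin 2 → k | v ≠ 0 ∧
    coeff (Finsupp.single 0 1) (L 0) * v 0 ^ 2 +
    (coeff (Finsupp.single 1 1) (L 0) + coeff (Finsupp.single 0 1) (L 1)) * (v 0 * v 1) +
    coeff (Finsupp.single 1 1) (L 1) * v 1 ^ 2 = 0} with hIdef
  have htot := sum_sq_lineZeroCount f
  rw [← add_sum_erase _ _ (mem_univ (0 : Fin 2 → k)), sum_sq_lineZeroCount_zero] at htot
  have hS : (∑ v ∈ univ.erase (0 : Fin 2 → k), ∑ P, lineZeroCount f P v ^ 2 : ℤ) =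
      q * q ^ 2 * N + q * (q - 1) * N ^ 2 - q ^ 2 * N := by
    have h3 : ((q ^ 2 * #(zeros f) + ∑ v ∈ univ.erase (0 : Fin 2 → k),
        ∑ P, lineZeroCount f P v ^ 2 : ℕ) : ℤ) =
        (q * q ^ 2 * #(zeros f) + q * (q - 1) * #(zeros f) ^ 2 : ℕ) := by
      exact_mod_cast htot
    push_cast at h3
    have h4 : ((q - 1 : ℕ) : ℤ) = q - 1 := by omega
    rw [h4] at h3
    rw [hNdef]
    linarith
  have hbound : ∀ v ∈ univ.erase (0 : Fin 2 → k), (∑ P, lineZeroCount f P v ^ 2 : ℤ) ≤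
      q * g + if v ∈ I then (q : ℤ) * M else 0 := by
    intro v hv
    have hv0 := ne_of_mem_erase hv
    split_ifs with hvI
    · rw [← mul_add]
      exact hiso v hv0
    -- Directions that are not isotropic contribute exactly `q * g`.
    · have h3 : slopeForm L v ≠ 0 := fun h0 => hvI (by simpa [hIdef, hv0, slopeForm] using h0)
      rw [sum_sq_lineZeroCount_of_slopeForm_ne_zero hL1 hfL h3 (by omega) hNlt hE, hg]
      exact le_of_eq (by ring)
  have hSle := sum_le_sum hbound
  rw [sum_add_distrib, sum_const, card_erase_of_mem (mem_univ _), card_univ, Fintype.card_fun,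
    Fintype.card_fin, sum_ite_mem, sum_const, nsmul_eq_mul, nsmul_eq_mul,
    Nat.cast_sub (Nat.one_le_pow _ _ Fintype.card_pos)] at hSle
  push_cast at hSle
  rw [← hqdef] at hSle
  refine moment_contradiction hE1 hEq hNz hS hM hM0 ?_ hSle
  have h3 : #(univ.erase (0 : Fin 2 → k) ∩ I) ≤ 2 * (q - 1) :=
    (card_le_card inter_subset_right).trans hI
  have h4 : ((#(univ.erase (0 : Fin 2 → k) ∩ I) : ℕ) : ℤ) ≤ (2 * (q - 1) : ℕ) := by
    exact_mod_cast h3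
  rwa [Nat.cast_mul, Nat.cast_sub (Fintype.card_pos : 1 ≤ Fintype.card k)] at h4

/-- A planar polynomial with at least `e q - (e - 1)` zeros is a product of linear factors. -/
theorem allLinear_of_plane_count (h2 : 2 ≤ f.totalDegree) (hq : f.totalDegree < Fintype.card k)
    (hN : f.totalDegree * Fintype.card k ≤ #(zeros f) + (f.totalDegree - 1)) : AllLinear f := by
  rcases plane_structure h2 hq hN with ⟨c, hc, h⟩ | ⟨h, hN'⟩
  · exact (allLinear_const_combination hc).of_dvd h
  · exact h.allLinear h2 hq hN'

end PlaneCase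

/-! ### Arbitrary dimension: reduction to planes and induction on the degree -/

section Main

open MvPolynomial Finset

set_option linter.unusedSectionVars false

variable {k : Type*} [Field k]

theorem coeff_single_sum_sub {σ : Type*} [Fintype σ] (a : σ → k) (c : k) (j : σ) :
    coeff (Finsupp.single j 1) (∑ i, C (a i) * X i - C c : MvPolynomial σ k) = a j := by
  classical
  have hne : (0 : σ →₀ ℕ) ≠ Finsupp.single j 1 := fun h => by
    simpa using DFunLike.congr_fun h j
  simp [coeff_sum, coeff_C_mul, coeff_X, coeff_C, hne, Finsupp.single_left_inj]

theorem totalDegree_sum_sub {σ : Type*} [Fintype σ] {a : σ → k} (ha : a ≠ 0) (c : k) :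
    (∑ i, C (a i) * X i - C c : MvPolynomial σ k).totalDegree = 1 := by
  refine le_antisymm ?_ (Nat.one_le_iff_ne_zero.mpr fun h0 => ?_)
  · refine (totalDegree_sub _ _).trans (max_le (totalDegree_finsetSum_le fun i _ => ?_) ?_)
    · exact (totalDegree_mul _ _).trans (by simp)
    · simp
  · obtain ⟨b, hb⟩ : ∃ b, (∑ i, C (a i) * X i - C c : MvPolynomial σ k) = C b :=
      ⟨_, totalDegree_eq_zero_iff_eq_C.mp h0⟩
    refine ha (funext fun j => ?_)
    have := congrArg (coeff (Finsupp.single j 1)) hb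
    have hne : (0 : σ →₀ ℕ) ≠ Finsupp.single j 1 := fun h => by
      simpa using DFunLike.congr_fun h j
    rw [coeff_single_sum_sub] at this
    classical
    rw [this, coeff_C, if_neg hne]
    rfl

theorem eval_eq_of_totalDegree_le_one {σ : Type*} [Fintype σ] {p : MvPolynomial σ k}
    (h : p.totalDegree ≤ 1) (x : σ → k) :
    eval x p = coeff 0 p + ∑ i, coeff (Finsupp.single i 1) p * x i := by
  conv_lhs => rw [eq_linear_of_totalDegree_le_one h]
  simp

/-- A squarefree polynomial divides `f` as soon as all its irreducible factors do. -/
theorem dvd_of_squarefree {M : Type*} [CommMonoidWithZero M]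
    [UniqueFactorizationMonoid M] {φ f : M} (hs : Squarefree φ) (h0 : φ ≠ 0)
    (h : ∀ p, Irreducible p → p ∣ φ → p ∣ f) : φ ∣ f := by
  induction φ using WfDvdMonoid.induction_on_irreducible with
  | zero => exact absurd rfl h0
  | unit u hu => exact hu.dvd
  | mul a i ha hi ih =>
    obtain ⟨c, hc⟩ := ih (hs.squarefree_of_dvd (dvd_mul_left a i)) ha
      fun p hp hpa => h p hp (hpa.mul_left i)
    have h1 := h i hi (dvd_mul_right i a)
    rw [hc] at h1
    rcases hi.prime.dvd_or_dvd h1 with h1 | h1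
    · exact absurd (hs i (mul_dvd_mul_left i h1)) hi.not_isUnit
    · rw [hc, mul_comm i a]
      exact mul_dvd_mul_left a h1

variable [Fintype k] [DecidableEq k] {n : ℕ}

/-- The directions along which the polynomial function `f` is constant. -/
def invariantDirections (f : MvPolynomial (Fin n) k) : Submodule k (Fin n → k) where
  carrier := {w | ∀ P (t : k), eval (P + t • w) f = eval P f}
  zero_mem' P t := by rw [smul_zero, add_zero]
  add_mem' {v w} hv hw P t := by rw [smul_add, ← add_assoc, hw, hv]
  smul_mem' c w hw P t := by rw [smul_smul, hw]

theorem mem_invariantDirections {f : MvPolynomial (Fin n) k}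
    (hq : f.totalDegree < Fintype.card k) {w : Fin n → k} :
    w ∈ invariantDirections f ↔ dirDegree w f = 0 :=
  ⟨fun h => dirDegree_eq_zero_of_forall hq h, fun h => eval_add_smul_of_dirDegree_eq_zero h⟩

theorem eval_add_of_mem {f : MvPolynomial (Fin n) k} {w : Fin n → k}
    (h : w ∈ invariantDirections f) (P : Fin n → k) : eval (P + w) f = eval P f := by
  simpa using h P 1

theorem invariantDirections_le_of_dvd {f g : MvPolynomial (Fin n) k} (hf : f ≠ 0)
    (hq : f.totalDegree < Fintype.card k) (h : g ∣ f) :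
    invariantDirections f ≤ invariantDirections g := by
  intro w hw
  obtain ⟨c, rfl⟩ := h
  have hg0 : g ≠ 0 := left_ne_zero_of_mul hf
  have hc0 : c ≠ 0 := right_ne_zero_of_mul hf
  rw [mem_invariantDirections hq, dirDegree_mul w hg0 hc0] at hw
  rw [totalDegree_mul_of_isDomain hg0 hc0] at hq
  rw [mem_invariantDirections (by omega)]
  omega

theorem exists_add_smul_of_sup_span_eq_top {V : Submodule k (Fin n → k)} {u : Fin n → k}
    (h : V ⊔ Submodule.span k {u} = ⊤) (P : Fin n → k) : ∃ v ∈ V, ∃ s : k, P = v + s • u := by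
  have hP : P ∈ V ⊔ Submodule.span k {u} := h ▸ Submodule.mem_top
  obtain ⟨v, hv, y, hy, rfl⟩ := Submodule.mem_sup.mp hP
  obtain ⟨s, rfl⟩ := Submodule.mem_span_singleton.mp hy
  exact ⟨v, hv, s, rfl⟩

/-- A polynomial function depending on a single linear form and having a zero has a linear
factor. -/
theorem exists_linear_dvd {g : MvPolynomial (Fin n) k} (hq : g.totalDegree < Fintype.card k)
    {u Q : Fin n → k} (h : invariantDirections g ⊔ Submodule.span k {u} = ⊤)
    (hu : u ∉ invariantDirections g) (hQ : eval Q g = 0) :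
    ∃ p : MvPolynomial (Fin n) k, p.totalDegree = 1 ∧ p ∣ g := by
  obtain ⟨Λ, hΛu, hΛ⟩ := Submodule.exists_le_ker_of_notMem hu
  have hΛs : ∀ R : Fin n → k, Λ R = ∑ i, Λ (Pi.single i 1) * R i := by
    intro R
    rw [LinearMap.pi_apply_eq_sum_univ Λ R]
    refine sum_congr rfl fun i _ => ?_
    rw [smul_eq_mul, mul_comm]
    congr 2
    funext j
    simp [Pi.single_apply, eq_comm]
  have ha : (fun i => Λ (Pi.single i 1)) ≠ 0 := by
    intro h0
    apply hΛu
    rw [hΛs]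
    exact sum_eq_zero fun i _ => by rw [congrFun h0 i, Pi.zero_apply, zero_mul]
  have hp1 := totalDegree_sum_sub ha (Λ Q)
  -- The linear factor is the hyperplane through `Q` parallel to the invariant directions; `g` is
  -- constant on it with value `eval Q g = 0`.
  refine ⟨_, hp1, dvd_of_zeros_subset hp1 hq fun R hR => ?_⟩
  have hR' : Λ (R - Q) = 0 := by
    simp only [map_sub, map_sum, map_mul, eval_C, eval_X] at hR
    rw [map_sub, hΛs R]
    exact hR
  obtain ⟨v, hv, s, hvs⟩ := exists_add_smul_of_sup_span_eq_top h (R - Q)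
  have hs : s = 0 := by
    rw [hvs, map_add, LinearMap.mem_ker.mp (hΛ hv), zero_add, map_smul, smul_eq_mul] at hR'
    exact (mul_eq_zero.mp hR').resolve_right hΛu
  rw [hs, zero_smul, add_zero] at hvs
  rw [show R = Q + v by rw [← hvs]; abel, eval_add_of_mem hv, hQ]

/-- Moving the base point modulo invariant directions only shifts the parameter, so all lines in
direction `u` carry equally many zeros. -/
theorem card_zeros_eq_of_sup_span_eq_top {f : MvPolynomial (Fin (n + 1)) k}
    {u : Fin (n + 1) → k} (h : invariantDirections f ⊔ Submodule.span k {u} = ⊤) :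
    #(zeros f) = lineZeroCount f 0 u * Fintype.card k ^ n := by
  have hconst : ∀ P, lineZeroCount f P u = lineZeroCount f 0 u := by
    intro P
    obtain ⟨v, hv, s, rfl⟩ := exists_add_smul_of_sup_span_eq_top h P
    refine card_bij' (fun t _ => s + t) (fun t _ => t - s) ?_ ?_ ?_ ?_
    · intro t ht
      rw [mem_filter] at ht ⊢
      refine ⟨mem_univ _, ?_⟩
      rw [← ht.2, ← eval_add_of_mem hv (0 + (s + t) • u), add_smul]
      congr 2
      abel
    · intro t ht
      rw [mem_filter] at ht ⊢
      refine ⟨mem_univ _, ?_⟩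
      rw [← ht.2, ← eval_add_of_mem hv (0 + t • u), sub_smul]
      congr 2
      abel
    · intro t _
      abel
    · intro t _
      abel
  have hsum := sum_lineZeroCount f u
  rw [sum_congr rfl fun P _ => hconst P, sum_const, card_univ, Fintype.card_fun, Fintype.card_fin,
    smul_eq_mul, pow_succ] at hsum
  refine Nat.eq_of_mul_eq_mul_left (Fintype.card_pos : 0 < Fintype.card k) ?_
  rw [← hsum]
  ring

/-- The restriction of `f` to the plane through `P` spanned by `u` and `w`. -/
noncomputable def planeRestrict (P u w : Fin n → k) :
    MvPolynomial (Fin n) k →ₐ[k] MvPolynomial (Fin 2) k :=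
  aeval fun i => C (P i) + C (u i) * X 0 + C (w i) * X 1

theorem eval_planeRestrict (P u w : Fin n → k) (f : MvPolynomial (Fin n) k) (x : Fin 2 → k) :
    eval x (planeRestrict P u w f) = eval (P + x 0 • u + x 1 • w) f := by
  induction f using MvPolynomial.induction_on with
  | C a => simp [planeRestrict, algebraMap_eq]
  | add p q hp hq => rw [map_add, map_add, map_add, hp, hq]
  | mul_X p i hp =>
    rw [map_mul, map_mul, map_mul, hp, planeRestrict, aeval_X]
    simp [mul_comm]

theorem lineRestrict_planeRestrict (P u w : Fin n → k) (Q v : Fin 2 → k)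
    (f : MvPolynomial (Fin n) k) :
    lineRestrict Q v (planeRestrict P u w f) =
      lineRestrict (P + Q 0 • u + Q 1 • w) (v 0 • u + v 1 • w) f := by
  induction f using MvPolynomial.induction_on with
  | C a => simp [planeRestrict, lineRestrict, algebraMap_eq]
  | add p q hp hq => rw [map_add, map_add, map_add, hp, hq]
  | mul_X p i hp =>
    rw [map_mul, map_mul, map_mul, hp, planeRestrict, aeval_X]
    congr 1
    simp [lineRestrict]
    ring

theorem totalDegree_planeRestrict_le (P u w : Fin n → k) (f : MvPolynomial (Fin n) k) :
    (planeRestrict P u w f).totalDegree ≤ f.totalDegree := by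
  refine totalDegree_aeval_le _ (fun i => ?_) f
  refine (totalDegree_add _ _).trans (max_le ((totalDegree_add _ _).trans (max_le ?_ ?_)) ?_)
  · simp
  · exact totalDegree_C_mul_X_le _ _
  · exact totalDegree_C_mul_X_le _ _

theorem totalDegree_planeRestrict {u : Fin n → k} {f : MvPolynomial (Fin n) k} (hf : f ≠ 0)
    (h : dirDegree u f = f.totalDegree) (P w : Fin n → k) :
    (planeRestrict P u w f).totalDegree = f.totalDegree := by
  refine le_antisymm (totalDegree_planeRestrict_le P u w f) ?_
  have h1 := lineRestrict_planeRestrict P u w 0 ![1, 0] f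
  simp only [Matrix.cons_val_zero, Matrix.cons_val_one, one_smul, zero_smul, add_zero] at h1
  rw [← natDegree_lineRestrict_of_dirDegree_eq (P + (0 : Fin 2 → k) 0 • u + (0 : Fin 2 → k) 1 • w) u
    hf h, ← h1]
  exact (natDegree_lineRestrict_le _ _ _).trans (dirDegree_le_totalDegree _ _)

theorem sum_card_zeros_planeRestrict (u w : Fin n → k) (f : MvPolynomial (Fin n) k) :
    ∑ P, #(zeros (planeRestrict P u w f)) = Fintype.card k ^ 2 * #(zeros f) := by
  simp only [zeros, card_filter, eval_planeRestrict]
  rw [sum_comm]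
  have : ∀ x : Fin 2 → k, ∑ P : Fin n → k, (if eval (P + x 0 • u + x 1 • w) f = 0 then 1 else 0) =
      ∑ P : Fin n → k, if eval P f = 0 then 1 else 0 := by
    intro x
    simp only [add_assoc]
    exact Equiv.sum_comp (Equiv.addRight (x 0 • u + x 1 • w))
      fun P => if eval P f = 0 then 1 else 0
  rw [sum_congr rfl fun x _ => this x, sum_const, card_univ, Fintype.card_fun, Fintype.card_fin,
    smul_eq_mul]

/-- Averaging over all translates of the plane: the threshold in dimension `n + 2` is `q ^ n` times
the planar one. -/
theorem exists_planeRestrict_count {f : MvPolynomial (Fin (n + 2)) k} {e : ℕ}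
    (hN : e * Fintype.card k ^ (n + 1) ≤ #(zeros f) + (e - 1) * Fintype.card k ^ n)
    (u w : Fin (n + 2) → k) :
    ∃ P, e * Fintype.card k ≤ #(zeros (planeRestrict P u w f)) + (e - 1) := by
  by_contra! h
  have h1 := sum_lt_sum_of_nonempty (univ_nonempty (α := Fin (n + 2) → k)) fun P _ => h P
  rw [sum_add_distrib, sum_card_zeros_planeRestrict, sum_const, sum_const, card_univ,
    Fintype.card_fun, Fintype.card_fin, smul_eq_mul, smul_eq_mul] at h1
  have h2 := Nat.mul_le_mul_left (Fintype.card k ^ 2) hN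
  have e1 : Fintype.card k ^ 2 * (e * Fintype.card k ^ (n + 1)) =
      Fintype.card k ^ (n + 2) * (e * Fintype.card k) := by ring
  have e2 : Fintype.card k ^ 2 * (#(zeros f) + (e - 1) * Fintype.card k ^ n) =
      Fintype.card k ^ 2 * #(zeros f) + Fintype.card k ^ (n + 2) * (e - 1) := by ring
  rw [e1, e2] at h2
  omega

/-- Along the kernel of its linear part a linear polynomial is constant. -/
theorem dirDegree_eq_zero_of_linear {p : MvPolynomial (Fin n) k} (hp : p.totalDegree = 1)
    (hq : 1 < Fintype.card k) {v : Fin n → k}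
    (hv : ∑ i, coeff (Finsupp.single i 1) p * v i = 0) : dirDegree v p = 0 := by
  refine dirDegree_eq_zero_of_forall (by omega) fun P t => ?_
  rw [eval_eq_of_totalDegree_le_one hp.le, eval_eq_of_totalDegree_le_one hp.le]
  simp only [Pi.add_apply, Pi.smul_apply, smul_eq_mul, mul_add, sum_add_distrib]
  have : ∑ i, coeff (Finsupp.single i 1) p * (t * v i) = 0 := by
    rw [← mul_zero t, ← hv, mul_sum]
    exact sum_congr rfl fun i _ => by ring
  rw [this, add_zero]

/-- Full degree along `u` preserves the degrees of `f` and `g` on every plane containing `u`. On a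
plane with enough zeros the restriction of `g` has a linear factor `p`, and the direction of the
line `p = 0` lowers the degree of `g`. It does not lie among the invariant directions of `f`,
because the plane meets them only in zero. -/
theorem exists_intermediate_direction {f g : MvPolynomial (Fin (n + 2)) k}
    {u w : Fin (n + 2) → k} (h2 : 2 ≤ f.totalDegree) (hq : f.totalDegree < Fintype.card k)
    (hN : f.totalDegree * Fintype.card k ^ (n + 1) ≤
      #(zeros f) + (f.totalDegree - 1) * Fintype.card k ^ n)
    (hg : g ∣ f) (hg2 : 2 ≤ g.totalDegree) (hu : dirDegree u f = f.totalDegree)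
    (hw : w ∉ invariantDirections f ⊔ Submodule.span k {u}) :
    ∃ w', dirDegree w' g < g.totalDegree ∧ dirDegree w' f ≠ 0 := by
  have hf0 : f ≠ 0 := by
    rintro rfl
    simp at h2
  obtain ⟨h, rfl⟩ := hg
  have hg0 : g ≠ 0 := left_ne_zero_of_mul hf0
  have hh0 : h ≠ 0 := right_ne_zero_of_mul hf0
  have hug : dirDegree u g = g.totalDegree := by
    have h3 := dirDegree_le_totalDegree u g
    have h4 := dirDegree_le_totalDegree u h
    rw [dirDegree_mul u hg0 hh0, totalDegree_mul_of_isDomain hg0 hh0] at hu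
    omega
  obtain ⟨P, hP⟩ := exists_planeRestrict_count hN u w
  have hdf := totalDegree_planeRestrict hf0 hu P w
  have hdg := totalDegree_planeRestrict hg0 hug P w
  have hlin : AllLinear (planeRestrict P u w (g * h)) :=
    allLinear_of_plane_count (by omega) (by omega) (by rwa [hdf])
  have hgP0 : planeRestrict P u w g ≠ 0 := by
    intro h0
    rw [h0, totalDegree_zero] at hdg
    omega
  obtain ⟨p, hp, r, hr⟩ := WfDvdMonoid.exists_irreducible_factor
    (a := planeRestrict P u w g) (fun hunit => by
      have := (isUnit_iff_totalDegree_of_isReduced.mp hunit).2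
      omega) hgP0
  have hp1 : p.totalDegree = 1 := by
    refine hlin p hp ?_
    rw [map_mul, hr, mul_assoc]
    exact dvd_mul_right _ _
  have hr0 : r ≠ 0 := by
    rintro rfl
    exact hgP0 (by rw [hr, mul_zero])
  set v : Fin 2 → k := ![coeff (Finsupp.single 1 1) p, - coeff (Finsupp.single 0 1) p] with hv
  have hvp : dirDegree v p = 0 := by
    refine dirDegree_eq_zero_of_linear hp1 (by omega) ?_
    rw [Fin.sum_univ_two, hv]
    simp only [Matrix.cons_val_zero, Matrix.cons_val_one]
    ring
  have hv0 : ¬ (v 0 = 0 ∧ v 1 = 0) := by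
    rintro ⟨a0, a1⟩
    obtain ⟨i, hi⟩ := exists_coeff_single_ne_zero hp1
    fin_cases i
    · exact hi (neg_eq_zero.mp a1)
    · exact hi a0
  refine ⟨v 0 • u + v 1 • w, ?_, fun h0 => ?_⟩
  · refine lt_of_le_of_ne (dirDegree_le_totalDegree _ _) fun heq => ?_
    have h3 := natDegree_lineRestrict_of_dirDegree_eq
      (P + (0 : Fin 2 → k) 0 • u + (0 : Fin 2 → k) 1 • w) _ hg0 heq
    rw [← lineRestrict_planeRestrict] at h3
    have h4 := natDegree_lineRestrict_le 0 v (planeRestrict P u w g)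
    rw [h3, ← hdg, hr, dirDegree_mul v hp.ne_zero hr0, hvp,
      totalDegree_mul_of_isDomain hp.ne_zero hr0] at h4
    have h5 := dirDegree_le_totalDegree v r
    omega
  · have h3 := (mem_invariantDirections hq).mpr h0
    by_cases h1 : v 1 = 0
    · rw [h1, zero_smul, add_zero] at h3
      have h4 := (Submodule.smul_mem_iff _ fun a0 => hv0 ⟨a0, h1⟩).mp h3
      rw [mem_invariantDirections hq, hu] at h4
      omega
    · apply hw
      have h4 : w = (v 1)⁻¹ • ((v 0 • u + v 1 • w) - v 0 • u) := by
        rw [add_sub_cancel_left, smul_smul, inv_mul_cancel₀ h1, one_smul]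
      rw [h4]
      refine Submodule.smul_mem _ _ (Submodule.sub_mem _ (Submodule.mem_sup_left h3) ?_)
      exact Submodule.mem_sup_right (Submodule.smul_mem _ _ (Submodule.mem_span_singleton_self u))

theorem lineZeroCount_mul_le (g h : MvPolynomial (Fin n) k) (P w : Fin n → k) :
    lineZeroCount (g * h) P w ≤ lineZeroCount g P w + lineZeroCount h P w := by
  refine (card_le_card fun t ht => ?_).trans (card_union_le _ _)
  simpa using ht

/-- If `φ` has as many zeros as its degree allows, splits into linear factors, and its zeros are
zeros of `f`, then `φ` divides `f`. -/
theorem AllLinear.dvd_of_card_zeros {φ f : MvPolynomial (Fin (n + 1)) k} (hφ : AllLinear φ)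
    (hφ0 : φ ≠ 0) (hcard : #(zeros φ) = φ.totalDegree * Fintype.card k ^ n)
    (hq : f.totalDegree < Fintype.card k) (h : ∀ P, eval P φ = 0 → eval P f = 0) : φ ∣ f := by
  refine dvd_of_squarefree ?_ hφ0 fun p hp hpφ => ?_
  · rw [squarefree_iff_irreducible_sq_not_dvd_of_ne_zero hφ0]
    -- Dropping a repeated factor would keep all zeros and lower the degree, contradicting the upper
    -- bound for the number of zeros.
    rintro p hp ⟨c, rfl⟩
    have hp0 := hp.ne_zero
    have hc0 : c ≠ 0 := right_ne_zero_of_mul hφ0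
    have h1 : zeros (p * p * c) = zeros (p * c) := by
      ext P
      simp
    have h2 := card_zeros_le (mul_ne_zero hp0 hc0)
    rw [← h1, hcard, mul_assoc, totalDegree_mul_of_isDomain hp0 (mul_ne_zero hp0 hc0), add_mul] at h2
    have h3 : 0 < p.totalDegree * Fintype.card k ^ n :=
      Nat.mul_pos (Nat.pos_of_ne_zero (totalDegree_ne_zero_of_irreducible hp))
        (pow_pos Fintype.card_pos _)
    omega
  · refine dvd_of_zeros_subset (hφ p hp hpφ) hq fun P hP => h P ?_
    obtain ⟨c, rfl⟩ := hpφ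
    rw [map_mul, hP, zero_mul]

/-- A polynomial of degree `e < q` with at least `e q ^ (n + 1) - (e - 1) q ^ n` zeros is a
product of linear factors. -/
theorem allLinear_of_count {f : MvPolynomial (Fin (n + 2)) k} (h2 : 2 ≤ f.totalDegree)
    (hq : f.totalDegree < Fintype.card k)
    (hN : f.totalDegree * Fintype.card k ^ (n + 1) ≤
      #(zeros f) + (f.totalDegree - 1) * Fintype.card k ^ n) : AllLinear f := by
  induction hd : f.totalDegree using Nat.strong_induction_on generalizing f with
  | _ e ih =>
  subst hd
  have hf0 : f ≠ 0 := by
    rintro rfl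
    simp at h2
  intro g hg hgf
  by_contra hg1
  have hg2 : 2 ≤ g.totalDegree := by
    have := totalDegree_ne_zero_of_irreducible hg
    omega
  obtain ⟨u, hu⟩ := exists_dirDegree_eq_totalDegree hf0 hq
  by_cases htop : invariantDirections f ⊔ Submodule.span k {u} = ⊤
  · have hcount := card_zeros_eq_of_sup_span_eq_top htop
    -- The number of zeros is a multiple of `q ^ (n + 1)`, and `(e - 1) q ^ n < q ^ (n + 1)`; so the
    -- threshold already forces the maximum `e q ^ (n + 1)`.
    have hle : f.totalDegree ≤ lineZeroCount f 0 u := by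
      by_contra! hlt
      have h3 : lineZeroCount f 0 u * Fintype.card k ^ (n + 1) ≤
          (f.totalDegree - 1) * Fintype.card k ^ (n + 1) := Nat.mul_le_mul_right _ (by omega)
      have h4 : (f.totalDegree - 1) * Fintype.card k ^ n < Fintype.card k ^ (n + 1) := by
        rw [pow_succ, mul_comm]
        exact Nat.mul_lt_mul_of_pos_left (by omega) (pow_pos Fintype.card_pos _)
      have h5 : f.totalDegree * Fintype.card k ^ (n + 1) =
          (f.totalDegree - 1) * Fintype.card k ^ (n + 1) + Fintype.card k ^ (n + 1) := by
        rw [← Nat.succ_mul]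
        congr 1
        omega
      omega
    obtain ⟨h, rfl⟩ := hgf
    have hh0 : h ≠ 0 := right_ne_zero_of_mul hf0
    have hlr : lineRestrict 0 u (g * h) ≠ 0 := by
      intro h0
      have h3 := natDegree_lineRestrict_of_dirDegree_eq 0 u hf0 hu
      rw [h0, Polynomial.natDegree_zero] at h3
      omega
    rw [map_mul] at hlr
    have h3 := lineZeroCount_le_dirDegree (right_ne_zero_of_mul hlr)
    have h4 := dirDegree_le_totalDegree u h
    have h5 := lineZeroCount_mul_le g h 0 u
    have h6 := totalDegree_mul_of_isDomain hg.ne_zero hh0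
    -- The cofactor `h` has at most `h.totalDegree` zeros on this line, so some zero must come from
    -- `g`.
    have hpos : 0 < lineZeroCount g 0 u := by omega
    obtain ⟨t, ht⟩ := card_pos.mp hpos
    have hle' := invariantDirections_le_of_dvd hf0 hq (dvd_mul_right g h)
    obtain ⟨p, hp1, hpg⟩ := exists_linear_dvd (g := g) (u := u) (Q := 0 + t • u) (by omega)
      (top_le_iff.mp (htop ▸ sup_le_sup_right hle' _)) (fun hmem => by
        rw [mem_invariantDirections (by omega)] at hmem
        rw [dirDegree_mul u hg.ne_zero hh0] at hu
        omega) (mem_filter.mp ht).2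
    obtain ⟨c, hc⟩ := hpg
    have hcu := (hg.isUnit_or_isUnit hc).resolve_left (irreducible_of_totalDegree_one hp1).not_isUnit
    have hp0 : p * c ≠ 0 := hc ▸ hg.ne_zero
    have h7 := totalDegree_mul_of_isDomain (left_ne_zero_of_mul hp0) (right_ne_zero_of_mul hp0)
    rw [← hc, (isUnit_iff_totalDegree_of_isReduced.mp hcu).2] at h7
    omega
  · obtain ⟨w, hw⟩ : ∃ w, w ∉ invariantDirections f ⊔ Submodule.span k {u} := by
      by_contra! hall
      exact htop (eq_top_iff.mpr fun w _ => hall w)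
    obtain ⟨w', hw'g, hw'f⟩ := exists_intermediate_direction h2 hq hN hgf hg2 hu hw
    have hlt : dirDegree w' f < f.totalDegree := by
      obtain ⟨h, rfl⟩ := hgf
      have hh0 : h ≠ 0 := right_ne_zero_of_mul hf0
      rw [dirDegree_mul w' hg.ne_zero hh0, totalDegree_mul_of_isDomain hg.ne_zero hh0]
      have := dirDegree_le_totalDegree w' h
      omega
    obtain ⟨-, hcard, hdeg, hzeros⟩ := zeros_of_dirDegree hq hw'f hlt hN
    have hφ0 : (dirShift w' f).leadingCoeff ≠ 0 :=
      Polynomial.leadingCoeff_ne_zero.mpr (dirShift_ne_zero w' hf0)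
    have hφw := dirDegree_leadingCoeff (w := w') hq
    set φ := (dirShift w' f).leadingCoeff with hφ
    have hφlin : AllLinear φ := by
      rcases Nat.lt_or_ge φ.totalDegree 2 with h3 | h3
      · exact allLinear_of_totalDegree_le_one hφ0 (by omega)
      -- The degree of `φ` is smaller by `dirDegree w' f ≠ 0`, and its number of zeros is maximal,
      -- hence above the threshold.
      · exact ih φ.totalDegree (by omega) h3 (by omega)
          (by rw [hcard, hdeg]; exact Nat.le_add_right _ _) rfl
    obtain ⟨χ, hχ⟩ := hφlin.dvd_of_card_zeros hφ0 (by rw [hcard, hdeg]) hq hzeros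
    have hχ0 : χ ≠ 0 := by
      rintro rfl
      exact hf0 (by rw [hχ, mul_zero])
    have h3 := dirDegree_mul w' hφ0 hχ0
    have h4 := totalDegree_mul_of_isDomain hφ0 hχ0
    rw [← hχ] at h3 h4
    rw [hχ] at hgf
    rcases hg.prime.dvd_or_dvd hgf with hgφ | ⟨c, rfl⟩
    · exact hg1 (hφlin g hg hgφ)
    -- As `φ` is invariant along `w'`, the cofactor `χ` carries the whole directional degree and has
    -- full degree along `w'`. So have all its factors, but `g` has not.
    · have hc0 : c ≠ 0 := right_ne_zero_of_mul hχ0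
      rw [dirDegree_mul w' hg.ne_zero hc0] at h3
      rw [totalDegree_mul_of_isDomain hg.ne_zero hc0] at h4
      have := dirDegree_le_totalDegree w' c
      omega

/-- There is a gap in the possible numbers of zeros of a polynomial of degree `e < q`. -/
theorem card_zeros_add_le {f : MvPolynomial (Fin (n + 2)) k} (h2 : 2 ≤ f.totalDegree)
    (hq : f.totalDegree < Fintype.card k)
    (hlt : #(zeros f) < f.totalDegree * Fintype.card k ^ (n + 1)) :
    #(zeros f) + (f.totalDegree - 1) * Fintype.card k ^ n ≤
      f.totalDegree * Fintype.card k ^ (n + 1) := by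
  by_contra! hN
  have hf0 : f ≠ 0 := by
    rintro rfl
    simp at h2
  have hlin := allLinear_of_count h2 hq hN.le
  obtain ⟨p, hp, c, hc⟩ := WfDvdMonoid.exists_irreducible_factor (a := f) (fun hunit => by
    have := (isUnit_iff_totalDegree_of_isReduced.mp hunit).2
    omega) hf0
  have hp1 : p.totalDegree = 1 := hlin p hp ⟨c, hc⟩
  have hc0 : c ≠ 0 := by
    rintro rfl
    exact hf0 (by rw [hc, mul_zero])
  have hdeg := totalDegree_mul_of_isDomain hp.ne_zero hc0
  rw [← hc] at hdeg
  have hker : ∀ w : Fin (n + 2) → k, ∑ i, coeff (Finsupp.single i 1) p * w i = 0 →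
      w ∈ invariantDirections f := by
    intro w hw
    rw [mem_invariantDirections hq]
    by_contra h0
    have h3 := dirDegree_eq_zero_of_linear hp1 (by omega) hw
    have h4 := dirDegree_mul w hp.ne_zero hc0
    rw [← hc, h3] at h4
    have h5 := dirDegree_le_totalDegree w c
    -- A degree strictly between `0` and `e` would force equality in the count, which is strict
    -- here. So the kernel of the linear part of `p` consists of invariant directions.
    exact hN.ne (zeros_of_dirDegree hq h0 (by omega) hN.le).1
  obtain ⟨u, hu⟩ := exists_dirDegree_eq_totalDegree hf0 hq
  set Λ : (Fin (n + 2) → k) → k := fun w => ∑ i, coeff (Finsupp.single i 1) p * w i with hΛ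
  have hΛu : Λ u ≠ 0 := by
    intro h0
    have h3 := (mem_invariantDirections hq).mp (hker u h0)
    omega
  have htop : invariantDirections f ⊔ Submodule.span k {u} = ⊤ := by
    refine eq_top_iff.mpr fun w _ => ?_
    have h3 : w = (w - (Λ w / Λ u) • u) + (Λ w / Λ u) • u := by abel
    rw [h3]
    refine Submodule.add_mem_sup (hker _ ?_)
      (Submodule.smul_mem _ _ (Submodule.mem_span_singleton_self u))
    have h4 : ∑ i, coeff (Finsupp.single i 1) p * (w - (Λ w / Λ u) • u) i =
        Λ w - (Λ w / Λ u) * Λ u := by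
      simp only [hΛ, Pi.sub_apply, Pi.smul_apply, smul_eq_mul, mul_sub, sum_sub_distrib, mul_sum]
      congr 1
      exact sum_congr rfl fun i _ => by ring
    rw [h4, div_mul_cancel₀ _ hΛu, sub_self]
  have hcount := card_zeros_eq_of_sup_span_eq_top htop
  rw [hcount] at hlt hN
  have h3 := lt_of_mul_lt_mul_right hlt (Nat.zero_le _)
  have h4 : lineZeroCount f 0 u * Fintype.card k ^ (n + 1) ≤
      (f.totalDegree - 1) * Fintype.card k ^ (n + 1) := Nat.mul_le_mul_right _ (by omega)
  have h5 : (f.totalDegree - 1) * Fintype.card k ^ n < Fintype.card k ^ (n + 1) := by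
    rw [pow_succ, mul_comm]
    exact Nat.mul_lt_mul_of_pos_left (by omega) (pow_pos Fintype.card_pos _)
  have h6 : f.totalDegree * Fintype.card k ^ (n + 1) =
      (f.totalDegree - 1) * Fintype.card k ^ (n + 1) + Fintype.card k ^ (n + 1) := by
    rw [← Nat.succ_mul]
    congr 1
    omega
  omega

end Main

/-! ### The affine chart complementary to the hyperplane -/

section Projective

open MvPolynomial Finset

open scoped LinearAlgebra.Projectivization

set_option linter.unusedSectionVars false

variable {k F K : Type*} [Field k] [Field F] [Algebra k F] [Field K] [Algebra k K] {m : ℕ}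

/-- The linear form with coefficients `a`. -/
noncomputable abbrev linForm (a : Fin (m + 1) → k) : MvPolynomial (Fin (m + 1)) k :=
  ∑ i, C (a i) * X i

theorem isHomogeneous_linForm (a : Fin (m + 1) → k) : (linForm a).IsHomogeneous 1 :=
  IsHomogeneous.sum _ _ _ fun i _ => isHomogeneous_C_mul_X (a i) i

theorem aeval_linForm {A : Type*} [CommRing A] [Algebra k A] (a : Fin (m + 1) → k)
    (x : Fin (m + 1) → A) : aeval x (linForm a) = ∑ i, algebraMap k A (a i) * x i := by
  simp [linForm]

theorem totalDegree_linForm {a : Fin (m + 1) → k} (ha : a ≠ 0) : (linForm a).totalDegree = 1 := by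
  simpa using totalDegree_sum_sub ha 0

/-- The coordinates of the affine chart `∑ aᵢ xᵢ = 1`, parametrized by all coordinates but
the one with index `i`. -/
noncomputable def chartPoly (a : Fin (m + 1) → k) (i : Fin (m + 1)) :
    Fin (m + 1) → MvPolynomial (Fin m) k :=
  i.insertNth (C (a i)⁻¹ * (1 - ∑ j, C (a (i.succAbove j)) * X j)) X

/-- The point of the affine chart `∑ aᵢ xᵢ = 1` with parameter `y`. -/
noncomputable def chart (a : Fin (m + 1) → k) (i : Fin (m + 1)) (y : Fin m → F) : Fin (m + 1) → F :=
  fun j => aeval y (chartPoly a i j)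

variable {a : Fin (m + 1) → k} {i : Fin (m + 1)}

theorem aeval_chart (y : Fin m → F) (P : MvPolynomial (Fin (m + 1)) k) :
    aeval (chart a i y) P = aeval y (aeval (chartPoly a i) P) :=
  (comp_aeval_apply (chartPoly a i) (aeval y) P).symm

theorem chart_succAbove (y : Fin m → F) (j : Fin m) : chart a i y (i.succAbove j) = y j := by
  simp [chart, chartPoly]

theorem aeval_chartPoly_linForm (hi : a i ≠ 0) : aeval (chartPoly a i) (linForm a) = 1 := by
  rw [aeval_linForm, Fin.sum_univ_succAbove _ i]
  simp only [chartPoly, Fin.insertNth_apply_same, Fin.insertNth_apply_succAbove, algebraMap_eq]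
  rw [← mul_assoc, ← C_mul, mul_inv_cancel₀ hi, C_1, one_mul, sub_add_cancel]

theorem aeval_chart_linForm (hi : a i ≠ 0) (y : Fin m → F) :
    aeval (chart a i y) (linForm a) = 1 := by
  rw [aeval_chart, aeval_chartPoly_linForm hi, map_one]

theorem chart_ne_zero (hi : a i ≠ 0) (y : Fin m → F) : chart a i y ≠ 0 := by
  intro h
  have := aeval_chart_linForm hi y
  rw [h, aeval_linForm] at this
  simp at this

theorem chart_injective : Function.Injective (chart a i : (Fin m → F) → Fin (m + 1) → F) := by
  intro y z h
  funext j
  rw [← chart_succAbove (a := a) (i := i) y, h, chart_succAbove]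

theorem exists_chart_eq (hi : a i ≠ 0) {x : Fin (m + 1) → F} (hx : aeval x (linForm a) = 1) :
    ∃ y, chart a i y = x := by
  refine ⟨fun j => x (i.succAbove j), ?_⟩
  have hi' : algebraMap k F (a i) ≠ 0 := by simpa using hi
  have h1 := aeval_chart_linForm (F := F) hi fun j => x (i.succAbove j)
  rw [← hx, aeval_linForm, aeval_linForm, Fin.sum_univ_succAbove _ i,
    Fin.sum_univ_succAbove _ i] at h1
  simp only [chart_succAbove] at h1
  have h2 := mul_left_cancel₀ hi' (add_right_cancel h1)
  funext j
  rcases Fin.eq_self_or_eq_succAbove i j with rfl | ⟨j, rfl⟩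
  · exact h2
  · rw [chart_succAbove]

/-- The point of projective space with parameter `y` in the affine chart `∑ aᵢ xᵢ = 1`. -/
noncomputable def chartPoint (hi : a i ≠ 0) (y : Fin m → F) : ProjSpace F m :=
  Projectivization.mk F (chart a i y) (chart_ne_zero hi y)

theorem chartPoint_mem (hi : a i ≠ 0) {P : MvPolynomial (Fin (m + 1)) k} {d : ℕ}
    (hP : P.IsHomogeneous d) (y : Fin m → F) :
    chartPoint hi y ∈ projZeroSet F P ↔ aeval y (aeval (chartPoly a i) P) = 0 := by
  rw [chartPoint, mk_mem_projZeroSet_iff hP, aeval_chart]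

theorem chartPoint_injective (hi : a i ≠ 0) :
    Function.Injective (chartPoint hi : (Fin m → F) → ProjSpace F m) := by
  intro y z h
  obtain ⟨c, hc⟩ := (Projectivization.mk_eq_mk_iff' F _ _ _ _).mp h
  have h1 := aeval_chart_linForm hi y
  have h2 := aeval_chart_linForm hi z
  rw [aeval_linForm] at h1 h2
  have hc1 : c = 1 := by
    rw [← hc] at h1
    simp only [Pi.smul_apply, smul_eq_mul, mul_left_comm _ c, ← mul_sum] at h1
    rwa [h2, mul_one] at h1
  rw [hc1, one_smul] at hc
  exact (chart_injective hc).symm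

theorem exists_chartPoint_eq (hi : a i ≠ 0) {x : ProjSpace F m}
    (hx : x ∉ projZeroSet F (linForm a)) : ∃ y, chartPoint hi y = x := by
  induction x using Projectivization.ind with
  | h v hv =>
  rw [mk_mem_projZeroSet_iff (isHomogeneous_linForm a), aeval_linForm] at hx
  set c := ∑ i, algebraMap k F (a i) * v i with hc
  obtain ⟨y, hy⟩ := exists_chart_eq (a := a) (i := i) hi (x := c⁻¹ • v) (by
    rw [aeval_linForm, ← inv_mul_cancel₀ hx, hc, mul_sum]
    exact sum_congr rfl fun j _ => by
      rw [Pi.smul_apply, smul_eq_mul]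
      ring)
  refine ⟨y, ?_⟩
  rw [chartPoint, Projectivization.mk_eq_mk_iff']
  exact ⟨c⁻¹, hy.symm⟩

theorem totalDegree_chartPoly_le (j : Fin (m + 1)) : (chartPoly a i j).totalDegree ≤ 1 := by
  rcases Fin.eq_self_or_eq_succAbove i j with rfl | ⟨j, rfl⟩
  · rw [chartPoly, Fin.insertNth_apply_same]
    refine (totalDegree_mul _ _).trans ?_
    rw [totalDegree_C, zero_add]
    refine (totalDegree_sub _ _).trans (max_le (by simp) (totalDegree_finsetSum_le fun j _ => ?_))
    exact (totalDegree_mul _ _).trans (by simp)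
  · rw [chartPoly, Fin.insertNth_apply_succAbove]
    simp

theorem eq_zero_of_forall_aeval [Infinite K] {σ : Type*} {g : MvPolynomial σ k}
    (h : ∀ x : σ → K, aeval x g = 0) : g = 0 := by
  apply map_injective (algebraMap k K) (algebraMap k K).injective
  rw [map_zero]
  refine MvPolynomial.funext fun x => ?_
  rw [eval_map, ← aeval_def, h, map_zero]

/-- The origin is no projective point; there `Q` vanishes because its degree is positive. -/
theorem aeval_eq_zero_of_projZeroSet_subset {P Q : MvPolynomial (Fin (m + 1)) k} {d e : ℕ}
    (hP : P.IsHomogeneous d) (hQ : Q.IsHomogeneous e) (he : e ≠ 0)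
    (h : projZeroSet K P ⊆ projZeroSet K Q) {x : Fin (m + 1) → K} (hx : aeval x P = 0) :
    aeval x Q = 0 := by
  by_cases hx0 : x = 0
  · rw [hx0, aeval_def, eval₂_eq]
    refine sum_eq_zero fun s hs => ?_
    have hs1 := hQ (mem_support_iff.mp hs)
    obtain ⟨j, hj⟩ : ∃ j, s j ≠ 0 := by
      by_contra! h0
      apply he
      rw [← hs1, (DFunLike.ext s 0 h0 : s = 0), map_zero]
    rw [prod_eq_zero (Finsupp.mem_support_iff.mpr hj) (by simp [hj]), mul_zero]
  · rw [← mk_mem_projZeroSet_iff hQ x hx0]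
    exact h ((mk_mem_projZeroSet_iff hP x hx0).mpr hx)

theorem linForm_dvd_of_subset [Infinite K] {P : MvPolynomial (Fin (m + 1)) k} {d : ℕ}
    (ha : a ≠ 0) (hP : P.IsHomogeneous d) (hd : d ≠ 0)
    (h : projZeroSet K (linForm a) ⊆ projZeroSet K P) : linForm a ∣ P :=
  dvd_of_forall_aeval_eq_zero (K := K) (totalDegree_linForm ha)
    (fun _ _ hg => eq_zero_of_forall_aeval hg)
    fun _ hx => aeval_eq_zero_of_projZeroSet_subset (isHomogeneous_linForm a) hP hd h hx

theorem aeval_chartPoly_ne_zero [Infinite K] {P : MvPolynomial (Fin (m + 1)) k} {d : ℕ}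
    (hi : a i ≠ 0) (hP0 : P ≠ 0) (hP : P.IsHomogeneous d) (hd : d ≠ 0)
    (h : projZeroSet K (linForm a) ⊆ projZeroSet K P) : aeval (chartPoly a i) P ≠ 0 := by
  intro hf
  refine hP0 (eq_zero_of_forall_aeval (K := K) fun x => ?_)
  have hz : (0 : MvPolynomial (Fin (m + 1)) k).IsHomogeneous d := isHomogeneous_zero _ _ _
  -- Applied to the zero form, whose zero set is the whole space: `P` vanishes on the hyperplane and
  -- on its complement.
  refine aeval_eq_zero_of_projZeroSet_subset hz hP hd (fun x _ => ?_) (map_zero _)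
  by_cases hx : x ∈ projZeroSet K (linForm a)
  · exact h hx
  · obtain ⟨y, rfl⟩ := exists_chartPoint_eq hi hx
    rw [chartPoint_mem hi hP, hf, map_zero]

theorem rationalPoints_projZeroSet {P : MvPolynomial (Fin (m + 1)) k} {d : ℕ}
    (hP : P.IsHomogeneous d) : rationalPoints k (projZeroSet K P) = projZeroSet k P := by
  ext x
  induction x using Projectivization.ind with
  | h v hv =>
  have hv' : (fun i => algebraMap k K (v i)) ≠ 0 := fun h0 =>
    hv (funext fun i => (algebraMap k K).injective ((congrFun h0 i).trans (map_zero _).symm))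
  have h1 : rationalInclusion k K m (Projectivization.mk k v hv) =
      Projectivization.mk K (fun i => algebraMap k K (v i)) hv' := rfl
  have h2 : aeval (fun i => algebraMap k K (v i)) P = algebraMap k K (aeval v P) :=
    aeval_algebraMap_apply _ _ _
  change rationalInclusion k K m (Projectivization.mk k v hv) ∈ projZeroSet K P ↔ _
  rw [h1, mk_mem_projZeroSet_iff hP, mk_mem_projZeroSet_iff hP, h2, map_eq_zero]

theorem exists_irreducible_factor_of_aeval_eq_zero {σ : Type*} {f : MvPolynomial σ k} (hf : f ≠ 0)
    {y : σ → K} (hy : aeval y f = 0) : ∃ p, Irreducible p ∧ p ∣ f ∧ aeval y p = 0 := by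
  induction f using WfDvdMonoid.induction_on_irreducible with
  | zero => exact absurd rfl hf
  | unit u hu => exact absurd hy (hu.map (aeval y)).ne_zero
  | mul b p hb hp ih =>
    rw [map_mul] at hy
    rcases mul_eq_zero.mp hy with h | h
    · exact ⟨p, hp, dvd_mul_right p b, h⟩
    · obtain ⟨r, hr, hrb, hry⟩ := ih hb h
      exact ⟨r, hr, hrb.mul_left p, hry⟩

/-- The projective closure of a hyperplane of the affine chart. -/
theorem exists_linForm_of_totalDegree_eq_one (hi : a i ≠ 0) {p : MvPolynomial (Fin m) k}
    (hp : p.totalDegree = 1) :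
    ∃ b : Fin (m + 1) → k, b ≠ 0 ∧ aeval (chartPoly a i) (linForm b) = p := by
  set c : Fin (m + 1) → k := i.insertNth 0 fun j => coeff (Finsupp.single j 1) p with hc
  -- On the chart `linForm a` equals one, so the constant term of `p` is homogenized as a multiple
  -- of `linForm a`.
  refine ⟨coeff 0 p • a + c, fun h => ?_, ?_⟩
  · have h0 := congrFun h i
    simp only [hc, Pi.add_apply, Pi.smul_apply, Fin.insertNth_apply_same, add_zero, smul_eq_mul,
      Pi.zero_apply, mul_eq_zero, hi, or_false] at h0
    obtain ⟨j, hj⟩ := exists_coeff_single_ne_zero hp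
    have h1 := congrFun h (i.succAbove j)
    simp only [hc, Pi.add_apply, Fin.insertNth_apply_succAbove, h0, zero_smul,
      zero_add, Pi.zero_apply] at h1
    exact hj h1
  · have h1 : linForm (coeff 0 p • a + c) = C (coeff 0 p) * linForm a + linForm c := by
      simp only [linForm, Pi.add_apply, Pi.smul_apply, smul_eq_mul, C_add, C_mul, add_mul,
        sum_add_distrib, mul_sum, mul_assoc]
    rw [h1, map_add, map_mul, aeval_chartPoly_linForm hi, aeval_linForm c,
      Fin.sum_univ_succAbove _ i]
    conv_rhs => rw [eq_linear_of_totalDegree_le_one hp.le]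
    simp [hc, chartPoly, algebraMap_eq]

theorem eq_sUnion_of_allLinear {P : MvPolynomial (Fin (m + 1)) k} {d : ℕ} (hi : a i ≠ 0)
    (hP : P.IsHomogeneous d) (h : projZeroSet K (linForm a) ⊆ projZeroSet K P)
    (hf0 : aeval (chartPoly a i) P ≠ 0) (hf : AllLinear (aeval (chartPoly a i) P)) :
    ∃ S : Set (Set (ProjSpace K m)), (∀ H ∈ S, IsHyperplane k H) ∧ projZeroSet K P = ⋃₀ S := by
  refine ⟨{H | IsHyperplane k H ∧ H ⊆ projZeroSet K P}, fun H hH => hH.1,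
    Set.Subset.antisymm (fun x hx => ?_) (Set.sUnion_subset fun H hH => hH.2)⟩
  have ha : a ≠ 0 := fun h0 => hi (congrFun h0 i)
  by_cases hxa : x ∈ projZeroSet K (linForm a)
  · exact Set.mem_sUnion.mpr ⟨_, ⟨⟨a, ha, rfl⟩, h⟩, hxa⟩
  obtain ⟨y, rfl⟩ := exists_chartPoint_eq hi hxa
  rw [chartPoint_mem hi hP] at hx
  obtain ⟨p, hp, hpf, hpy⟩ := exists_irreducible_factor_of_aeval_eq_zero hf0 hx
  obtain ⟨b, hb, hbp⟩ := exists_linForm_of_totalDegree_eq_one hi (hf p hp hpf)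
  refine Set.mem_sUnion.mpr ⟨projZeroSet K (linForm b), ⟨⟨b, hb, rfl⟩, fun z hz => ?_⟩, ?_⟩
  · by_cases hza : z ∈ projZeroSet K (linForm a)
    · exact h hza
    · obtain ⟨w, rfl⟩ := exists_chartPoint_eq hi hza
      rw [chartPoint_mem hi (isHomogeneous_linForm b), hbp] at hz
      rw [chartPoint_mem hi hP]
      obtain ⟨c, hc⟩ := hpf
      rw [hc, map_mul, hz, zero_mul]
  · rw [chartPoint_mem hi (isHomogeneous_linForm b), hbp, hpy]

variable [Fintype k] [DecidableEq k]

/-- The complement is counted: it lies in the chart and corresponds to the affine points where `f`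
does not vanish. -/
theorem ncard_projZeroSet {P : MvPolynomial (Fin (m + 2)) k} {a : Fin (m + 2) → k}
    {i : Fin (m + 2)} {d : ℕ} (hi : a i ≠ 0) (hP : P.IsHomogeneous d) (h : linForm a ∣ P) :
    (projZeroSet k P).ncard =
      projCount (Fintype.card k) m + #(zeros (aeval (chartPoly a i) P)) := by
  have : Finite (ProjSpace k (m + 1)) := inferInstance
  set f := aeval (chartPoly a i) P with hf
  have hcompl : (projZeroSet k P)ᶜ =
      (chartPoint hi : (Fin (m + 1) → k) → _) '' ((zeros f : Finset (Fin (m + 1) → k)) : Set (Fin (m + 1) → k))ᶜ := by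
    ext x
    constructor
    · intro hx
      have hxa : x ∉ projZeroSet k (linForm a) := by
        intro hxa
        apply hx
        obtain ⟨c, rfl⟩ := h
        have hxa' : aeval x.rep (linForm a) = 0 := hxa
        show aeval x.rep (linForm a * c) = 0
        rw [map_mul, hxa', zero_mul]
      obtain ⟨y, rfl⟩ := exists_chartPoint_eq hi hxa
      refine ⟨y, fun hy => hx ?_, rfl⟩
      rw [chartPoint_mem hi hP, aeval_eq_eval]
      exact mem_zeros.mp hy
    · rintro ⟨y, hy, rfl⟩ hx
      rw [chartPoint_mem hi hP, aeval_eq_eval] at hx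
      exact hy (mem_zeros.mpr hx)
  have h1 := Set.ncard_add_ncard_compl (projZeroSet k P)
  have h2 := Set.ncard_add_ncard_compl ((zeros f : Finset (Fin (m + 1) → k)) : Set (Fin (m + 1) → k))
  rw [hcompl, Set.ncard_image_of_injective _ (chartPoint_injective hi),
    Projectivization.card_of_finrank k (Fin (m + 2) → k) (n := m + 2) (by simp)] at h1
  rw [Set.ncard_coe_finset, Nat.card_eq_fintype_card, Fintype.card_fun, Fintype.card_fin] at h2
  rw [sum_range_succ, Nat.card_eq_fintype_card] at h1
  rw [projCount]
  omega

end Projective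

theorem mainTheorem7 {k : Type*} {K : Type*} [Field k] [Finite k] [Field K] [Algebra k K]
    [IsAlgClosure k K] (q m d : ℕ) (hq : Nat.card k = q) (hm : 2 ≤ m) (hd : 3 ≤ d) (hdq : d ≤ q)
    (X : Set (ProjSpace K m)) (hX : IsHypersurface k d X)
    (hplane : ∃ H : Set (ProjSpace K m), IsHyperplane k H ∧ H ⊆ X) :
    ((rationalPoints k X).ncard < d * q ^ (m - 1) + projCount q (m - 2) →
      ((rationalPoints k X).ncard : ℤ) ≤
        (d : ℤ) * (q : ℤ) ^ (m - 1) + (projCount q (m - 2) : ℤ)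
          - ((d : ℤ) - 2) * (q : ℤ) ^ (m - 2)) ∧
    (((rationalPoints k X).ncard : ℤ) =
        (d : ℤ) * (q : ℤ) ^ (m - 1) + (projCount q (m - 2) : ℤ)
          - ((d : ℤ) - 2) * (q : ℤ) ^ (m - 2) →
      ∃ S : Set (Set (ProjSpace K m)), (∀ H ∈ S, IsHyperplane k H) ∧ X = ⋃₀ S) := by
  classical
  have := Fintype.ofFinite k
  have hKinf : Infinite K := by
    have := IsAlgClosure.isAlgClosed k (K := K)
    exact IsAlgClosed.instInfinite
  rw [Nat.card_eq_fintype_card] at hq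
  obtain ⟨n, rfl⟩ : ∃ n, m = n + 2 := ⟨m - 2, by omega⟩
  obtain ⟨P, hP0, hP, rfl⟩ := hX
  obtain ⟨H, ⟨a, ha, rfl⟩, hH⟩ := hplane
  obtain ⟨i, hi⟩ : ∃ i, a i ≠ 0 := Function.ne_iff.mp ha
  have hdvd : linForm a ∣ P := linForm_dvd_of_subset ha hP (by omega) hH
  have hf0 := aeval_chartPoly_ne_zero hi hP0 hP (by omega) hH
  have hdeg : (MvPolynomial.aeval (chartPoly a i) P).totalDegree ≤ d - 1 := by
    obtain ⟨Q, rfl⟩ := hdvd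
    rw [map_mul, aeval_chartPoly_linForm hi, one_mul]
    refine (totalDegree_aeval_le _ totalDegree_chartPoly_le Q).trans ?_
    have h1 := hP.totalDegree hP0
    rw [MvPolynomial.totalDegree_mul_of_isDomain (left_ne_zero_of_mul hP0)
      (right_ne_zero_of_mul hP0), totalDegree_linForm ha] at h1
    omega
  have hcard := ncard_projZeroSet hi hP hdvd
  have hunion := eq_sUnion_of_allLinear hi hP hH hf0
  rw [rationalPoints_projZeroSet hP, hcard]
  set f := MvPolynomial.aeval (chartPoly a i) P with hf
  rw [hq] at hcard ⊢
  have hsucc : projCount q (n + 1) = projCount q n + q ^ (n + 1) := Finset.sum_range_succ _ _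
  -- Now `e = d - 1 = c + 2`, and the gap `d - 2` is `e - 1 = c + 1`.
  obtain ⟨c, rfl⟩ : ∃ c, d = c + 3 := ⟨d - 3, by omega⟩
  have hpow : (c + 1) * q ^ n < q ^ (n + 1) := by
    rw [pow_succ, mul_comm]
    exact Nat.mul_lt_mul_of_pos_left (by omega) (pow_pos (by omega) n)
  -- The degree drops when `P` contains the hyperplane with multiplicity. By `hpow` the number of
  -- zeros is then strictly below the threshold.
  have hsmall : f.totalDegree ≠ c + 2 → (zeros f).card ≤ (c + 1) * q ^ (n + 1) := by
    intro hne
    have h1 := card_zeros_le hf0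
    rw [hq] at h1
    exact h1.trans (Nat.mul_le_mul_right _ (by omega))
  have hsplit : (c + 2) * q ^ (n + 1) = (c + 1) * q ^ (n + 1) + q ^ (n + 1) := by ring
  have hsplit' : (c + 3) * q ^ (n + 1) = (c + 2) * q ^ (n + 1) + q ^ (n + 1) := by ring
  simp only [show n + 2 - 1 = n + 1 from rfl, show n + 2 - 2 = n from rfl, hsucc]
  refine ⟨fun hlt => ?_, fun heq => hunion ?_⟩
  · have h1 : (zeros f).card + (c + 1) * q ^ n ≤ (c + 2) * q ^ (n + 1) := by
      by_cases hd' : f.totalDegree = c + 2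
      · have h2 := card_zeros_add_le (f := f) (by omega) (by omega) (by rw [hd', hq]; omega)
        rwa [hd', hq] at h2
      · have := hsmall hd'
        omega
    zify at h1
    push_cast
    linarith
  · have h1 : (zeros f).card + (c + 1) * q ^ n = (c + 2) * q ^ (n + 1) := by
      push_cast at heq
      zify
      linarith
    have hd' : f.totalDegree = c + 2 := by
      by_contra hd'
      have := hsmall hd'
      omega
    exact allLinear_of_count (by omega) (by omega) (by rw [hd', hq]; exact h1.ge)
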